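/- **Setting.** Let $H_1,H_2$ be real Hilbert spaces, $K:H_1\to H_2$ a continuous linear operator, $(e_i)_{i\ge1}$ an orthonormal basis of $H_1$, and for $n\ge1$ let $$Y=K\mu_0+n^{-1/2}Z ,\qquad\text{i.e. } Y_h=\langle K\mu_0,h\rangle_2+n^{-1/2}Z_h\quad(h\in H_2),$$ where $Z=(Z_h:h\in H_2)$ is the iso-Gaussian process (jointly Gaussian, mean zero, $\operatorname{cov}(Z_h,Z_{h'})=\langle h,h'\rangle_2$). Let $\alpha>0$, $\beta>0$, $p\ge0$, $C\ge1$, and suppose $K^TKe_i=\kappa_i^2e_i$ with $C^{-1}i^{-p}\le\kappa_i\le Ci^{-p}$. The prior on $\mu$ is $N(0,\Lambda_n)$ with $\Lambda_ne_i=\lambda_ie_i$, $\lambda_i=\tau_n^2i^{-1-2\alpha}$, where $\tau_n>0$ and $n\tau_n^2\to\infty$ (such a $(\tau_n)$ is called a scaling). Write $\|\mu\|_\beta^2=\sum_i\langle\mu,e_i\rangle^2i^{2\beta}$ and $S^\beta=\{\mu\in H_1:\|\mu\|_\beta<\infty\}$. Let $L:H_1\to\mathbb R$ be a $N(0,\Lambda_n)$-measurable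 linear functional: a Borel map that is linear on a Borel measurable linear subspace $\underline H_1\subset H_1$ of prior probability one (this does not depend on $n$); assume $S^\beta\subset\underline H_1$, so that $L$ is linear on $S^\beta$. Then $L\Lambda_n^{1/2}$ is a continuous linear functional; let $l_i=L(\Lambda_n^{1/2}e_i)/\sqrt{\lambda_i}$ (this does not depend on $n$). Assume that $$|l_i|=i^{-q-1/2}\mathcal S(i)\quad(i\ge1),\qquad q<p,\quad q>-\beta,\quad q>-\alpha-\tfrac12,$$ where $\mathcal S$ is slowly varying: measurable, eventually positive, and $\mathcal S(tx)/\mathcal S(t)\to1$ as $t\to\infty$ for every $x>0$. The posterior distribution of $L\mu$ given $Y$ is $N(LAY,s_n^2)$, where $LA=(L\Lambda_n^{1/2})\bigl(n^{-1}I+\Lambda_n^{1/2}K^TK\Lambda_n^{1/2}\bigr)^{-1}\Lambda_n^{1/2}K^T$, $LAY=Y_{(LA)^T}$ and $s_n^2=(L\Lambda_n^{1/2})(L\Lambda_n^{1/2})^T-LA(n^{-1}I+K\Lambda_nK^T)(LA)^T$. For $\gamma\in(0,1)$ and $z_{\gamma/2}$ the lower standard normal $\gamma/2$-quantile, the coverage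 at $\mu_0$ is $$c_n(\mu_0)=\Pr_{\mu_0}\bigl(LAY+z_{\gamma/2}s_n\le L\mu_0\le LAY-z_{\gamma/2}s_n\bigr).$$ Put $\rho_n(\tau)=(n\tau^2)^{1/(1+2\alpha+2p)}$, $\delta_n(\tau)=|\mathcal S(\rho_n(\tau))|$, and let $\gamma_n(\tau)^2$ be equal to $\mathcal S^2(\rho_n(\tau))$ if $\beta+q<1+2\alpha+2p$, to $\sum_{i\le\rho_n(\tau)}\mathcal S^2(i)/i$ if $\beta+q=1+2\alpha+2p$, and to $1$ if $\beta+q>1+2\alpha+2p$. Let $\tilde\tau_n$ be an optimal scaling, i.e. a scaling that equates, up to constants (the quotient is bounded away from $0$ and $\infty$ as $n\to\infty$), the two terms $$(n\tau^2)^{-\left(\frac{\beta+q}{1+2\alpha+2p}\wedge1\right)}\gamma_n(\tau)\qquad\text{and}\qquad \tau\,(n\tau^2)^{-\left(\frac{1/2+\alpha+q}{1+2\alpha+2p}\wedge\frac12\right)}\delta_n(\tau)\qquad\text{at }\tau=\tilde\tau_n .$$ Below, "the asymptotic coverage is in $(a,b)$" means that $a<\liminf_nc_n\le\limsup_nc_n<b$;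 uniformly over a set of $\mu_0$ means $a<\liminf_n\inf_{\mu_0}c_n(\mu_0)$ and $\limsup_n\sup_{\mu_0}c_n(\mu_0)<b$. **Theorem 5.3 (Credibility, linear functionals).** The asymptotic coverage of the interval $LAY\pm z_{\gamma/2}s_n$ is: (i) in $(1-\gamma,1)$, uniformly in $\mu_0$ with $\|\mu_0\|_\beta\le1$, if $\tau_n\gg\tilde\tau_n$; (ii) if $\tau_n\asymp\tilde\tau_n$: in $(1-\gamma,1)$ for every fixed $\mu_0\in S^\beta$, provided $\beta+q<1+2\alpha+2p$; and (without this proviso), for every $c\in(0,1)$, in $(0,c)$ along some sequence $\mu_0^n$ with $\sup_n\|\mu_0^n\|_\beta<\infty$; (iii) $0$ along some $\mu_0^n$ with $\sup_n\|\mu_0^n\|_\beta<\infty$, if $\tau_n\ll\tilde\tau_n$. In case (iii) the sequence $\mu_0^n$ can be taken a fixed element $\mu_0\in S^\beta$ if $\tau_n\lesssim n^{-\delta}\tilde\tau_n$ for some $\delta>0$. Furthermore, if $\tau_n\equiv1$, then the coverage is: in $(1-\gamma,1)$ uniformly in $\|\mu_0\|_\beta\le1$ if $\alpha<\beta-1/2$;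 in $(1-\gamma,1)$ for every fixed $\mu_0\in S^\beta$, and, for every $c\in(0,1)$, in $(0,c)$ along some $\mu_0^n$ with $\sup_n\|\mu_0^n\|_\beta<\infty$, if $\alpha=\beta-1/2$; and tending to $0$ at some fixed $\mu_0\in S^\beta$ if $\alpha>\beta-1/2$. -/

import Mathlib

open Filter Topology MeasureTheory ProbabilityTheory Asymptotics

noncomputable section

namespace LinearCredible

/-! Indices `i : ℕ` of eigenbases start at `0`, so that the usual index in `1, 2, 3, …` is
`i + 1`. -/

section Spaces

variable {E F Ω : Type*}
  [NormedAddCommGroup E] [InnerProductSpace ℝ E] [CompleteSpace E]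
  [NormedAddCommGroup F] [InnerProductSpace ℝ F] [CompleteSpace F]
  [MeasurableSpace Ω]

/-- Membership of the Sobolev space `S^β` relative to the orthonormal basis `e`. -/
def MemSobolev (e : HilbertBasis ℕ ℝ E) (β : ℝ) (μ : E) : Prop :=
  Summable fun i : ℕ => (inner ℝ (e i) μ) ^ 2 * ((i : ℝ) + 1) ^ (2 * β)

/-- The Sobolev norm `‖μ‖_β` (meaningful for `μ` in `S^β`). -/
def sobolevNorm (e : HilbertBasis ℕ ℝ E) (β : ℝ) (μ : E) : ℝ :=
  √(∑' i : ℕ, (inner ℝ (e i) μ) ^ 2 * ((i : ℝ) + 1) ^ (2 * β))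

/-- `Z = (Z_h : h ∈ F)` is the iso-Gaussian process (white noise) of the Hilbert space `F`. -/
structure IsIsoGaussian (Z : F → Ω → ℝ) (P : Measure Ω) : Prop where
  gaussian : IsGaussianProcess Z P
  mean : ∀ h, ∫ ω, Z h ω ∂P = 0
  cov : ∀ h h', covariance (Z h) (Z h') P = inner ℝ h h'

/-- The observed process `Y = K μ + n^{-1/2} Z`, in process form `Y_h = ⟨K μ, h⟩ + n^{-1/2} Z_h`. -/
def obs (Z : F → Ω → ℝ) (K : E →L[ℝ] F) (n : ℕ) (μ : E) (h : F) (ω : Ω) : ℝ :=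
  inner ℝ (K μ) h + (√(n : ℝ))⁻¹ * Z h ω

/-- `ν` is the Gaussian distribution `N(0, Λ)` on the Borel sets of the Hilbert space `E`. -/
structure IsCenteredGaussian [MeasurableSpace E] (ν : Measure E) (Λ : E →L[ℝ] E) : Prop where
  gaussian : IsGaussian ν
  mean : ∀ h, ∫ x, inner ℝ x h ∂ν = 0
  cov : ∀ h h', covariance (fun x => inner ℝ x h) (fun x => inner ℝ x h') ν = inner ℝ h (Λ h')

/-- `L` is a measurable linear functional relative to `N(0, Λ)`: a Borel map that is linear on the
measurable linear subspace `V`, which has probability one under `N(0, Λ)`.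
(As `V` is a linear subspace, this is the same notion for `N(0, τ²Λ)`, for every `τ > 0`.) -/
structure IsMeasurableLinear [MeasurableSpace E] (Λ : E →L[ℝ] E) (L : E → ℝ)
    (V : Submodule ℝ E) : Prop where
  measurable : Measurable L
  measurableSet : MeasurableSet (V : Set E)
  full : ∃ ν : Measure E, IsCenteredGaussian ν Λ ∧ ν (V : Set E)ᶜ = 0
  map_add : ∀ x ∈ V, ∀ y ∈ V, L (x + y) = L x + L y
  map_smul : ∀ (a : ℝ), ∀ x ∈ V, L (a • x) = a * L x

/-- The element of `E` that represents the continuous functional `L ∘ T`; its coordinates relative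
to the basis `e` are `L (T (e i))`. It is used for `T = Λ^{1/2}`. -/
def functionalVec (e : HilbertBasis ℕ ℝ E) (L : E → ℝ) (T : E →L[ℝ] E) : E :=
  ∑' i : ℕ, L (T (e i)) • e i

/-- The operator `B = (n⁻¹ I + Λ^{1/2} Kᵀ K Λ^{1/2})⁻¹ Λ^{1/2} Kᵀ`, where `R = Λ^{1/2}`. The
posterior mean of `μ` is `A Y`, for `A = Λ^{1/2} B`, so that `L A = (L Λ^{1/2}) B`. -/
def regOp (K : E →L[ℝ] F) (R : E →L[ℝ] E) (n : ℕ) : F →L[ℝ] E :=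
  Ring.inverse ((n : ℝ)⁻¹ • ContinuousLinearMap.id ℝ E +
      R ∘L K.adjoint ∘L K ∘L R) ∘L R ∘L K.adjoint

/-- The element `(L A)ᵀ` of `F` that represents the continuous functional
`L A = (L Λ^{1/2}) B`, where `R = Λ^{1/2}`. -/
def LAvec (e : HilbertBasis ℕ ℝ E) (K : E →L[ℝ] F) (R : E →L[ℝ] E) (L : E → ℝ) (n : ℕ) : F :=
  (regOp K R n).adjoint (functionalVec e L R)

/-- The posterior standard deviation `s_n` of `L μ` for the prior `N(0, Λ)`, where `R = Λ^{1/2}`: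
`s_n² = (L Λ^{1/2})(L Λ^{1/2})ᵀ - L A (n⁻¹ I + K Λ Kᵀ) (L A)ᵀ`. -/
def postSd (e : HilbertBasis ℕ ℝ E) (K : E →L[ℝ] F) (Λ R : E →L[ℝ] E) (L : E → ℝ) (n : ℕ) : ℝ :=
  √(‖functionalVec e L R‖ ^ 2 -
    inner ℝ (LAvec e K R L n)
      (((n : ℝ)⁻¹ • ContinuousLinearMap.id ℝ F + K ∘L Λ ∘L K.adjoint) (LAvec e K R L n)))

/-- The (lower) standard normal quantile `z_a`. -/
def normalQuantile (a : ℝ) : ℝ := sInf {x : ℝ | a ≤ cdf (gaussianReal 0 1) x}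

/-- The coverage `Pr_μ (L A Y + z_{γ/2} s_n ≤ L μ ≤ L A Y - z_{γ/2} s_n)`
of the credible interval, for the prior `N(0, τ² Λ)`, where `R = Λ^{1/2}`. Here
`L A Y` is the coordinate of `Y` at `(L A)ᵀ`. -/
def coverage (P : Measure Ω) (Z : F → Ω → ℝ) (e : HilbertBasis ℕ ℝ E) (K : E →L[ℝ] F)
    (Λ R : E →L[ℝ] E) (L : E → ℝ) (γ : ℝ) (n : ℕ) (τ : ℝ) (μ : E) : ℝ :=
  P.real {ω |
    obs Z K n μ (LAvec e K (τ • R) L n) ω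
        + normalQuantile (γ / 2) * postSd e K (τ ^ 2 • Λ) (τ • R) L n ≤ L μ ∧
    L μ ≤ obs Z K n μ (LAvec e K (τ • R) L n) ω
        - normalQuantile (γ / 2) * postSd e K (τ ^ 2 • Λ) (τ • R) L n}

end Spaces

/-- Slowly varying (measurable, eventually positive) functions. -/
structure SlowlyVarying (S : ℝ → ℝ) : Prop where
  measurable : Measurable S
  eventually_pos : ∀ᶠ t in atTop, 0 < S t
  tendsto : ∀ x : ℝ, 0 < x → Tendsto (fun t => S (t * x) / S t) atTop (𝓝 1)

/-- `ρ_n = (n τ²)^{1/(1+2α+2p)}`. -/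
def rho (α p : ℝ) (n : ℕ) (τ : ℝ) : ℝ := ((n : ℝ) * τ ^ 2) ^ (1 / (1 + 2 * α + 2 * p))

/-- The squared slowly varying factor of the bias term of the contraction rate. -/
def biasFactorSq (S : ℝ → ℝ) (α β p q : ℝ) (n : ℕ) (τ : ℝ) : ℝ :=
  open Classical in
  if β + q < 1 + 2 * α + 2 * p then S (rho α p n τ) ^ 2
  else if β + q = 1 + 2 * α + 2 * p then
    ∑ i ∈ Finset.Icc 1 ⌊rho α p n τ⌋₊, S (i : ℝ) ^ 2 / (i : ℝ)
  else 1

/-- The squared slowly varying factor of the spread term of the contraction rate. -/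
def spreadFactorSq (S : ℝ → ℝ) (α p q : ℝ) (n : ℕ) (τ : ℝ) : ℝ :=
  open Classical in
  if q < p then S (rho α p n τ) ^ 2
  else if q = p then ∑ i ∈ Finset.Icc 1 ⌊rho α p n τ⌋₊, S (i : ℝ) ^ 2 / (i : ℝ)
  else 1

/-- The first term (the maximal bias) of the contraction rate. -/
def biasTerm (S : ℝ → ℝ) (α β p q : ℝ) (n : ℕ) (τ : ℝ) : ℝ :=
  ((n : ℝ) * τ ^ 2) ^ (-(min ((β + q) / (1 + 2 * α + 2 * p)) 1)) * √(biasFactorSq S α β p q n τ)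

/-- The second term (the spread) of the contraction rate. -/
def spreadTerm (S : ℝ → ℝ) (α p q : ℝ) (n : ℕ) (τ : ℝ) : ℝ :=
  τ * ((n : ℝ) * τ ^ 2) ^ (-(min ((1 / 2 + α + q) / (1 + 2 * α + 2 * p)) (1 / 2))) *
    √(spreadFactorSq S α p q n τ)

/-- An admissible sequence of scalings: `τ_n > 0` and `n τ_n² → ∞`. -/
def IsScaling (τ : ℕ → ℝ) : Prop :=
  (∀ n : ℕ, 1 ≤ n → 0 < τ n) ∧ Tendsto (fun n : ℕ => (n : ℝ) * τ n ^ 2) atTop atTop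

/-- An optimal scaling: an admissible scaling that balances the two terms of the contraction rate.
Since exact solutions of the equation "bias term = spread term" need not exist if the slowly
varying function is discontinuous, the two terms are equated up to constants; this covers
the exact solutions. -/
def IsOptimalScaling (S : ℝ → ℝ) (α β p q : ℝ) (τ : ℕ → ℝ) : Prop :=
  IsScaling τ ∧
    (fun n : ℕ => biasTerm S α β p q n (τ n)) =Θ[atTop] fun n : ℕ => spreadTerm S α p q n (τ n)

/-- The numbers `x n` are asymptotically in the open interval `(a, b)`:
`a < liminf x ≤ limsup x < b`. -/
def AsympIn (x : ℕ → ℝ) (a b : ℝ) : Prop :=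
  ∃ a' b' : ℝ, a < a' ∧ b' < b ∧ ∀ᶠ n in atTop, a' ≤ x n ∧ x n ≤ b'

/-- The numbers `x n μ` are asymptotically in the open interval `(a, b)`,
uniformly in `μ ∈ T`. -/
def UnifAsympIn {M : Type*} (x : ℕ → M → ℝ) (T : Set M) (a b : ℝ) : Prop :=
  ∃ a' b' : ℝ, a < a' ∧ b' < b ∧ ∀ᶠ n in atTop, ∀ μ ∈ T, a' ≤ x n μ ∧ x n μ ≤ b'

/-- A sequence that is bounded in the Sobolev space `S^β`. -/
def BddSobolevSeq {E : Type*} [NormedAddCommGroup E] [InnerProductSpace ℝ E]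
    (e : HilbertBasis ℕ ℝ E) (β : ℝ) (μ : ℕ → E) : Prop :=
  ∃ M : ℝ, ∀ n, MemSobolev e β (μ n) ∧ sobolevNorm e β (μ n) ≤ M

end LinearCredible

end

/-!
In the eigenbasis everything is a series. With `x i = n τ² λ i κ i ^ 2`, which is of the order
`(ρ / j) ^ (1 + 2 α + 2 p)` for `j = i + 1`, the posterior mean of `L μ` has bias
`- ∑ L (e i) μ i / (1 + x i)` and variance `t² = ∑ τ² λ i (l i)² x i / (1 + x i)²`, whereas the
posterior variance is `s² = ∑ τ² λ i (l i)² / (1 + x i)`, where `l i = L (e i)`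
(`posterior_spectral`, `DiagonalModel.spectral`). Consequently the coverage is the probability that a standard normal
variable, shifted by bias divided by `t`, is bounded in absolute value by `-z s / t`
(`coverage_eq_shiftedCoverage`).

As `q < p`, the series for `t²`, for `s²` and for `s² - t²` are all dominated by the indices `j` of
the order `ρ`, and are all of the order of the square of the spread term. So `s / t` is bounded, and
at least a constant `r > 1` (`DiagonalModel.exists_coverage_eq`): without bias the interval
overcovers, and a bias that is small, comparable, or large relative to the spread term gives
coverage in `(1 - γ, 1)`, coverage bounded away from `0`, or coverage tending to `0`, respectively.
By duality the maximal bias over a Sobolev ball is the norm of a sequence, which is of the order of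
the bias term (`PotterBounded.exists_biasSum_bounds`). At a fixed parameter the bias is of smaller
order, unless it is saturated (`DiagonalModel.exists_abs_spectralBias_le_of_lt`), but for suitable
parameters only by a small power of `ρ` (`DiagonalModel.exists_fixed_spectralBias_ge`).

It remains to compare the two terms. Their quotient is `√n / H ρ`, where `H` is a power of positive
exponent times a slowly varying function. So it decreases polynomially if the scaling increases
(`exists_terms_compare`), and the position of the scaling relative to an optimal one determines the
regime. If `τ = 1`, the terms can be compared directly.

Two facts underlie these computations. The measurability of a slowly varying function implies the
Potter bounds (`SlowlyVarying.potterBounded`), by the uniform convergence theorem. The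
measurability of `L` implies that `L` is continuous on the Sobolev space and hence is given there
by its values at the basis vectors (`IsMeasurableLinear.hasSum_inner_mul`), by the fact that
measurable linear functionals on a Banach space are continuous (`continuous_of_measurable_linear`).
-/

namespace LinearCredible

/-! ### Slowly varying functions -/

/-- Local uniformity: if `f` is measurable and `f (x + u) - f x → 0` for every `u`, then the
convergence is uniform in `u ∈ [0, 1]`. The average of `min 1 |f (x + v) - f x|` over `v ∈ [0, 2]`
tends to zero by dominated convergence, and the increment `f (x + u) - f x` passes through
`f (x + v)` for every `v ∈ [1, 2]`. -/
theorem exists_forall_abs_sub_le {f : ℝ → ℝ} (hf : Measurable f)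
    (h : ∀ u, Tendsto (fun x => f (x + u) - f x) atTop (𝓝 0)) {ε : ℝ} (hε : 0 < ε) :
    ∃ x₀, ∀ x, x₀ ≤ x → ∀ u, 0 ≤ u → u ≤ 1 → |f (x + u) - f x| ≤ ε := by
  set G : ℝ → ℝ → ENNReal := fun x v => ENNReal.ofReal (min 1 |f (x + v) - f x|) with hG
  have hGm : ∀ x, Measurable (G x) := fun x => by
    have : Measurable fun v => f (x + v) := hf.comp (measurable_const_add x)
    fun_prop
  have hlim : Tendsto (fun x => ∫⁻ v, (Set.Icc (0 : ℝ) 2).indicator (G x) v) atTop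
      (𝓝 (∫⁻ _ : ℝ, 0)) := by
    refine tendsto_lintegral_filter_of_dominated_convergence
      ((Set.Icc (0 : ℝ) 2).indicator fun _ => 1) ?_ ?_ ?_ ?_
    · exact Eventually.of_forall fun x => (hGm x).indicator measurableSet_Icc
    · refine Eventually.of_forall fun x => Eventually.of_forall fun v => ?_
      refine Set.indicator_le_indicator ?_
      simp [hG]
    · simp
    · refine Eventually.of_forall fun v => ?_
      have h1 : Tendsto (fun x => G x v) atTop (𝓝 0) := by
        have h2 := (tendsto_const_nhds (x := (1 : ℝ))).min (h v).abs
        have h3 := ENNReal.tendsto_ofReal h2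
        simpa [hG] using h3
      by_cases hv : v ∈ Set.Icc (0 : ℝ) 2
      · simpa [hv] using h1
      · simp [hv]
  simp only [lintegral_zero] at hlim
  have hδ : 0 < min (1 / 2) ε := lt_min (by norm_num) hε
  have hev := (hlim.eventually (gt_mem_nhds
    (ENNReal.ofReal_pos.2 (half_pos hδ))))
  obtain ⟨x₀, hx₀⟩ := eventually_atTop.1 hev
  refine ⟨x₀, fun x hx u hu0 hu1 => ?_⟩
  -- average the triangle inequality through `f (x + v)` over `v ∈ [1, 2]`
  have key : G x u ≤ ENNReal.ofReal (min (1 / 2) ε) := by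
    calc G x u = ∫⁻ v, (Set.Icc (1 : ℝ) 2).indicator (fun _ => G x u) v := by
          rw [lintegral_indicator measurableSet_Icc]
          simp; norm_num
      _ ≤ ∫⁻ v, ((Set.Icc (0 : ℝ) 2).indicator (G x) v
            + (Set.Icc (0 : ℝ) 2).indicator (G (x + u)) (v - u)) := by
          refine lintegral_mono fun v => ?_
          by_cases hv : v ∈ Set.Icc (1 : ℝ) 2
          · have hv1 : v ∈ Set.Icc (0 : ℝ) 2 := ⟨by linarith [hv.1], hv.2⟩
            have hv2 : v - u ∈ Set.Icc (0 : ℝ) 2 := ⟨by linarith [hv.1], by linarith [hv.2]⟩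
            simp only [hv, hv1, hv2, Set.indicator_of_mem, hG]
            rw [← ENNReal.ofReal_add (by positivity) (by positivity)]
            refine ENNReal.ofReal_le_ofReal ?_
            have e : x + u + (v - u) = x + v := by ring
            rw [e]
            have := abs_sub_le (f (x + u)) (f (x + v)) (f x)
            rw [abs_sub_comm (f (x + u)) (f (x + v))] at this
            have n1 := abs_nonneg (f (x + v) - f x)
            have n2 := abs_nonneg (f (x + v) - f (x + u))
            rcases le_total 1 |f (x + v) - f x| with a | a <;>
            rcases le_total 1 |f (x + v) - f (x + u)| with b | b <;>
            simp only [min_eq_left, min_eq_right, a, b, min_le_iff] <;> grind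
          · simp [hv]
      _ = (∫⁻ v, (Set.Icc (0 : ℝ) 2).indicator (G x) v)
            + ∫⁻ v, (Set.Icc (0 : ℝ) 2).indicator (G (x + u)) v := by
          rw [lintegral_add_left ((hGm x).indicator measurableSet_Icc),
            lintegral_sub_right_eq_self]
      _ ≤ ENNReal.ofReal (min (1 / 2) ε / 2) + ENNReal.ofReal (min (1 / 2) ε / 2) :=
          add_le_add (hx₀ x hx).le (hx₀ (x + u) (by linarith)).le
      _ = ENNReal.ofReal (min (1 / 2) ε) := by
          rw [← ENNReal.ofReal_add (by positivity) (by positivity), add_halves]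
  have key' := (ENNReal.ofReal_le_ofReal_iff hδ.le).1 key
  have h1 : min (1 / 2) ε ≤ 1 / 2 := min_le_left _ _
  have h2 : min (1 / 2) ε ≤ ε := min_le_right _ _
  rcases min_le_iff.1 (key'.trans le_rfl) with h3 | h3
  · linarith
  · linarith

theorem exists_forall_abs_sub_le_mul {f : ℝ → ℝ} (hf : Measurable f)
    (h : ∀ u, Tendsto (fun x => f (x + u) - f x) atTop (𝓝 0)) {ε : ℝ} (hε : 0 < ε) :
    ∃ x₀, ∀ x, x₀ ≤ x → ∀ y, x ≤ y → |f y - f x| ≤ ε * (y - x + 1) := by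
  obtain ⟨x₀, hx₀⟩ := exists_forall_abs_sub_le hf h hε
  refine ⟨x₀, ?_⟩
  have key : ∀ n : ℕ, ∀ x, x₀ ≤ x → ∀ y, x ≤ y → y ≤ x + n → |f y - f x| ≤ ε * n := by
    intro n
    induction n with
    | zero =>
      intro x _ y h1 h2
      have : y = x := le_antisymm (by simpa using h2) h1
      simp [this]
    | succ n ih =>
      intro x hx y h1 h2
      push_cast at h2 ⊢
      by_cases hy : y ≤ x + n
      · exact (ih x hx y h1 hy).trans (by nlinarith)
      · push Not at hy
        have hn : (0 : ℝ) ≤ n := n.cast_nonneg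
        have a := ih x hx (x + n) (by linarith) le_rfl
        have b := hx₀ (x + n) (by linarith) (y - (x + n)) (by linarith) (by linarith)
        rw [add_sub_cancel] at b
        have := abs_sub_le (f y) (f (x + n)) (f x)
        linarith
  intro x hx y hxy
  have h1 := key ⌈y - x⌉₊ x hx y hxy (by linarith [Nat.le_ceil (y - x)])
  have h2 := Nat.ceil_lt_add_one (sub_nonneg.2 hxy)
  exact h1.trans (mul_le_mul_of_nonneg_left h2.le hε.le)

/-- The Potter bounds: eventually, `σ` is positive and changes by no more than any power of the
quotient of the arguments, up to a constant. This is the only property of slowly varying functions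
that the asymptotics below depend on. -/
def PotterBounded (σ : ℝ → ℝ) : Prop :=
  ∀ ε : ℝ, 0 < ε → ∃ C t₀ : ℝ, 1 ≤ C ∧ 1 ≤ t₀ ∧ ∀ X Y, t₀ ≤ X → X ≤ Y →
    0 < σ X ∧ σ Y ≤ C * (Y / X) ^ ε * σ X ∧ σ X ≤ C * (Y / X) ^ ε * σ Y

/-- In logarithmic coordinates, the defining limit says that the increments of `log S` over bounded
distances tend to zero; their uniformity gives increments at most `ε` times the distance. -/
theorem SlowlyVarying.potterBounded {S : ℝ → ℝ} (hS : SlowlyVarying S) : PotterBounded S := by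
  intro ε hε
  have hm : Measurable fun x => Real.log (S (Real.exp x)) :=
    Real.measurable_log.comp (hS.measurable.comp Real.measurable_exp)
  have hlim : ∀ u, Tendsto (fun x => Real.log (S (Real.exp (x + u))) - Real.log (S (Real.exp x)))
      atTop (𝓝 0) := by
    intro u
    have h1 := (hS.tendsto (Real.exp u) (Real.exp_pos u)).comp Real.tendsto_exp_atTop
    have h2 := (Real.continuousAt_log one_ne_zero).tendsto.comp h1
    rw [Real.log_one] at h2
    have h3 := Real.tendsto_exp_atTop.eventually hS.eventually_pos
    have h4 := (tendsto_atTop_add_const_right atTop u tendsto_id).eventually h3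
    refine h2.congr' ?_
    filter_upwards [h3, h4] with x hx hxu
    simp only [Function.comp_apply, id] at hxu ⊢
    rw [← Real.exp_add, Real.log_div hxu.ne' hx.ne']
  obtain ⟨x₀, hx₀⟩ := exists_forall_abs_sub_le_mul hm hlim hε
  obtain ⟨t₁, ht₁⟩ := eventually_atTop.1 hS.eventually_pos
  refine ⟨Real.exp ε, max (max (Real.exp x₀) t₁) 1, Real.one_le_exp hε.le, le_max_right _ _, ?_⟩
  intro X Y hX hXY
  have hX1 : 1 ≤ X := (le_max_right _ _).trans hX
  have hX2 : Real.exp x₀ ≤ X := ((le_max_left _ _).trans (le_max_left _ _)).trans hX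
  have hX3 : t₁ ≤ X := ((le_max_right _ _).trans (le_max_left _ _)).trans hX
  have hX0 : 0 < X := by linarith
  have hY0 : 0 < Y := by linarith
  have pX := ht₁ X hX3
  have pY := ht₁ Y (hX3.trans hXY)
  have h := hx₀ (Real.log X) ((Real.le_log_iff_exp_le hX0).2 hX2) (Real.log Y)
    (Real.log_le_log hX0 hXY)
  rw [Real.exp_log hX0, Real.exp_log hY0] at h
  have e : Real.exp ε * (Y / X) ^ ε = Real.exp (ε * (Real.log Y - Real.log X + 1)) := by
    rw [Real.rpow_def_of_pos (by positivity), ← Real.exp_add, Real.log_div hY0.ne' hX0.ne']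
    congr 1; ring
  rw [e]
  obtain ⟨h1, h2⟩ := abs_le.1 h
  refine ⟨pX, ?_, ?_⟩
  · rw [← Real.log_le_log_iff pY (by positivity), Real.log_mul (Real.exp_pos _).ne' pX.ne',
      Real.log_exp]
    linarith
  · rw [← Real.log_le_log_iff pX (by positivity), Real.log_mul (Real.exp_pos _).ne' pY.ne',
      Real.log_exp]
    linarith

theorem PotterBounded.one : PotterBounded fun _ => 1 := by
  intro ε hε
  refine ⟨1, 1, le_rfl, le_rfl, fun X Y hX hXY => ?_⟩
  have : 1 ≤ (Y / X) ^ ε := Real.one_le_rpow ((one_le_div (by linarith)).2 hXY) hε.le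
  simpa using this

theorem PotterBounded.eventually_pos {σ : ℝ → ℝ} (h : PotterBounded σ) :
    ∃ t₀, 1 ≤ t₀ ∧ ∀ X, t₀ ≤ X → 0 < σ X := by
  obtain ⟨C, t₀, _, h1, h2⟩ := h 1 one_pos
  exact ⟨t₀, h1, fun X hX => (h2 X X hX le_rfl).1⟩

theorem PotterBounded.div {σ υ : ℝ → ℝ} (hσ : PotterBounded σ) (hυ : PotterBounded υ) :
    PotterBounded fun x => σ x / υ x := by
  intro ε hε
  obtain ⟨C, t, hC, ht, h⟩ := hσ (ε / 2) (by positivity)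
  obtain ⟨C', t', hC', ht', h'⟩ := hυ (ε / 2) (by positivity)
  refine ⟨C * C', max t t', one_le_mul_of_one_le_of_one_le hC hC', ht.trans (le_max_left _ _), ?_⟩
  intro X Y hX hXY
  obtain ⟨a1, a2, a3⟩ := h X Y ((le_max_left _ _).trans hX) hXY
  obtain ⟨b1, b2, b3⟩ := h' X Y ((le_max_right _ _).trans hX) hXY
  have a4 := (h Y Y (((le_max_left _ _).trans hX).trans hXY) le_rfl).1
  have b4 := (h' Y Y (((le_max_right _ _).trans hX).trans hXY) le_rfl).1
  have hX0 : 0 < X := by linarith [(le_max_left t t').trans hX]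
  have hq : 0 < Y / X := div_pos (by linarith) hX0
  have e : (Y / X) ^ ε = (Y / X) ^ (ε / 2) * (Y / X) ^ (ε / 2) := by
    rw [← Real.rpow_add hq, add_halves]
  set r := (Y / X) ^ (ε / 2)
  rw [e]
  refine ⟨by positivity, ?_, ?_⟩
  · rw [div_le_iff₀ b4, mul_assoc, div_mul_eq_mul_div, mul_div_assoc', le_div_iff₀ b1]
    calc σ Y * υ X ≤ (C * r * σ X) * (C' * r * υ Y) := by
          apply mul_le_mul a2 b3 b1.le (by positivity)
      _ = _ := by ring
  · rw [div_le_iff₀ b1, mul_assoc, div_mul_eq_mul_div, mul_div_assoc', le_div_iff₀ b4]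
    calc σ X * υ Y ≤ (C * r * σ Y) * (C' * r * υ X) := by
          apply mul_le_mul a3 b2 b4.le (by positivity)
      _ = _ := by ring

/-! ### Power sums -/

theorem mul_rpow_sub_one_le_sub {a : ℝ} (ha : 0 ≤ a) (ha1 : a ≤ 1) (i : ℕ) :
    a * ((i : ℝ) + 1) ^ (a - 1) ≤ ((i : ℝ) + 1) ^ a - (i : ℝ) ^ a := by
  have hj : (0 : ℝ) < (i : ℝ) + 1 := by positivity
  have h := rpow_one_add_le_one_add_mul_self (s := -(1 / ((i : ℝ) + 1))) (p := a)
    (by rw [neg_le_neg_iff, div_le_one hj]; linarith [(i.cast_nonneg : (0 : ℝ) ≤ i)]) ha ha1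
  have e : (i : ℝ) = ((i : ℝ) + 1) * (1 + -(1 / ((i : ℝ) + 1))) := by field_simp; ring
  have e2 : (i : ℝ) ^ a = ((i : ℝ) + 1) ^ a * (1 + -(1 / ((i : ℝ) + 1))) ^ a := by
    rw [← Real.mul_rpow hj.le, ← e]
    have : 1 + -(1 / ((i : ℝ) + 1)) = (i : ℝ) / (i + 1) := by field_simp; ring
    rw [this]; positivity
  rw [e2, Real.rpow_sub_one hj.ne']
  have := mul_le_mul_of_nonneg_left h (Real.rpow_nonneg hj.le a)
  have e3 : a * (((i : ℝ) + 1) ^ a / ((i : ℝ) + 1))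
    = ((i : ℝ) + 1) ^ a * (a * (1 / ((i : ℝ) + 1))) := by ring
  rw [e3]
  linarith

theorem mul_rpow_neg_sub_one_le_sub {b : ℝ} (hb : 0 ≤ b) {i : ℕ} (hi : 0 < i) :
    b * ((i : ℝ) + 1) ^ (-b - 1) ≤ (i : ℝ) ^ (-b) - ((i : ℝ) + 1) ^ (-b) := by
  have hj : (0 : ℝ) < (i : ℝ) + 1 := by positivity
  have hi' : (0 : ℝ) < i := by exact_mod_cast hi
  have hq : 0 < (i : ℝ) / (i + 1) := by positivity
  have e2 : (i : ℝ) ^ (-b) = ((i : ℝ) + 1) ^ (-b) * ((i : ℝ) / (i + 1)) ^ (-b) := by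
    rw [← Real.mul_rpow hj.le hq.le, mul_div_cancel₀ _ hj.ne']
  have h : 1 + b * (1 / ((i : ℝ) + 1)) ≤ ((i : ℝ) / (i + 1)) ^ (-b) := by
    rw [Real.rpow_def_of_pos hq]
    have h1 := Real.log_le_sub_one_of_pos hq
    have h2 : (i : ℝ) / (i + 1) - 1 = -(1 / ((i : ℝ) + 1)) := by field_simp; ring
    rw [h2] at h1
    have h3 := Real.add_one_le_exp (Real.log ((i : ℝ) / (i + 1)) * -b)
    nlinarith
  rw [e2, Real.rpow_sub_one hj.ne']
  have := mul_le_mul_of_nonneg_left h (Real.rpow_nonneg hj.le (-b))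
  have e3 : b * (((i : ℝ) + 1) ^ (-b) / ((i : ℝ) + 1))
    = ((i : ℝ) + 1) ^ (-b) * (b * (1 / ((i : ℝ) + 1))) := by ring
  rw [e3]
  linarith

theorem sum_range_rpow_le {a : ℝ} (ha : 0 < a) (ha1 : a ≤ 1) (m : ℕ) :
    ∑ i ∈ Finset.range m, ((i : ℝ) + 1) ^ (a - 1) ≤ (m : ℝ) ^ a / a := by
  rw [le_div_iff₀ ha, mul_comm, Finset.mul_sum]
  have h := Finset.sum_range_sub (fun i : ℕ => (i : ℝ) ^ a) m
  simp only [Nat.cast_zero, Real.zero_rpow ha.ne', sub_zero] at h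
  rw [← h]
  refine Finset.sum_le_sum fun i _ => ?_
  have := mul_rpow_sub_one_le_sub ha.le ha1 i
  exact_mod_cast this

/-- The sums `∑ j⁻¹ min ((j/ρ)^a, (j/ρ)^{-b})` are bounded uniformly in `ρ`. The potential `Ψ`
is bounded and monotone, and its increments dominate the terms, with the exception of the term at
which `j` crosses `ρ`. -/
theorem exists_sum_min_rpow_le {a b : ℝ} (ha : 0 < a) (hb : 0 < b) :
    ∃ C : ℝ, 0 < C ∧ ∀ ρ : ℝ, 1 ≤ ρ → ∀ m : ℕ, ∑ i ∈ Finset.range m,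
      ((i : ℝ) + 1)⁻¹ * min ((((i : ℝ) + 1) / ρ) ^ a) ((((i : ℝ) + 1) / ρ) ^ (-b)) ≤ C := by
  set d := min a 1 with hd
  have hd0 : 0 < d := lt_min ha one_pos
  refine ⟨1 / d + 1 / b + 1, by positivity, fun ρ hρ m => ?_⟩
  have hρ0 : 0 < ρ := by linarith
  set Ψ : ℕ → ℝ := fun i => 1 / d * (min ((i : ℝ) / ρ) 1) ^ d
    + 1 / b * (1 - (max ((i : ℝ) / ρ) 1) ^ (-b)) with hΨ
  have hterm : ∀ i : ℕ,
      ((i : ℝ) + 1)⁻¹ * min ((((i : ℝ) + 1) / ρ) ^ a) ((((i : ℝ) + 1) / ρ) ^ (-b))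
        ≤ (Ψ (i + 1) - Ψ i) + if i = ⌊ρ⌋₊ then 1 else 0 := by
    intro i
    have hj : (0 : ℝ) < (i : ℝ) + 1 := by positivity
    have hi0 : (0 : ℝ) ≤ i := i.cast_nonneg
    have hr : 0 < ((i : ℝ) + 1) / ρ := by positivity
    have hmono : Ψ i ≤ Ψ (i + 1) := by
      have hle : (i : ℝ) / ρ ≤ ((i + 1 : ℕ) : ℝ) / ρ := by
        gcongr; linarith
      have h1 : (min ((i : ℝ) / ρ) 1) ^ d ≤ (min (((i + 1 : ℕ) : ℝ) / ρ) 1) ^ d :=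
        Real.rpow_le_rpow (by positivity) (min_le_min_right _ hle) hd0.le
      have h2 : (max (((i + 1 : ℕ) : ℝ) / ρ) 1) ^ (-b) ≤ (max ((i : ℝ) / ρ) 1) ^ (-b) :=
        Real.rpow_le_rpow_of_nonpos (by positivity) (max_le_max_right _ hle) (by linarith)
      simp only [hΨ]
      gcongr
    rcases le_or_gt ((i : ℝ) + 1) ρ with h1 | h1
    · have hr1 : ((i : ℝ) + 1) / ρ ≤ 1 := (div_le_one hρ0).2 h1
      have hi1 : (i : ℝ) / ρ ≤ 1 := (div_le_one hρ0).2 (by linarith)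
      have e : Ψ (i + 1) - Ψ i = 1 / d * ((((i : ℝ) + 1) ^ d - (i : ℝ) ^ d) / ρ ^ d) := by
        simp only [hΨ, Nat.cast_add, Nat.cast_one, min_eq_left hr1, min_eq_left hi1,
          max_eq_right hr1, max_eq_right hi1, Real.div_rpow hj.le hρ0.le,
          Real.div_rpow hi0 hρ0.le]
        ring
      rw [e]
      have h2 : min ((((i : ℝ) + 1) / ρ) ^ a) ((((i : ℝ) + 1) / ρ) ^ (-b))
          ≤ ((i : ℝ) + 1) ^ d / ρ ^ d := by
        rw [← Real.div_rpow hj.le hρ0.le]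
        exact (min_le_left _ _).trans
          (Real.rpow_le_rpow_of_exponent_ge hr hr1 (min_le_left _ _))
      have h3 := mul_rpow_sub_one_le_sub hd0.le (min_le_right a 1) i
      have h4 : ((i : ℝ) + 1)⁻¹ * (((i : ℝ) + 1) ^ d / ρ ^ d)
          = 1 / d * ((d * ((i : ℝ) + 1) ^ (d - 1)) / ρ ^ d) := by
        rw [Real.rpow_sub_one hj.ne']; field_simp
      have h5 : 1 / d * ((d * ((i : ℝ) + 1) ^ (d - 1)) / ρ ^ d)
          ≤ 1 / d * ((((i : ℝ) + 1) ^ d - (i : ℝ) ^ d) / ρ ^ d) := by gcongr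
      have h6 := mul_le_mul_of_nonneg_left h2 (inv_nonneg.2 hj.le)
      have h7 : (0 : ℝ) ≤ if i = ⌊ρ⌋₊ then 1 else 0 := by split_ifs <;> norm_num
      linarith
    rcases le_or_gt ρ (i : ℝ) with h2 | h2
    · have hipos : (0 : ℝ) < i := by linarith
      have hr1 : 1 ≤ ((i : ℝ) + 1) / ρ := (one_le_div hρ0).2 h1.le
      have hi1 : 1 ≤ (i : ℝ) / ρ := (one_le_div hρ0).2 h2
      have e : Ψ (i + 1) - Ψ i = 1 / b * (((i : ℝ) ^ (-b) - ((i : ℝ) + 1) ^ (-b)) / ρ ^ (-b)) := by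
        simp only [hΨ, Nat.cast_add, Nat.cast_one, min_eq_right hr1, min_eq_right hi1,
          max_eq_left hr1, max_eq_left hi1, Real.div_rpow hj.le hρ0.le,
          Real.div_rpow hi0 hρ0.le]
        ring
      rw [e]
      have h3 := mul_rpow_neg_sub_one_le_sub hb.le (by exact_mod_cast hipos : 0 < i)
      have h4 : ((i : ℝ) + 1)⁻¹ * (((i : ℝ) + 1) / ρ) ^ (-b)
          = 1 / b * ((b * ((i : ℝ) + 1) ^ (-b - 1)) / ρ ^ (-b)) := by
        rw [Real.rpow_sub_one hj.ne', Real.div_rpow hj.le hρ0.le]; field_simp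
      have h5 : 1 / b * ((b * ((i : ℝ) + 1) ^ (-b - 1)) / ρ ^ (-b))
          ≤ 1 / b * (((i : ℝ) ^ (-b) - ((i : ℝ) + 1) ^ (-b)) / ρ ^ (-b)) := by gcongr
      have h6 := mul_le_mul_of_nonneg_left
        (min_le_right ((((i : ℝ) + 1) / ρ) ^ a) ((((i : ℝ) + 1) / ρ) ^ (-b))) (inv_nonneg.2 hj.le)
      have h7 : (0 : ℝ) ≤ if i = ⌊ρ⌋₊ then 1 else 0 := by split_ifs <;> norm_num
      linarith
    · have hfl : ⌊ρ⌋₊ = i := (Nat.floor_eq_iff hρ0.le).2 ⟨h2.le, h1⟩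
      rw [if_pos hfl.symm]
      have hr1 : 1 ≤ ((i : ℝ) + 1) / ρ := (one_le_div hρ0).2 h1.le
      have h3 : min ((((i : ℝ) + 1) / ρ) ^ a) ((((i : ℝ) + 1) / ρ) ^ (-b)) ≤ 1 :=
        (min_le_right _ _).trans (Real.rpow_le_one_of_one_le_of_nonpos hr1 (by linarith))
      have h4 : ((i : ℝ) + 1)⁻¹ ≤ 1 := inv_le_one_of_one_le₀ (by linarith)
      have h5 := mul_le_mul h4 h3 (by positivity) zero_le_one
      linarith
  refine (Finset.sum_le_sum fun i _ => hterm i).trans ?_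
  rw [Finset.sum_add_distrib, Finset.sum_range_sub, Finset.sum_ite_eq']
  have h0 : Ψ 0 = 0 := by
    simp [hΨ, Real.zero_rpow hd0.ne']
  have h1 : Ψ m ≤ 1 / d + 1 / b := by
    simp only [hΨ]
    have a1 : (min ((m : ℝ) / ρ) 1) ^ d ≤ 1 :=
      Real.rpow_le_one (by positivity) (min_le_right _ _) hd0.le
    have a2 : 0 ≤ (max ((m : ℝ) / ρ) 1) ^ (-b) := by positivity
    have a3 : 1 / d * (min ((m : ℝ) / ρ) 1) ^ d ≤ 1 / d * 1 := by gcongr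
    have a4 : 1 / b * (1 - (max ((m : ℝ) / ρ) 1) ^ (-b)) ≤ 1 / b * 1 := by gcongr; linarith
    linarith
  rw [h0]
  split_ifs <;> linarith

/-! ### Sums with slowly varying weights -/

/-- The Potter bounds relative to the value at `ρ`, for all indices: the finitely many indices below
the threshold `t₀` are absorbed into the constant. -/
theorem PotterBounded.exists_nat_le {S : ℝ → ℝ} (hS : PotterBounded S) {ε : ℝ} (hε : 0 < ε) :
    ∃ C t₀ : ℝ, 1 ≤ C ∧ 1 ≤ t₀ ∧ ∀ ρ, t₀ ≤ ρ → 0 < S ρ ∧ ∀ i : ℕ,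
      ((i : ℝ) + 1 ≤ ρ → S (i + 1) ≤ C * (ρ / (i + 1)) ^ ε * S ρ) ∧
      (ρ ≤ (i : ℝ) + 1 → S (i + 1) ≤ C * ((i + 1) / ρ) ^ ε * S ρ) := by
  obtain ⟨C, t₀, hC, ht, h⟩ := hS ε hε
  have hpos := (h t₀ t₀ le_rfl le_rfl).1
  set M := ∑ i ∈ Finset.range ⌈t₀⌉₊, |S ((i : ℝ) + 1)| with hM
  have hM0 : 0 ≤ M := Finset.sum_nonneg fun _ _ => abs_nonneg _
  have hC' : C ≤ C + M * C / S t₀ := le_add_of_nonneg_right (by positivity)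
  refine ⟨C + M * C / S t₀, t₀, hC.trans hC', ht, fun ρ hρ => ⟨(h ρ ρ hρ le_rfl).1, fun i => ?_⟩⟩
  have hρ0 : 0 < ρ := by linarith
  have hSρ := (h ρ ρ hρ le_rfl).1
  have hj : (0 : ℝ) < (i : ℝ) + 1 := by positivity
  constructor
  · intro hi
    rcases le_or_gt t₀ ((i : ℝ) + 1) with h1 | h1
    · refine (h _ ρ h1 hi).2.2.trans ?_
      gcongr
    · have h2 : |S ((i : ℝ) + 1)| ≤ M :=
        Finset.single_le_sum (f := fun i : ℕ => |S ((i : ℝ) + 1)|) (fun _ _ => abs_nonneg _)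
          (Finset.mem_range.2 (Nat.lt_ceil.2 (by linarith)))
      have h3 := (h t₀ ρ le_rfl hρ).2.2
      calc S ((i : ℝ) + 1) ≤ M := (le_abs_self _).trans h2
        _ = M / S t₀ * S t₀ := by field_simp
        _ ≤ M / S t₀ * (C * (ρ / t₀) ^ ε * S ρ) := by gcongr
        _ ≤ M / S t₀ * (C * (ρ / (i + 1)) ^ ε * S ρ) := by gcongr
        _ = (M * C / S t₀) * (ρ / (i + 1)) ^ ε * S ρ := by ring
        _ ≤ (C + M * C / S t₀) * (ρ / (i + 1)) ^ ε * S ρ := by gcongr; linarith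
  · intro hi
    refine (h ρ _ hρ hi).2.1.trans ?_
    gcongr

theorem PotterBounded.exists_le_rpow {S : ℝ → ℝ} (hS : PotterBounded S) {ε : ℝ} (hε : 0 < ε) :
    ∃ C : ℝ, 0 < C ∧ ∀ i : ℕ, S (i + 1) ≤ C * ((i : ℝ) + 1) ^ ε := by
  obtain ⟨C, t₀, hC, ht, h⟩ := hS.exists_nat_le hε
  obtain ⟨hpos, h⟩ := h t₀ le_rfl
  have ht0 : 0 < t₀ := by linarith
  refine ⟨C * t₀ ^ ε * S t₀, by positivity, fun i => ?_⟩
  have hj : (1 : ℝ) ≤ (i : ℝ) + 1 := by linarith [(i.cast_nonneg : (0 : ℝ) ≤ i)]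
  have hj0 : (0 : ℝ) < (i : ℝ) + 1 := by linarith
  have h1 : 1 ≤ ((i : ℝ) + 1) ^ ε := Real.one_le_rpow hj hε.le
  have h2 : 1 ≤ t₀ ^ ε := Real.one_le_rpow ht hε.le
  rcases le_total ((i : ℝ) + 1) t₀ with h3 | h3
  · refine ((h i).1 h3).trans ?_
    have : (t₀ / (i + 1)) ^ ε ≤ t₀ ^ ε :=
      Real.rpow_le_rpow (by positivity) (div_le_self ht0.le hj) hε.le
    calc C * (t₀ / (i + 1)) ^ ε * S t₀ ≤ C * t₀ ^ ε * S t₀ * 1 := by rw [mul_one]; gcongr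
      _ ≤ _ := by gcongr
  · refine ((h i).2 h3).trans ?_
    have : (((i : ℝ) + 1) / t₀) ^ ε ≤ ((i : ℝ) + 1) ^ ε :=
      Real.rpow_le_rpow (by positivity) (div_le_self hj0.le ht) hε.le
    calc C * (((i : ℝ) + 1) / t₀) ^ ε * S t₀ ≤ C * ((i : ℝ) + 1) ^ ε * S t₀ := by gcongr
      _ = C * 1 * S t₀ * ((i : ℝ) + 1) ^ ε := by ring
      _ ≤ _ := by gcongr

theorem summable_rpow_add_one {s : ℝ} (hs : s < -1) : Summable fun i : ℕ => ((i : ℝ) + 1) ^ s := by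
  have := (summable_nat_add_iff 1).2 (Real.summable_nat_rpow.2 hs)
  simpa using this

theorem PotterBounded.summable_sq {S : ℝ → ℝ} (hS : PotterBounded S)
    (h0 : ∀ i : ℕ, 0 ≤ S (i + 1)) {s : ℝ} (hs : s < -1) :
    Summable fun i : ℕ => S (i + 1) ^ 2 * ((i : ℝ) + 1) ^ s := by
  obtain ⟨C, hC, h⟩ := hS.exists_le_rpow (ε := (-1 - s) / 4) (by linarith)
  refine Summable.of_nonneg_of_le (fun i => by positivity) (fun i => ?_)
    ((summable_rpow_add_one (s := s + (-1 - s) / 2) (by linarith)).mul_left (C ^ 2))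
  have hj : (0 : ℝ) < (i : ℝ) + 1 := by positivity
  calc S (i + 1) ^ 2 * ((i : ℝ) + 1) ^ s
      ≤ (C * ((i : ℝ) + 1) ^ ((-1 - s) / 4)) ^ 2 * ((i : ℝ) + 1) ^ s := by
        gcongr
        · exact h0 i
        · exact h i
    _ = C ^ 2 * ((i : ℝ) + 1) ^ (s + (-1 - s) / 2) := by
        rw [mul_pow, ← Real.rpow_natCast, ← Real.rpow_natCast, ← Real.rpow_mul hj.le, mul_assoc,
          ← Real.rpow_add hj]
        congr 2; push_cast; ring

/-- An upper bound by the terms with `j` of the order `ρ`. This needs `2 θ < k D`: below `ρ`, the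
terms are of the order `S(j)² j^{-1-2θ} (j/ρ)^{kD}`, which exceeds `j⁻¹` by a positive power. -/
theorem PotterBounded.exists_tsum_le {S : ℝ → ℝ} (hS : PotterBounded S)
    (h0 : ∀ i : ℕ, 0 ≤ S (i + 1)) {θ D c : ℝ} {k : ℕ} (hθ : 0 < θ) (hk : 2 * θ < k * D)
    (hc : 0 < c) :
    ∃ C t₀ : ℝ, 0 < C ∧ 1 ≤ t₀ ∧ ∀ ρ, t₀ ≤ ρ → ∀ x : ℕ → ℝ,
      (∀ i, c * (ρ / (i + 1)) ^ D ≤ x i) →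
      Summable (fun i : ℕ => S (i + 1) ^ 2 * ((i : ℝ) + 1) ^ (-1 - 2 * θ) / (1 + x i) ^ k) ∧
      ∑' i : ℕ, S (i + 1) ^ 2 * ((i : ℝ) + 1) ^ (-1 - 2 * θ) / (1 + x i) ^ k
        ≤ C * (ρ ^ (-θ) * S ρ) ^ 2 := by
  set a := (k * D - 2 * θ) / 2 with ha
  have ha0 : 0 < a := by rw [ha]; linarith
  set ε := min (θ / 2) (a / 2) with hε
  have hε0 : 0 < ε := lt_min (by linarith) (by linarith)
  have hε1 : ε ≤ θ / 2 := min_le_left _ _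
  have hε2 : ε ≤ a / 2 := min_le_right _ _
  obtain ⟨C₁, t₀, hC₁, ht, h⟩ := hS.exists_nat_le hε0
  obtain ⟨C₂, hC₂, hsum⟩ := exists_sum_min_rpow_le ha0 hθ
  refine ⟨C₁ ^ 2 * (1 + (c ^ k)⁻¹) * C₂, t₀, by positivity, ht, fun ρ hρ x hx => ?_⟩
  obtain ⟨hSρ, h⟩ := h ρ hρ
  have hρ0 : 0 < ρ := by linarith
  have hx0 : ∀ i, 0 ≤ x i := fun i => le_trans (by positivity) (hx i)
  have hterm0 : ∀ i : ℕ, 0 ≤ S (i + 1) ^ 2 * ((i : ℝ) + 1) ^ (-1 - 2 * θ) / (1 + x i) ^ k :=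
    fun i => by have := hx0 i; positivity
  refine ⟨Summable.of_nonneg_of_le hterm0 (fun i => ?_)
    (hS.summable_sq h0 (s := -1 - 2 * θ) (by linarith)), ?_⟩
  · exact div_le_self (by positivity) (one_le_pow₀ (by linarith [hx0 i]))
  refine Real.tsum_le_of_sum_range_le hterm0 fun m => ?_
  have hterm : ∀ i : ℕ, S (i + 1) ^ 2 * ((i : ℝ) + 1) ^ (-1 - 2 * θ) / (1 + x i) ^ k
      ≤ C₁ ^ 2 * (1 + (c ^ k)⁻¹) * (ρ ^ (-θ) * S ρ) ^ 2 * (((i : ℝ) + 1)⁻¹ *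
        min ((((i : ℝ) + 1) / ρ) ^ a) ((((i : ℝ) + 1) / ρ) ^ (-θ))) := by
    intro i
    have hj : (0 : ℝ) < (i : ℝ) + 1 := by positivity
    set r := ((i : ℝ) + 1) / ρ with hr
    have hr0 : 0 < r := by positivity
    have hrinv : ρ / ((i : ℝ) + 1) = r⁻¹ := by rw [hr, inv_div]
    have e1 : ((i : ℝ) + 1) ^ (-1 - 2 * θ)
        = (ρ ^ (-θ)) ^ 2 * ((i : ℝ) + 1)⁻¹ * r ^ (-2 * θ) := by
      rw [hr, Real.div_rpow hj.le hρ0.le, ← Real.rpow_natCast, ← Real.rpow_mul hρ0.le,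
        ← Real.rpow_neg_one ((i : ℝ) + 1)]
      have : ρ ^ (-θ * (2 : ℕ)) = ρ ^ (-2 * θ) := by congr 1; push_cast; ring
      rw [this]
      have h3 : ((i : ℝ) + 1) ^ (-1 - 2 * θ)
          = ((i : ℝ) + 1) ^ (-1 : ℝ) * ((i : ℝ) + 1) ^ (-2 * θ) := by
        rw [← Real.rpow_add hj]; congr 1; ring
      rw [h3]
      have : ρ ^ (-2 * θ) ≠ 0 := by positivity
      field_simp
    have hinv : (1 + x i) ^ k ≥ 1 := one_le_pow₀ (by linarith [hx0 i])
    rcases le_total ((i : ℝ) + 1) ρ with h1 | h1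
    · have hr1 : r ≤ 1 := (div_le_one hρ0).2 h1
      have hmin : min (r ^ a) (r ^ (-θ)) = r ^ a :=
        min_eq_left (Real.rpow_le_rpow_of_exponent_ge hr0 hr1 (by linarith))
      rw [hmin]
      have hs := (h i).1 h1
      rw [hrinv] at hs
      have hxk : ((1 + x i) ^ k)⁻¹ ≤ (c ^ k)⁻¹ * r ^ (k * D) := by
        have h2 : c ^ k * r ^ (-(k * D)) ≤ (1 + x i) ^ k := by
          have h3 := hx i
          rw [hrinv, Real.inv_rpow hr0.le, ← Real.rpow_neg hr0.le] at h3
          calc c ^ k * r ^ (-(k * D)) = (c * r ^ (-D)) ^ k := by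
                rw [mul_pow, ← Real.rpow_natCast (r ^ (-D)), ← Real.rpow_mul hr0.le]
                congr 2; ring
            _ ≤ (1 + x i) ^ k := by gcongr; linarith
        have h4 := inv_anti₀ (by positivity) h2
        rwa [mul_inv, Real.rpow_neg hr0.le, inv_inv] at h4
      have hs2 : S (i + 1) ^ 2 ≤ C₁ ^ 2 * r ^ (-2 * ε) * S ρ ^ 2 := by
        calc S (i + 1) ^ 2 ≤ (C₁ * (r⁻¹) ^ ε * S ρ) ^ 2 := by
              gcongr
              exact h0 i
          _ = _ := by
              rw [Real.inv_rpow hr0.le, ← Real.rpow_neg hr0.le, mul_pow, mul_pow,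
                ← Real.rpow_natCast (r ^ (-ε)), ← Real.rpow_mul hr0.le]
              congr 3; push_cast; ring
      have hexp : r ^ (-2 * ε) * r ^ (-2 * θ) * r ^ (k * D) ≤ r ^ a := by
        rw [← Real.rpow_add hr0, ← Real.rpow_add hr0]
        exact Real.rpow_le_rpow_of_exponent_ge hr0 hr1 (by rw [ha] at *; linarith)
      calc S (i + 1) ^ 2 * ((i : ℝ) + 1) ^ (-1 - 2 * θ) / (1 + x i) ^ k
          = S (i + 1) ^ 2 * ((ρ ^ (-θ)) ^ 2 * ((i : ℝ) + 1)⁻¹ * r ^ (-2 * θ))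
            * ((1 + x i) ^ k)⁻¹ := by rw [e1, div_eq_mul_inv]
        _ ≤ (C₁ ^ 2 * r ^ (-2 * ε) * S ρ ^ 2)
            * ((ρ ^ (-θ)) ^ 2 * ((i : ℝ) + 1)⁻¹ * r ^ (-2 * θ))
            * ((c ^ k)⁻¹ * r ^ (k * D)) := by gcongr
        _ = C₁ ^ 2 * (c ^ k)⁻¹ * (ρ ^ (-θ) * S ρ) ^ 2 * (((i : ℝ) + 1)⁻¹
            * (r ^ (-2 * ε) * r ^ (-2 * θ) * r ^ (k * D))) := by ring
        _ ≤ C₁ ^ 2 * (1 + (c ^ k)⁻¹) * (ρ ^ (-θ) * S ρ) ^ 2 * (((i : ℝ) + 1)⁻¹ * r ^ a) := by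
            gcongr
            linarith
    · have hr1 : 1 ≤ r := (one_le_div hρ0).2 h1
      have hmin : min (r ^ a) (r ^ (-θ)) = r ^ (-θ) :=
        min_eq_right (Real.rpow_le_rpow_of_exponent_le hr1 (by linarith))
      rw [hmin]
      have hs := (h i).2 h1
      rw [← hr] at hs
      have hs2 : S (i + 1) ^ 2 ≤ C₁ ^ 2 * r ^ (2 * ε) * S ρ ^ 2 := by
        calc S (i + 1) ^ 2 ≤ (C₁ * r ^ ε * S ρ) ^ 2 := by
              gcongr
              exact h0 i
          _ = _ := by
              rw [mul_pow, mul_pow, ← Real.rpow_natCast (r ^ ε), ← Real.rpow_mul hr0.le]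
              congr 3; push_cast; ring
      have hexp : r ^ (2 * ε) * r ^ (-2 * θ) ≤ r ^ (-θ) := by
        rw [← Real.rpow_add hr0]
        exact Real.rpow_le_rpow_of_exponent_le hr1 (by linarith)
      have hck : 0 < (c ^ k)⁻¹ := by positivity
      calc S (i + 1) ^ 2 * ((i : ℝ) + 1) ^ (-1 - 2 * θ) / (1 + x i) ^ k
          ≤ S (i + 1) ^ 2 * ((i : ℝ) + 1) ^ (-1 - 2 * θ) := div_le_self (by positivity) hinv
        _ = S (i + 1) ^ 2 * ((ρ ^ (-θ)) ^ 2 * ((i : ℝ) + 1)⁻¹ * r ^ (-2 * θ)) := by rw [e1]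
        _ ≤ (C₁ ^ 2 * r ^ (2 * ε) * S ρ ^ 2)
            * ((ρ ^ (-θ)) ^ 2 * ((i : ℝ) + 1)⁻¹ * r ^ (-2 * θ)) := by gcongr
        _ = C₁ ^ 2 * 1 * (ρ ^ (-θ) * S ρ) ^ 2 * (((i : ℝ) + 1)⁻¹
            * (r ^ (2 * ε) * r ^ (-2 * θ))) := by ring
        _ ≤ C₁ ^ 2 * (1 + (c ^ k)⁻¹) * (ρ ^ (-θ) * S ρ) ^ 2 * (((i : ℝ) + 1)⁻¹ * r ^ (-θ)) := by
            gcongr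
            linarith
  calc _ ≤ ∑ i ∈ Finset.range m, C₁ ^ 2 * (1 + (c ^ k)⁻¹) * (ρ ^ (-θ) * S ρ) ^ 2 *
        (((i : ℝ) + 1)⁻¹ * min ((((i : ℝ) + 1) / ρ) ^ a) ((((i : ℝ) + 1) / ρ) ^ (-θ))) :=
        Finset.sum_le_sum fun i _ => hterm i
    _ = C₁ ^ 2 * (1 + (c ^ k)⁻¹) * (ρ ^ (-θ) * S ρ) ^ 2 * ∑ i ∈ Finset.range m,
        (((i : ℝ) + 1)⁻¹ * min ((((i : ℝ) + 1) / ρ) ^ a) ((((i : ℝ) + 1) / ρ) ^ (-θ))) := by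
        rw [Finset.mul_sum]
    _ ≤ C₁ ^ 2 * (1 + (c ^ k)⁻¹) * (ρ ^ (-θ) * S ρ) ^ 2 * C₂ := by
        gcongr
        exact hsum ρ (ht.trans hρ) m
    _ = _ := by ring

/-- A lower bound for a sum from its terms with `ρ < j ≤ 3 ρ` only. -/
theorem PotterBounded.exists_le_sum {S : ℝ → ℝ} (hS : PotterBounded S) (k : ℕ) {s : ℝ}
    (hs : 0 ≤ s) :
    ∃ c t₀ : ℝ, 0 < c ∧ 1 ≤ t₀ ∧ ∀ ρ, t₀ ≤ ρ → c * (ρ ^ (-s) * S ρ ^ k) ≤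
      ∑ i ∈ Finset.Ico ⌈ρ⌉₊ ⌊3 * ρ⌋₊, S ((i : ℝ) + 1) ^ k * ((i : ℝ) + 1) ^ (-1 - s) := by
  obtain ⟨C, t₀, hC, ht, h⟩ := hS 1 one_pos
  refine ⟨((C * 3) ^ k)⁻¹ * 3 ^ (-1 - s), max t₀ 2, by positivity, ht.trans (le_max_left _ _), ?_⟩
  intro ρ hρ
  have hρ1 : t₀ ≤ ρ := (le_max_left _ _).trans hρ
  have hρ2 : 2 ≤ ρ := (le_max_right _ _).trans hρ
  have hρ0 : 0 < ρ := by linarith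
  have hSρ := (h ρ ρ hρ1 le_rfl).1
  have hterm : ∀ i ∈ Finset.Ico ⌈ρ⌉₊ ⌊3 * ρ⌋₊,
      (S ρ / (C * 3)) ^ k * (3 * ρ) ^ (-1 - s)
        ≤ S ((i : ℝ) + 1) ^ k * ((i : ℝ) + 1) ^ (-1 - s) := by
    intro i hi
    obtain ⟨h1, h2⟩ := Finset.mem_Ico.1 hi
    have h3 : ρ ≤ (i : ℝ) + 1 := by linarith [Nat.ceil_le.1 h1]
    have h4 : (i : ℝ) + 1 ≤ 3 * ρ := by
      have := (Nat.le_floor_iff (by positivity)).1 (Nat.succ_le_of_lt h2)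
      exact_mod_cast this
    have hSj := (h ((i : ℝ) + 1) ((i : ℝ) + 1) (hρ1.trans h3) le_rfl).1
    have h5 := (h ρ _ hρ1 h3).2.2
    rw [Real.rpow_one] at h5
    have h6 : ((i : ℝ) + 1) / ρ ≤ 3 := (div_le_iff₀ hρ0).2 h4
    have h7 : S ρ ≤ C * 3 * S ((i : ℝ) + 1) := h5.trans (by gcongr)
    have h8 : S ρ / (C * 3) ≤ S ((i : ℝ) + 1) := by
      rw [div_le_iff₀ (by positivity)]; linarith
    have h9 : (3 * ρ) ^ (-1 - s) ≤ ((i : ℝ) + 1) ^ (-1 - s) :=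
      Real.rpow_le_rpow_of_nonpos (by positivity) h4 (by linarith)
    gcongr
  have hcard : ρ ≤ ((Finset.Ico ⌈ρ⌉₊ ⌊3 * ρ⌋₊).card : ℝ) := by
    rw [Nat.card_Ico]
    have h1 := Nat.ceil_lt_add_one hρ0.le
    have h2 := Nat.sub_one_lt_floor (3 * ρ)
    have h3 : (⌊3 * ρ⌋₊ : ℝ) - ⌈ρ⌉₊ ≤ ((⌊3 * ρ⌋₊ - ⌈ρ⌉₊ : ℕ) : ℝ) := by
      rw [sub_le_iff_le_add]; exact_mod_cast Nat.sub_le_iff_le_add.1 le_rfl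
    linarith
  have hsum := Finset.card_nsmul_le_sum _ _ _ hterm
  refine le_trans ?_ hsum
  rw [nsmul_eq_mul]
  have e : ((C * 3) ^ k)⁻¹ * 3 ^ (-1 - s) * (ρ ^ (-s) * S ρ ^ k)
      = ρ * ((S ρ / (C * 3)) ^ k * (3 * ρ) ^ (-1 - s)) := by
    rw [Real.mul_rpow (by norm_num) hρ0.le, div_pow]
    have : ρ ^ (-s) = ρ * ρ ^ (-1 - s) := by
      nth_rewrite 2 [← Real.rpow_one ρ]
      rw [← Real.rpow_add hρ0]; congr 1; ring
    rw [this]; ring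
  rw [e]
  gcongr

theorem PotterBounded.exists_le_tsum {S : ℝ → ℝ} (hS : PotterBounded S) (k : ℕ) {s : ℝ}
    (hs : 0 ≤ s) :
    ∃ c t₀ : ℝ, 0 < c ∧ 1 ≤ t₀ ∧ ∀ ρ, t₀ ≤ ρ → ∀ (f : ℕ → ℝ) (d : ℝ), Summable f →
      (∀ i, 0 ≤ f i) → 0 ≤ d →
      (∀ i : ℕ, ρ ≤ (i : ℝ) + 1 → (i : ℝ) + 1 ≤ 3 * ρ →
        d * (S ((i : ℝ) + 1) ^ k * ((i : ℝ) + 1) ^ (-1 - s)) ≤ f i) →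
      c * d * (ρ ^ (-s) * S ρ ^ k) ≤ ∑' i, f i := by
  obtain ⟨c, t₀, hc, ht, h⟩ := hS.exists_le_sum k hs
  refine ⟨c, t₀, hc, ht, fun ρ hρ f d hf hf0 hd hle => ?_⟩
  calc c * d * (ρ ^ (-s) * S ρ ^ k) = d * (c * (ρ ^ (-s) * S ρ ^ k)) := by ring
    _ ≤ d * ∑ i ∈ Finset.Ico ⌈ρ⌉₊ ⌊3 * ρ⌋₊, S ((i : ℝ) + 1) ^ k * ((i : ℝ) + 1) ^ (-1 - s) := by
        gcongr
        exact h ρ hρ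
    _ ≤ ∑ i ∈ Finset.Ico ⌈ρ⌉₊ ⌊3 * ρ⌋₊, f i := by
        rw [Finset.mul_sum]
        refine Finset.sum_le_sum fun i hi => hle i ?_ ?_
        · obtain ⟨h1, -⟩ := Finset.mem_Ico.1 hi
          linarith [Nat.ceil_le.1 h1]
        · obtain ⟨-, h2⟩ := Finset.mem_Ico.1 hi
          have := (Nat.le_floor_iff (by linarith [ht.trans hρ])).1 (Nat.succ_le_of_lt h2)
          exact_mod_cast this
    _ ≤ ∑' i, f i := hf.sum_le_tsum _ fun i _ => hf0 i

/-! ### The slowly varying factor of the bias -/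

/-- The sums `∑_{j ≤ ρ} S(j)² / j`, which make up the bias factor in the critical case. -/
noncomputable def cumulSq (S : ℝ → ℝ) (ρ : ℝ) : ℝ :=
  ∑ i ∈ Finset.range ⌊ρ⌋₊, S ((i : ℝ) + 1) ^ 2 / ((i : ℝ) + 1)

theorem cumulSq_nonneg (S : ℝ → ℝ) (ρ : ℝ) : 0 ≤ cumulSq S ρ :=
  Finset.sum_nonneg fun _ _ => by positivity

theorem cumulSq_mono (S : ℝ → ℝ) {X Y : ℝ} (h : X ≤ Y) : cumulSq S X ≤ cumulSq S Y :=
  Finset.sum_le_sum_of_subset_of_nonneg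
    (Finset.range_mono (Nat.floor_mono h)) fun _ _ _ => by positivity

/-- The indices between `ρ / 3` and `ρ` alone contribute `S(ρ)²`, up to a constant. -/
theorem PotterBounded.exists_sq_le_cumulSq {S : ℝ → ℝ} (hS : PotterBounded S) :
    ∃ c t₀ : ℝ, 0 < c ∧ 1 ≤ t₀ ∧ ∀ ρ, t₀ ≤ ρ → c * S ρ ^ 2 ≤ cumulSq S ρ := by
  obtain ⟨c, t₁, hc, ht₁, h₁⟩ := hS.exists_le_sum 2 (s := 0) le_rfl
  obtain ⟨C, t₂, hC, ht₂, h₂⟩ := hS 1 one_pos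
  refine ⟨c * ((C * 3) ^ 2)⁻¹, 3 * max t₁ t₂, by positivity,
    by linarith [le_max_left t₁ t₂], fun ρ hρ => ?_⟩
  have hρ1 : t₁ ≤ ρ / 3 := by linarith [le_max_left t₁ t₂]
  have hρ2 : t₂ ≤ ρ / 3 := by linarith [le_max_right t₁ t₂]
  have hρ0 : 0 < ρ / 3 := by linarith
  have a := h₁ (ρ / 3) hρ1
  obtain ⟨b0, -, b⟩ := h₂ (ρ / 3) ρ hρ2 (by linarith)
  have b' := (h₂ (ρ / 3) ρ hρ2 (by linarith)).2.1
  have hρ3 : ρ ≠ 0 := fun h => by simp [h] at hρ0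
  have e3 : ρ / (ρ / 3) = 3 := by field_simp
  rw [e3, Real.rpow_one] at b'
  have hSρ := (h₂ ρ ρ (by linarith) le_rfl).1
  rw [mul_div_cancel₀ ρ (by norm_num : (3 : ℝ) ≠ 0), neg_zero, Real.rpow_zero, one_mul] at a
  calc c * ((C * 3) ^ 2)⁻¹ * S ρ ^ 2 ≤ c * ((C * 3) ^ 2)⁻¹ * (C * 3 * S (ρ / 3)) ^ 2 := by gcongr
    _ = c * S (ρ / 3) ^ 2 := by field_simp
    _ ≤ _ := a
    _ ≤ cumulSq S ρ := by
      simp only [cumulSq, sub_zero, Real.rpow_neg_one, ← div_eq_mul_inv]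
      refine Finset.sum_le_sum_of_subset_of_nonneg (fun i hi => ?_) fun _ _ _ => by positivity
      exact Finset.mem_range.2 (Finset.mem_Ico.1 hi).2

/-- The terms of the sum between `X` and `Y` add up to at most a small power of `Y / X` times
`S(X)²`, which is dominated by the sum up to `X`. -/
theorem PotterBounded.sqrt_cumulSq {S : ℝ → ℝ} (hS : PotterBounded S)
    (h0 : ∀ i : ℕ, 0 ≤ S (i + 1)) : PotterBounded fun ρ => √(cumulSq S ρ) := by
  intro ε' hε'
  -- the sum of `j ^ (2 ε - 1)` is estimated for `2 ε ≤ 1` only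
  set ε := min ε' (1 / 2) with hε
  have hε0 : 0 < ε := lt_min hε' (by norm_num)
  have hε1 : ε ≤ 1 / 2 := min_le_right _ _
  obtain ⟨c, t₁, hc, ht₁, h₁⟩ := hS.exists_sq_le_cumulSq
  obtain ⟨C, t₂, hC, ht₂, h₂⟩ := hS ε hε0
  refine ⟨√(1 + C ^ 2 / (c * (2 * ε))), max t₁ t₂, ?_, ht₁.trans (le_max_left _ _), ?_⟩
  · rw [Real.one_le_sqrt]
    linarith [show 0 ≤ C ^ 2 / (c * (2 * ε)) by positivity]
  intro X Y hX hXY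
  have hX1 : t₁ ≤ X := (le_max_left _ _).trans hX
  have hX2 : t₂ ≤ X := (le_max_right _ _).trans hX
  have hX0 : 0 < X := by linarith
  have hY0 : 0 < Y := by linarith
  have hSX := (h₂ X X hX2 le_rfl).1
  have hpos : 0 < cumulSq S X := lt_of_lt_of_le (by positivity) (h₁ X hX1)
  have hq : 1 ≤ Y / X := (one_le_div hX0).2 hXY
  have hqε : 1 ≤ (Y / X) ^ ε := Real.one_le_rpow hq hε0.le
  have hqle : (Y / X) ^ ε ≤ (Y / X) ^ ε' :=
    Real.rpow_le_rpow_of_exponent_le hq (min_le_left _ _)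
  have hA : 1 ≤ √(1 + C ^ 2 / (c * (2 * ε))) := by
    rw [Real.one_le_sqrt]
    linarith [show 0 ≤ C ^ 2 / (c * (2 * ε)) by positivity]
  refine ⟨Real.sqrt_pos.2 hpos, ?_, ?_⟩
  · have hfl : ⌊X⌋₊ ≤ ⌊Y⌋₊ := Nat.floor_mono hXY
    have hsplit : cumulSq S Y = cumulSq S X
        + ∑ i ∈ Finset.Ico ⌊X⌋₊ ⌊Y⌋₊, S ((i : ℝ) + 1) ^ 2 / ((i : ℝ) + 1) :=
      (Finset.sum_range_add_sum_Ico _ hfl).symm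
    have hterm : ∀ i ∈ Finset.Ico ⌊X⌋₊ ⌊Y⌋₊, S ((i : ℝ) + 1) ^ 2 / ((i : ℝ) + 1)
        ≤ C ^ 2 * S X ^ 2 * X ^ (-(2 * ε)) * ((i : ℝ) + 1) ^ (2 * ε - 1) := by
      intro i hi
      have hj : (0 : ℝ) < (i : ℝ) + 1 := by positivity
      have h3 : X ≤ (i : ℝ) + 1 := by
        have := Nat.lt_floor_add_one X
        have h4 : (⌊X⌋₊ : ℝ) ≤ i := by exact_mod_cast (Finset.mem_Ico.1 hi).1
        linarith
      have h5 := (h₂ X _ hX2 h3).2.1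
      calc S ((i : ℝ) + 1) ^ 2 / ((i : ℝ) + 1)
          ≤ (C * (((i : ℝ) + 1) / X) ^ ε * S X) ^ 2 / ((i : ℝ) + 1) := by
            gcongr
            exact h0 i
        _ = _ := by
            rw [Real.div_rpow hj.le hX0.le, Real.rpow_sub_one hj.ne', Real.rpow_neg hX0.le,
              two_mul, Real.rpow_add hX0, Real.rpow_add hj]
            field_simp
    have hsum : ∑ i ∈ Finset.Ico ⌊X⌋₊ ⌊Y⌋₊, S ((i : ℝ) + 1) ^ 2 / ((i : ℝ) + 1)
        ≤ C ^ 2 * S X ^ 2 * X ^ (-(2 * ε)) * (Y ^ (2 * ε) / (2 * ε)) := by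
      refine (Finset.sum_le_sum hterm).trans ?_
      rw [← Finset.mul_sum]
      have h3 : ∑ i ∈ Finset.Ico ⌊X⌋₊ ⌊Y⌋₊, ((i : ℝ) + 1) ^ (2 * ε - 1)
          ≤ ∑ i ∈ Finset.range ⌊Y⌋₊, ((i : ℝ) + 1) ^ (2 * ε - 1) :=
        Finset.sum_le_sum_of_subset_of_nonneg
          (fun i hi => Finset.mem_range.2 (Finset.mem_Ico.1 hi).2) fun _ _ _ => by positivity
      have h4 := sum_range_rpow_le (a := 2 * ε) (by positivity) (by linarith) ⌊Y⌋₊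
      have h5 : ((⌊Y⌋₊ : ℝ)) ^ (2 * ε) ≤ Y ^ (2 * ε) :=
        Real.rpow_le_rpow (by positivity) (Nat.floor_le hY0.le) (by positivity)
      have h6 : (⌊Y⌋₊ : ℝ) ^ (2 * ε) / (2 * ε) ≤ Y ^ (2 * ε) / (2 * ε) := by gcongr
      gcongr
      linarith
    have hsq : S X ^ 2 ≤ cumulSq S X / c := by
      rw [le_div_iff₀ hc]; linarith [h₁ X hX1]
    have hfin : cumulSq S Y ≤ (1 + C ^ 2 / (c * (2 * ε))) * ((Y / X) ^ ε) ^ 2 * cumulSq S X := by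
      have e : ((Y / X) ^ ε) ^ 2 = X ^ (-(2 * ε)) * Y ^ (2 * ε) := by
        rw [Real.div_rpow hY0.le hX0.le, Real.rpow_neg hX0.le, two_mul, Real.rpow_add hX0,
          Real.rpow_add hY0]
        field_simp
      have h3 : C ^ 2 * S X ^ 2 * X ^ (-(2 * ε)) * (Y ^ (2 * ε) / (2 * ε))
          ≤ C ^ 2 * (cumulSq S X / c) * X ^ (-(2 * ε)) * (Y ^ (2 * ε) / (2 * ε)) := by gcongr
      have h4 : C ^ 2 * (cumulSq S X / c) * X ^ (-(2 * ε)) * (Y ^ (2 * ε) / (2 * ε))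
          = C ^ 2 / (c * (2 * ε)) * ((Y / X) ^ ε) ^ 2 * cumulSq S X := by
        rw [e]; field_simp
      have h5 : cumulSq S X ≤ ((Y / X) ^ ε) ^ 2 * cumulSq S X :=
        le_mul_of_one_le_left hpos.le (one_le_pow₀ hqε)
      rw [hsplit]
      linarith
    calc √(cumulSq S Y) ≤ √((1 + C ^ 2 / (c * (2 * ε))) * ((Y / X) ^ ε) ^ 2 * cumulSq S X) :=
          Real.sqrt_le_sqrt hfin
      _ = √(1 + C ^ 2 / (c * (2 * ε))) * (Y / X) ^ ε * √(cumulSq S X) := by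
          rw [Real.sqrt_mul (by positivity), Real.sqrt_mul (by positivity),
            Real.sqrt_sq (by positivity)]
      _ ≤ _ := by gcongr
  · calc √(cumulSq S X) ≤ √(cumulSq S Y) := Real.sqrt_le_sqrt (cumulSq_mono S hXY)
      _ = 1 * 1 * √(cumulSq S Y) := by ring
      _ ≤ _ := by
        gcongr
        exact hqε.trans hqle

open Classical in
/-- The slowly varying factor of the maximal bias as a function of the effective dimension `ρ`,
when the bias has exponent `θ` and saturates at the exponent `D`. -/
noncomputable def biasShape (S : ℝ → ℝ) (θ D ρ : ℝ) : ℝ :=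
  if θ < D then S ρ else if θ = D then √(cumulSq S ρ) else 1

theorem PotterBounded.biasShape {S : ℝ → ℝ} (hS : PotterBounded S)
    (h0 : ∀ i : ℕ, 0 ≤ S (i + 1)) (θ D : ℝ) : PotterBounded (biasShape S θ D) := by
  unfold LinearCredible.biasShape
  rcases lt_trichotomy θ D with h | h | h
  · simpa [h] using hS
  · simpa [h] using hS.sqrt_cumulSq h0
  · simpa [h.not_gt, h.ne'] using PotterBounded.one

/-- One nonzero term of a sum bounds it from below by `ρ ^ (-D)`, for large `ρ`. -/
theorem PotterBounded.exists_term_le {S : ℝ → ℝ} (hS : PotterBounded S) {D C : ℝ} (hD : 0 < D)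
    (hC : 0 < C) (k m : ℕ) (s : ℝ) :
    ∃ c t₀ : ℝ, 0 < c ∧ 1 ≤ t₀ ∧ ∀ ρ, t₀ ≤ ρ → ∀ x : ℕ → ℝ,
      (∀ i, 0 ≤ x i ∧ x i ≤ C * (ρ / (i + 1)) ^ D) →
      ∃ i : ℕ, c * (ρ ^ (-D)) ^ k ≤ S (i + 1) ^ m * ((i : ℝ) + 1) ^ s / (1 + x i) ^ k := by
  obtain ⟨t, ht, hpos⟩ := hS.eventually_pos
  set i := ⌈t⌉₊ with hi
  have hj : (0 : ℝ) < (i : ℝ) + 1 := by positivity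
  have hSj : 0 < S ((i : ℝ) + 1) := hpos _ (by linarith [Nat.le_ceil t])
  refine ⟨S (i + 1) ^ m * ((i : ℝ) + 1) ^ s * (((1 + C) * ((i : ℝ) + 1) ^ (-D)) ^ k)⁻¹,
    (i : ℝ) + 1, by positivity, by linarith [(i.cast_nonneg : (0 : ℝ) ≤ i)], ?_⟩
  intro ρ hρ x hx
  refine ⟨i, ?_⟩
  have hρ0 : 0 < ρ := by linarith
  obtain ⟨h1, h2⟩ := hx i
  have h3 : 1 ≤ (ρ / (i + 1)) ^ D := Real.one_le_rpow ((one_le_div hj).2 hρ) hD.le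
  have h4 : 1 + x i ≤ (1 + C) * (((i : ℝ) + 1) ^ (-D) * ρ ^ D) := by
    have e : ((i : ℝ) + 1) ^ (-D) * ρ ^ D = (ρ / (i + 1)) ^ D := by
      rw [Real.div_rpow hρ0.le hj.le, Real.rpow_neg hj.le]; field_simp
    rw [e]; linarith
  have h5 : (1 + x i) ^ k ≤ ((1 + C) * (((i : ℝ) + 1) ^ (-D) * ρ ^ D)) ^ k := by gcongr
  rw [div_eq_mul_inv, mul_assoc]
  gcongr
  refine le_trans (le_of_eq ?_) (inv_anti₀ (by positivity) h5)
  rw [← mul_assoc, mul_pow _ (ρ ^ D), mul_inv, Real.rpow_neg hρ0.le, inv_pow]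

/-- The order of the squared maximal bias. If `θ < D` the indices near `ρ` dominate, if `θ = D` all
indices up to `ρ` contribute `S(j)² / j`, and if `θ > D` the indices of bounded size dominate. -/
theorem PotterBounded.exists_biasSum_bounds {S : ℝ → ℝ} (hS : PotterBounded S)
    (h0 : ∀ i : ℕ, 0 ≤ S (i + 1)) {θ D c C : ℝ} (hθ : 0 < θ) (hD : 0 < D) (hc : 0 < c)
    (hC : 0 < C) :
    ∃ c' C' t₀ : ℝ, 0 < c' ∧ 0 < C' ∧ 1 ≤ t₀ ∧ ∀ ρ, t₀ ≤ ρ → ∀ x : ℕ → ℝ,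
      (∀ i, c * (ρ / (i + 1)) ^ D ≤ x i ∧ x i ≤ C * (ρ / (i + 1)) ^ D) →
      Summable (fun i : ℕ => S (i + 1) ^ 2 * ((i : ℝ) + 1) ^ (-1 - 2 * θ) / (1 + x i) ^ 2) ∧
      c' * (ρ ^ (-min θ D) * LinearCredible.biasShape S θ D ρ) ^ 2
        ≤ ∑' i : ℕ, S (i + 1) ^ 2 * ((i : ℝ) + 1) ^ (-1 - 2 * θ) / (1 + x i) ^ 2 ∧
      ∑' i : ℕ, S (i + 1) ^ 2 * ((i : ℝ) + 1) ^ (-1 - 2 * θ) / (1 + x i) ^ 2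
        ≤ C' * (ρ ^ (-min θ D) * LinearCredible.biasShape S θ D ρ) ^ 2 := by
  have hsumm : ∀ x : ℕ → ℝ, (∀ i, 0 ≤ x i) →
      Summable (fun i : ℕ => S (i + 1) ^ 2 * ((i : ℝ) + 1) ^ (-1 - 2 * θ) / (1 + x i) ^ 2) := by
    intro x hx
    refine Summable.of_nonneg_of_le (fun i => ?_) (fun i => ?_)
      (hS.summable_sq h0 (s := -1 - 2 * θ) (by linarith))
    · have := hx i; positivity
    · exact div_le_self (by positivity) (one_le_pow₀ (by linarith [hx i]))
  rcases lt_trichotomy θ D with h | h | h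
  -- the indices near `ρ` give both bounds
  · obtain ⟨C₁, t₁, hC₁, ht₁, h₁⟩ := hS.exists_tsum_le h0 (k := 2) (D := D) hθ
      (by push_cast; linarith) hc
    obtain ⟨c₂, t₂, hc₂, ht₂, h₂⟩ := hS.exists_le_tsum 2 (s := 2 * θ) (by linarith)
    refine ⟨c₂ * ((1 + C) ^ 2)⁻¹, C₁, max t₁ t₂, by positivity, hC₁, ht₁.trans (le_max_left _ _),
      fun ρ hρ x hx => ?_⟩
    have hρ0 : 0 < ρ := by linarith [(le_max_left _ _).trans hρ]
    have hx0 : ∀ i, 0 ≤ x i := fun i => le_trans (by positivity) (hx i).1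
    rw [min_eq_left h.le]
    simp only [LinearCredible.biasShape, h, if_true]
    refine ⟨hsumm x hx0, ?_, (h₁ ρ ((le_max_left _ _).trans hρ) x fun i => (hx i).1).2⟩
    have key := h₂ ρ ((le_max_right _ _).trans hρ) _ ((1 + C) ^ 2)⁻¹ (hsumm x hx0)
      (fun i => by have := hx0 i; positivity) (by positivity) (fun i hi _ => ?_)
    · refine le_trans (le_of_eq ?_) key
      rw [mul_pow, ← Real.rpow_natCast (ρ ^ (-θ)), ← Real.rpow_mul hρ0.le]
      congr 3; push_cast; ring
    · have hj : (0 : ℝ) < (i : ℝ) + 1 := by positivity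
      have h3 : (ρ / (i + 1)) ^ D ≤ 1 :=
        Real.rpow_le_one (by positivity) ((div_le_one hj).2 hi) hD.le
      have h4 : x i ≤ C := (hx i).2.trans (mul_le_of_le_one_right hC.le h3)
      have h5 := hx0 i
      rw [div_eq_inv_mul]
      gcongr
  -- The sum over `j ≤ ρ` is a multiple of `cumulSq`. In the sum over `j > ρ`, the numbers `x i` are
  -- bounded, so that the exponent of `1 + x i` can be raised to `3`, for which the sum over all
  -- indices is dominated by the indices near `ρ`.
  · subst h
    obtain ⟨C₁, t₁, hC₁, ht₁, h₁⟩ := hS.exists_tsum_le h0 (k := 3) (D := θ) hθ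
      (by push_cast; linarith) hc
    obtain ⟨c₂, t₂, hc₂, ht₂, h₂⟩ := hS.exists_sq_le_cumulSq
    refine ⟨((1 + C) ^ 2)⁻¹, (c ^ 2)⁻¹ + (1 + C) * C₁ / c₂, max t₁ t₂, by positivity,
      by positivity, ht₁.trans (le_max_left _ _), fun ρ hρ x hx => ?_⟩
    have hρ1 : t₁ ≤ ρ := (le_max_left _ _).trans hρ
    have hρ0 : 0 < ρ := by linarith
    have hx0 : ∀ i, 0 ≤ x i := fun i => le_trans (by positivity) (hx i).1
    rw [min_self]
    simp only [LinearCredible.biasShape, lt_irrefl, if_true, if_false]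
    rw [mul_pow, Real.sq_sqrt (cumulSq_nonneg S ρ)]
    have hpow : ∀ i : ℕ, ((i : ℝ) + 1) ^ (-1 - 2 * θ) * ((ρ / ((i : ℝ) + 1)) ^ θ)⁻¹ ^ 2
        = (ρ ^ (-θ)) ^ 2 * ((i : ℝ) + 1)⁻¹ := by
      intro i
      have hj : (0 : ℝ) < (i : ℝ) + 1 := by positivity
      rw [Real.div_rpow hρ0.le hj.le, Real.rpow_sub hj, Real.rpow_neg_one, two_mul,
        Real.rpow_add hj, Real.rpow_neg hρ0.le]
      field_simp
    refine ⟨hsumm x hx0, ?_, ?_⟩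
    · refine le_trans ?_ ((hsumm x hx0).sum_le_tsum (Finset.range ⌊ρ⌋₊)
        fun i _ => by have := hx0 i; positivity)
      rw [cumulSq, Finset.mul_sum, Finset.mul_sum]
      refine Finset.sum_le_sum fun i hi => ?_
      have hj : (0 : ℝ) < (i : ℝ) + 1 := by positivity
      have hiρ : (i : ℝ) + 1 ≤ ρ := by
        have := (Nat.le_floor_iff hρ0.le).1 (Nat.succ_le_of_lt (Finset.mem_range.1 hi))
        exact_mod_cast this
      have h3 : 1 ≤ (ρ / ((i : ℝ) + 1)) ^ θ := Real.one_le_rpow ((one_le_div hj).2 hiρ) hθ.le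
      have h4 : 1 + x i ≤ (1 + C) * (ρ / ((i : ℝ) + 1)) ^ θ := by linarith [(hx i).2]
      have h5 := hx0 i
      calc ((1 + C) ^ 2)⁻¹ * ((ρ ^ (-θ)) ^ 2 * (S ((i : ℝ) + 1) ^ 2 / ((i : ℝ) + 1)))
          = S ((i : ℝ) + 1) ^ 2 * ((1 + C) ^ 2)⁻¹ * ((ρ ^ (-θ)) ^ 2 * ((i : ℝ) + 1)⁻¹) := by ring
        _ = S ((i : ℝ) + 1) ^ 2 * ((i : ℝ) + 1) ^ (-1 - 2 * θ)
            / ((1 + C) * (ρ / ((i : ℝ) + 1)) ^ θ) ^ 2 := by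
            rw [← hpow i]; field_simp
        _ ≤ _ := by gcongr
    · obtain ⟨hs3, ht3⟩ := h₁ ρ hρ1 x fun i => (hx i).1
      set H : ℕ → ℝ := fun i => if i ∈ Finset.range ⌊ρ⌋₊ then
        (c ^ 2)⁻¹ * (ρ ^ (-θ)) ^ 2 * (S ((i : ℝ) + 1) ^ 2 / ((i : ℝ) + 1)) else 0 with hH
      have hHs : HasSum H (∑ i ∈ Finset.range ⌊ρ⌋₊, H i) :=
        hasSum_sum_of_ne_finset_zero fun i hi => by simp only [hH, hi, if_false]
      have hle : ∀ i : ℕ, S ((i : ℝ) + 1) ^ 2 * ((i : ℝ) + 1) ^ (-1 - 2 * θ) / (1 + x i) ^ 2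
          ≤ H i + (1 + C) * (S ((i : ℝ) + 1) ^ 2 * ((i : ℝ) + 1) ^ (-1 - 2 * θ)
            / (1 + x i) ^ 3) := by
        intro i
        have hj : (0 : ℝ) < (i : ℝ) + 1 := by positivity
        have h5 := hx0 i
        by_cases hi : i ∈ Finset.range ⌊ρ⌋₊
        · have h6 : c * (ρ / ((i : ℝ) + 1)) ^ θ ≤ 1 + x i := by linarith [(hx i).1]
          simp only [hH, hi, if_true]
          refine le_add_of_le_of_nonneg ?_ (by positivity)
          calc S ((i : ℝ) + 1) ^ 2 * ((i : ℝ) + 1) ^ (-1 - 2 * θ) / (1 + x i) ^ 2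
              ≤ S ((i : ℝ) + 1) ^ 2 * ((i : ℝ) + 1) ^ (-1 - 2 * θ)
                / (c * (ρ / ((i : ℝ) + 1)) ^ θ) ^ 2 := by gcongr
            _ = (c ^ 2)⁻¹ * S ((i : ℝ) + 1) ^ 2 * (((i : ℝ) + 1) ^ (-1 - 2 * θ)
                * ((ρ / ((i : ℝ) + 1)) ^ θ)⁻¹ ^ 2) := by field_simp
            _ = _ := by rw [hpow i]; ring
        · have h6 : ρ ≤ (i : ℝ) + 1 := by
            have h7 : ⌊ρ⌋₊ ≤ i := by simpa using hi
            have h8 : (⌊ρ⌋₊ : ℝ) ≤ i := by exact_mod_cast h7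
            linarith [Nat.lt_floor_add_one ρ]
          have h3 : (ρ / ((i : ℝ) + 1)) ^ θ ≤ 1 :=
            Real.rpow_le_one (by positivity) ((div_le_one hj).2 h6) hD.le
          have h4 : x i ≤ C := (hx i).2.trans (mul_le_of_le_one_right hC.le h3)
          simp only [hH, hi, if_false, zero_add]
          calc S ((i : ℝ) + 1) ^ 2 * ((i : ℝ) + 1) ^ (-1 - 2 * θ) / (1 + x i) ^ 2
              = (1 + x i) * (S ((i : ℝ) + 1) ^ 2 * ((i : ℝ) + 1) ^ (-1 - 2 * θ)
                / (1 + x i) ^ 3) := by field_simp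
            _ ≤ _ := by gcongr
      have htot := (hsumm x hx0).tsum_le_tsum hle (hHs.summable.add (hs3.mul_left (1 + C)))
      rw [hHs.summable.tsum_add (hs3.mul_left (1 + C)), hHs.tsum_eq, tsum_mul_left] at htot
      have e1 : ∑ i ∈ Finset.range ⌊ρ⌋₊, H i = (c ^ 2)⁻¹ * (ρ ^ (-θ)) ^ 2 * cumulSq S ρ := by
        rw [cumulSq, Finset.mul_sum]
        exact Finset.sum_congr rfl fun i hi => by simp only [hH, hi, if_true]
      rw [e1] at htot
      have h6 : S ρ ^ 2 ≤ cumulSq S ρ / c₂ := by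
        rw [le_div_iff₀ hc₂]; linarith [h₂ ρ ((le_max_right _ _).trans hρ)]
      calc _ ≤ _ := htot
        _ ≤ (c ^ 2)⁻¹ * (ρ ^ (-θ)) ^ 2 * cumulSq S ρ
            + (1 + C) * (C₁ * (ρ ^ (-θ) * S ρ) ^ 2) := by gcongr
        _ = (c ^ 2)⁻¹ * (ρ ^ (-θ)) ^ 2 * cumulSq S ρ
            + (1 + C) * C₁ * (ρ ^ (-θ)) ^ 2 * S ρ ^ 2 := by ring
        _ ≤ (c ^ 2)⁻¹ * (ρ ^ (-θ)) ^ 2 * cumulSq S ρ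
            + (1 + C) * C₁ * (ρ ^ (-θ)) ^ 2 * (cumulSq S ρ / c₂) := by gcongr
        _ = _ := by ring
  -- bounding `1 + x i` below by a multiple of `(ρ / j) ^ D` leaves a convergent series, so that a
  -- single nonzero term gives the order of the sum
  · have hs := hS.summable_sq h0 (s := -1 - 2 * (θ - D)) (by linarith)
    obtain ⟨c₂, t₂, hc₂, ht₂, h₂⟩ := hS.exists_term_le (D := D) hD hC 2 2 (-1 - 2 * θ)
    have hT0 : 0 ≤ ∑' i : ℕ, S (i + 1) ^ 2 * ((i : ℝ) + 1) ^ (-1 - 2 * (θ - D)) :=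
      tsum_nonneg fun i => by positivity
    refine ⟨c₂, (c ^ 2)⁻¹ * (∑' i : ℕ, S (i + 1) ^ 2 * ((i : ℝ) + 1) ^ (-1 - 2 * (θ - D)) + 1),
      t₂, hc₂, by positivity, ht₂, fun ρ hρ x hx => ?_⟩
    have hρ0 : 0 < ρ := by linarith
    have hx0 : ∀ i, 0 ≤ x i := fun i => le_trans (by positivity) (hx i).1
    rw [min_eq_right h.le]
    simp only [LinearCredible.biasShape, h.not_gt, h.ne', if_false, mul_one]
    refine ⟨hsumm x hx0, ?_, ?_⟩
    · obtain ⟨i, hi⟩ := h₂ ρ hρ x fun i => ⟨hx0 i, (hx i).2⟩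
      exact hi.trans ((hsumm x hx0).le_tsum i fun i _ => by have := hx0 i; positivity)
    · have hle : ∀ i : ℕ, S ((i : ℝ) + 1) ^ 2 * ((i : ℝ) + 1) ^ (-1 - 2 * θ) / (1 + x i) ^ 2
          ≤ (c ^ 2)⁻¹ * (ρ ^ (-D)) ^ 2
            * (S (i + 1) ^ 2 * ((i : ℝ) + 1) ^ (-1 - 2 * (θ - D))) := by
        intro i
        have hj : (0 : ℝ) < (i : ℝ) + 1 := by positivity
        have h5 := hx0 i
        have h6 : c * (ρ / ((i : ℝ) + 1)) ^ D ≤ 1 + x i := by linarith [(hx i).1]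
        calc S ((i : ℝ) + 1) ^ 2 * ((i : ℝ) + 1) ^ (-1 - 2 * θ) / (1 + x i) ^ 2
            ≤ S ((i : ℝ) + 1) ^ 2 * ((i : ℝ) + 1) ^ (-1 - 2 * θ)
              / (c * (ρ / ((i : ℝ) + 1)) ^ D) ^ 2 := by gcongr
          _ = _ := by
            have e : -1 - 2 * (θ - D) = -1 - 2 * θ + D + D := by ring
            rw [e, Real.rpow_add hj, Real.rpow_add hj, Real.div_rpow hρ0.le hj.le,
              Real.rpow_neg hρ0.le]
            field_simp
      have htot := (hsumm x hx0).tsum_le_tsum hle (hs.mul_left _)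
      rw [tsum_mul_left] at htot
      have h7 : 0 ≤ (c ^ 2)⁻¹ * (ρ ^ (-D)) ^ 2 := by positivity
      linarith

/-- The bias at the fixed sequence `j ↦ ± j^{-β-1/2-ε}` is smaller than the maximal bias by no more
than a factor `ρ ^ (-ε)`. -/
theorem PotterBounded.exists_fixedBias_ge {S : ℝ → ℝ} (hS : PotterBounded S)
    (h0 : ∀ i : ℕ, 0 ≤ S (i + 1)) {θ D C ε : ℝ} (hθ : 0 < θ) (hD : 0 < D)
    (hC : 0 < C) (hε : 0 < ε) :
    ∃ c' t₀ : ℝ, 0 < c' ∧ 1 ≤ t₀ ∧ ∀ ρ, t₀ ≤ ρ → ∀ x : ℕ → ℝ,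
      (∀ i, 0 ≤ x i ∧ x i ≤ C * (ρ / (i + 1)) ^ D) →
      Summable (fun i : ℕ => S (i + 1) * ((i : ℝ) + 1) ^ (-1 - (θ + ε)) / (1 + x i)) ∧
      c' * (ρ ^ (-ε) * (ρ ^ (-min θ D) * LinearCredible.biasShape S θ D ρ))
        ≤ ∑' i : ℕ, S (i + 1) * ((i : ℝ) + 1) ^ (-1 - (θ + ε)) / (1 + x i) := by
  have hsumm : ∀ x : ℕ → ℝ, (∀ i, 0 ≤ x i) →
      Summable (fun i : ℕ => S (i + 1) * ((i : ℝ) + 1) ^ (-1 - (θ + ε)) / (1 + x i)) := by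
    obtain ⟨B, hB, hle⟩ := hS.exists_le_rpow hε
    intro x hx
    refine Summable.of_nonneg_of_le (fun i => ?_) (fun i => ?_)
      ((summable_rpow_add_one (s := -1 - θ) (by linarith)).mul_left B)
    · have := hx i
      have := h0 i
      positivity
    · have := h0 i
      have hj : (0 : ℝ) < (i : ℝ) + 1 := by positivity
      refine (div_le_self (by positivity) (by linarith [hx i])).trans ?_
      calc S (i + 1) * ((i : ℝ) + 1) ^ (-1 - (θ + ε))
          ≤ B * ((i : ℝ) + 1) ^ ε * ((i : ℝ) + 1) ^ (-1 - (θ + ε)) := by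
            gcongr
            exact hle i
        _ = B * ((i : ℝ) + 1) ^ (-1 - θ) := by
            rw [mul_assoc, ← Real.rpow_add hj]; congr 2; ring
  rcases lt_or_ge θ D with h | h
  · obtain ⟨c₂, t₂, hc₂, ht₂, h₂⟩ := hS.exists_le_tsum 1 (s := θ + ε) (by linarith)
    refine ⟨c₂ * (1 + C)⁻¹, t₂, by positivity, ht₂, fun ρ hρ x hx => ?_⟩
    have hρ0 : 0 < ρ := by linarith
    refine ⟨hsumm x fun i => (hx i).1, ?_⟩
    rw [min_eq_left h.le]
    simp only [LinearCredible.biasShape, h, if_true]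
    have key := h₂ ρ hρ _ (1 + C)⁻¹ (hsumm x fun i => (hx i).1)
      (fun i => by
        have := (hx i).1
        have := h0 i
        positivity) (by positivity) (fun i hi _ => ?_)
    · refine le_trans (le_of_eq ?_) key
      rw [pow_one, neg_add, Real.rpow_add hρ0]
      ring
    · have hj : (0 : ℝ) < (i : ℝ) + 1 := by positivity
      have h3 : (ρ / (i + 1)) ^ D ≤ 1 :=
        Real.rpow_le_one (by positivity) ((div_le_one hj).2 hi) hD.le
      have h4 : x i ≤ C := (hx i).2.trans (mul_le_of_le_one_right hC.le h3)
      have h5 := (hx i).1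
      have := h0 i
      rw [div_eq_inv_mul, pow_one]
      gcongr
  · obtain ⟨c₂, t₂, hc₂, ht₂, h₂⟩ := hS.exists_term_le (D := D) hD hC 1 1 (-1 - (θ + ε))
    obtain ⟨A, t₁, hA, ht₁, h₁⟩ := hS.biasShape h0 θ D ε hε
    have hp1 := (h₁ t₁ t₁ le_rfl le_rfl).1
    refine ⟨c₂ * (A * LinearCredible.biasShape S θ D t₁)⁻¹, max t₁ t₂, by positivity,
      ht₁.trans (le_max_left _ _), fun ρ hρ x hx => ?_⟩
    have hρ1 : t₁ ≤ ρ := (le_max_left _ _).trans hρ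
    have hρ0 : 0 < ρ := by linarith
    refine ⟨hsumm x fun i => (hx i).1, ?_⟩
    rw [min_eq_right h]
    obtain ⟨i, hi⟩ := h₂ ρ ((le_max_right _ _).trans hρ) x hx
    have h3 := (h₁ t₁ ρ le_rfl hρ1).2.1
    have h4 : (ρ / t₁) ^ ε ≤ ρ ^ ε :=
      Real.rpow_le_rpow (by positivity) (div_le_self hρ0.le ht₁) hε.le
    simp only [pow_one] at hi
    refine le_trans ?_ (hi.trans ((hsumm x fun i => (hx i).1).le_tsum i fun i _ => by
        have := (hx i).1
        have := h0 i
        positivity))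
    have h5 : LinearCredible.biasShape S θ D ρ ≤ A * ρ ^ ε * LinearCredible.biasShape S θ D t₁ :=
      h3.trans (by gcongr)
    calc c₂ * (A * LinearCredible.biasShape S θ D t₁)⁻¹
          * (ρ ^ (-ε) * (ρ ^ (-D) * LinearCredible.biasShape S θ D ρ))
        ≤ c₂ * (A * LinearCredible.biasShape S θ D t₁)⁻¹
          * (ρ ^ (-ε) * (ρ ^ (-D) * (A * ρ ^ ε * LinearCredible.biasShape S θ D t₁))) := by
          gcongr
      _ = c₂ * ρ ^ (-D) := by
          rw [Real.rpow_neg hρ0.le ε]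
          field_simp

/-! ### Automatic continuity of measurable linear functionals -/

/-- A Borel measurable linear functional on a Banach space is continuous. Otherwise there are
vectors `x k` of norm `2⁻ᵏ` with `|f (x k)| > k`. The random series `∑ ± x k` has a value under `f`
that changes by more than `2 k` if the `k`-th sign is flipped; as flips preserve the distribution of
the signs, the value belongs to `[-k, k]` with probability at most `1/2`, for every `k`. -/
theorem continuous_of_measurable_linear {E : Type*} [NormedAddCommGroup E] [NormedSpace ℝ E]
    [CompleteSpace E] [MeasurableSpace E] [BorelSpace E] (f : E →ₗ[ℝ] ℝ) (hf : Measurable f) :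
    Continuous f := by
  by_contra hcont
  have hunb : ∀ C : ℝ, ∃ y, C * ‖y‖ < ‖f y‖ := by
    intro C
    by_contra! h
    exact hcont (f.mkContinuous C h).continuous
  have hx : ∀ k : ℕ, ∃ x : E, ‖x‖ = (1 / 2) ^ k ∧ (k : ℝ) < |f x| := by
    intro k
    obtain ⟨y, hy⟩ := hunb (k * 2 ^ k)
    have hy0 : y ≠ 0 := by rintro rfl; simp at hy
    have hn : 0 < ‖y‖ := norm_pos_iff.2 hy0
    have hpos : (0 : ℝ) < (2 ^ k * ‖y‖)⁻¹ := by positivity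
    refine ⟨(2 ^ k * ‖y‖)⁻¹ • y, ?_, ?_⟩
    · rw [norm_smul, Real.norm_of_nonneg hpos.le, one_div, inv_pow]; field_simp
    · rw [map_smul, smul_eq_mul, abs_mul, abs_of_pos hpos, inv_mul_eq_div,
        lt_div_iff₀ (by positivity)]
      rw [Real.norm_eq_abs] at hy
      linarith
  choose x hxn hxf using hx
  let sg : Bool → ℝ := fun b => if b then 1 else -1
  have hsg : ∀ b, |sg b| = 1 := fun b => by cases b <;> simp [sg]
  let g : (ℕ → Bool) → E := fun ω => ∑' k, sg (ω k) • x k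
  have hbound : ∀ k (ω : ℕ → Bool), ‖sg (ω k) • x k‖ ≤ (1 / 2 : ℝ) ^ k := fun k ω => by
    rw [norm_smul, Real.norm_eq_abs, hsg, one_mul, hxn]
  have hsum : ∀ ω : ℕ → Bool, Summable fun k => sg (ω k) • x k := fun ω =>
    Summable.of_norm_bounded summable_geometric_two fun k => hbound k ω
  have hg : Continuous g := by
    refine continuous_tsum (fun k => ?_) summable_geometric_two hbound
    have : Continuous sg := continuous_of_discreteTopology
    fun_prop
  let coin : Measure Bool := (PMF.uniformOfFintype Bool).toMeasure
  have hcoin : coin.map not = coin := by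
    ext s hs
    have hm : MeasurableSet (not ⁻¹' s) := (Set.toFinite _).measurableSet
    have : Fintype s := Fintype.ofFinite s
    have : Fintype (not ⁻¹' s : Set Bool) := Fintype.ofFinite _
    rw [Measure.map_apply (measurable_of_finite _) hs]
    simp only [coin]
    rw [PMF.toMeasure_uniformOfFintype_apply _ hm, PMF.toMeasure_uniformOfFintype_apply _ hs]
    congr 2
    refine Fintype.card_congr (Equiv.subtypeEquiv ⟨not, not, fun b => by simp, fun b => by simp⟩ ?_)
    intro a
    rfl
  let P : Measure (ℕ → Bool) := Measure.infinitePi fun _ => coin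
  let flip : ℕ → (ℕ → Bool) → (ℕ → Bool) := fun k ω i => (if i = k then not else id) (ω i)
  have hflipm : ∀ k, Measurable (flip k) := fun k => by
    refine measurable_pi_lambda _ fun i => ?_
    exact (measurable_of_finite _).comp (measurable_pi_apply i)
  have hflip : ∀ k, P.map (flip k) = P := by
    intro k
    have := Measure.infinitePi_map_pi (μ := fun _ : ℕ => coin)
      (f := fun i => if i = k then not else id) (fun i => measurable_of_finite _)
    refine this.trans ?_
    congr 1
    funext i
    by_cases hi : i = k
    · simp only [hi, if_true]; exact hcoin
    · simp only [hi, if_false]; exact Measure.map_id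
  have hgflip : ∀ k ω, f (g (flip k ω)) = f (g ω) - 2 * sg (ω k) * f (x k) := by
    intro k ω
    have h1 : HasSum (fun i => sg (ω i) • x i - (if i = k then (2 * sg (ω k)) • x k else 0))
        (g ω - (2 * sg (ω k)) • x k) :=
      (hsum ω).hasSum.sub (hasSum_ite_eq k _)
    have h2 : g (flip k ω) = g ω - (2 * sg (ω k)) • x k := by
      rw [← h1.tsum_eq]
      refine tsum_congr fun i => ?_
      by_cases hi : i = k
      · subst hi
        simp only [flip, if_true, sg]
        cases ω i <;> simp <;> module
      · simp [flip, hi]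
    rw [h2, map_sub, map_smul, smul_eq_mul]
  let A : ℕ → Set (ℕ → Bool) := fun k => {ω | |f (g ω)| ≤ k}
  have hAm : ∀ k, MeasurableSet (A k) := fun k => by
    have : Measurable fun ω => f (g ω) := hf.comp hg.measurable
    exact measurableSet_le this.abs measurable_const
  have hA : ∀ k, P (A k) ≤ 1 / 2 := by
    intro k
    have hdisj : Disjoint (A k) (flip k ⁻¹' A k) := by
      rw [Set.disjoint_left]
      intro ω h1 h2
      simp only [A, Set.mem_ofPred_eq, Set.mem_preimage, hgflip] at h1 h2
      have h3 : |2 * sg (ω k) * f (x k)| ≤ 2 * k := by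
        have := abs_sub (f (g ω)) (f (g ω) - 2 * sg (ω k) * f (x k))
        rw [sub_sub_cancel] at this
        linarith
      rw [abs_mul, abs_mul, hsg] at h3
      have := hxf k
      rw [abs_of_pos (by norm_num : (0 : ℝ) < 2)] at h3
      linarith
    have h1 : P (flip k ⁻¹' A k) = P (A k) := by
      rw [← Measure.map_apply (hflipm k) (hAm k), hflip k]
    have h2 : P (A k ∪ flip k ⁻¹' A k) ≤ 1 := prob_le_one
    rw [measure_union hdisj (hflipm k (hAm k)), h1, ← two_mul] at h2
    rw [ENNReal.le_div_iff_mul_le (by simp) (by simp), mul_comm]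
    exact h2
  have hmono : Monotone A := fun a b hab ω h => by
    simp only [A, Set.mem_ofPred_eq] at h ⊢
    exact h.trans (by exact_mod_cast hab)
  have huniv : ⋃ k, A k = Set.univ := by
    refine Set.eq_univ_of_forall fun ω => ?_
    obtain ⟨k, hk⟩ := exists_nat_ge |f (g ω)|
    exact Set.mem_iUnion.2 ⟨k, hk⟩
  have hlim := tendsto_measure_iUnion_atTop (μ := P) hmono
  rw [huniv, measure_univ] at hlim
  have := le_of_tendsto' hlim hA
  have h2 : (1 / 2 : ENNReal) < 1 := by
    rw [one_div]; exact ENNReal.one_half_lt_one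
  exact absurd this (not_le.2 h2)

/-! ### Coordinates in the eigenbasis -/

section Coordinates

variable {E : Type*} [NormedAddCommGroup E] [InnerProductSpace ℝ E]
  (e : HilbertBasis ℕ ℝ E)

theorem hasSum_inner_basis (x y : E) :
    HasSum (fun i => inner ℝ (e i) x * inner ℝ (e i) y) (inner ℝ x y) := by
  have := e.hasSum_inner_mul_inner x y
  simpa only [real_inner_comm x] using this

theorem hasSum_sq_inner_basis (x : E) :
    HasSum (fun i => (inner ℝ (e i) x) ^ 2) (‖x‖ ^ 2) := by
  simpa only [sq, real_inner_self_eq_norm_mul_norm] using hasSum_inner_basis e x x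

theorem ext_inner_basis {x y : E} (h : ∀ i, inner ℝ (e i) x = inner ℝ (e i) y) : x = y := by
  apply e.repr.injective
  ext i
  rw [e.repr_apply_apply, e.repr_apply_apply, h]

theorem inner_basis_self (i k : ℕ) : inner ℝ (e i) (e k) = if i = k then (1 : ℝ) else 0 :=
  orthonormal_iff_ite.1 e.orthonormal i k

theorem exists_inner_basis_eq {c : ℕ → ℝ} (hc : Summable fun i => c i ^ 2) :
    ∃ x : E, ∀ i, inner ℝ (e i) x = c i := by
  have hmem : Memℓp c 2 := by
    refine memℓp_gen ?_
    simpa using hc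
  refine ⟨e.repr.symm ⟨c, hmem⟩, fun i => ?_⟩
  rw [← e.repr_apply_apply, LinearIsometryEquiv.apply_symm_apply]

theorem inner_tsum_smul_basis [CompleteSpace E] {c : ℕ → ℝ} (hc : Summable fun i => c i ^ 2)
    (i : ℕ) :
    inner ℝ (e i) (∑' k, c k • e k) = c i := by
  obtain ⟨x, hx⟩ := exists_inner_basis_eq e hc
  have h := e.hasSum_repr x
  simp only [e.repr_apply_apply, hx] at h
  rw [h.tsum_eq, hx]

/-- Bounded sequences are the eigenvalues of bounded diagonal operators. -/
theorem exists_diagonal {d : ℕ → ℝ} {B : ℝ} (hd : ∀ i, |d i| ≤ B) :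
    ∃ T : E →L[ℝ] E, ∀ x i, inner ℝ (e i) (T x) = d i * inner ℝ (e i) x := by
  have hB : 0 ≤ B := (abs_nonneg _).trans (hd 0)
  have hle : ∀ x i, (d i * inner ℝ (e i) x) ^ 2 ≤ B ^ 2 * (inner ℝ (e i) x) ^ 2 := fun x i => by
    rw [mul_pow]
    exact mul_le_mul_of_nonneg_right (sq_le_sq.2 ((hd i).trans (le_abs_self B))) (sq_nonneg _)
  have hs : ∀ x, Summable fun i => (d i * inner ℝ (e i) x) ^ 2 := fun x =>
    Summable.of_nonneg_of_le (fun i => sq_nonneg _) (hle x)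
      ((hasSum_sq_inner_basis e x).summable.mul_left _)
  choose T hT using fun x => exists_inner_basis_eq e (hs x)
  let T' : E →ₗ[ℝ] E :=
    { toFun := T
      map_add' := fun x y => ext_inner_basis e fun i => by
        rw [inner_add_right, hT, hT, hT, inner_add_right]; ring
      map_smul' := fun a x => ext_inner_basis e fun i => by
        simp only [RingHom.id_apply]
        rw [inner_smul_right, hT, hT, inner_smul_right]; ring }
  refine ⟨T'.mkContinuous B fun x => ?_, fun x i => hT x i⟩
  have h1 := hasSum_sq_inner_basis e (T x)
  simp only [hT] at h1
  have h2 := hasSum_le (hle x) h1 ((hasSum_sq_inner_basis e x).mul_left _)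
  rw [← mul_pow] at h2
  exact (sq_le_sq₀ (norm_nonneg _) (by positivity)).1 h2

theorem memSobolev_basis (β : ℝ) (k : ℕ) : MemSobolev e β (e k) := by
  refine summable_of_ne_finset_zero (s := {k}) fun i hi => ?_
  rw [inner_basis_self, if_neg (by simpa using hi)]
  simp

/-- On the Sobolev space, a measurable linear functional is the sum of its values at the basis
vectors. -/
theorem IsMeasurableLinear.hasSum_inner_mul [CompleteSpace E] [MeasurableSpace E] [BorelSpace E]
    {Λ : E →L[ℝ] E} {L : E → ℝ} {V : Submodule ℝ E} (hL : IsMeasurableLinear Λ L V) {β : ℝ}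
    (hβ : 0 < β) (hV : ∀ μ, MemSobolev e β μ → μ ∈ V) {μ : E} (hμ : MemSobolev e β μ) :
    HasSum (fun i => inner ℝ (e i) μ * L (e i)) (L μ) := by
  have hj : ∀ i : ℕ, (0 : ℝ) < (i : ℝ) + 1 := fun i => by positivity
  -- the diagonal operator `T` maps `E` onto the Sobolev space, and `L ∘ T` is continuous
  obtain ⟨T, hT⟩ := exists_diagonal e (d := fun i => ((i : ℝ) + 1) ^ (-β)) (B := 1) fun i => by
    rw [abs_of_nonneg (by positivity)]
    exact Real.rpow_le_one_of_one_le_of_nonpos (by linarith [(i.cast_nonneg : (0 : ℝ) ≤ i)])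
      (by linarith)
  have hpow : ∀ i : ℕ, (((i : ℝ) + 1) ^ β) ^ 2 = ((i : ℝ) + 1) ^ (2 * β) := fun i => by
    rw [← Real.rpow_natCast, ← Real.rpow_mul (hj i).le]; congr 1; push_cast; ring
  have hTS : ∀ x, T x ∈ V := fun x => hV _ <| by
    refine (hasSum_sq_inner_basis e x).summable.congr fun i => ?_
    rw [hT, ← hpow, Real.rpow_neg (hj i).le]
    have := hj i
    field_simp
  let f : E →ₗ[ℝ] ℝ :=
    { toFun := fun x => L (T x)
      map_add' := fun x y => by rw [T.map_add, hL.map_add _ (hTS x) _ (hTS y)]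
      map_smul' := fun a x => by
        rw [T.map_smul, hL.map_smul _ _ (hTS x), RingHom.id_apply, smul_eq_mul] }
  have hf : Continuous f :=
    continuous_of_measurable_linear f (hL.measurable.comp T.continuous.measurable)
  obtain ⟨y, hy⟩ := exists_inner_basis_eq e (c := fun i => inner ℝ (e i) μ * ((i : ℝ) + 1) ^ β)
    (by simpa only [mul_pow, hpow, MemSobolev] using hμ)
  have hTy : T y = μ := ext_inner_basis e fun i => by
    rw [hT, hy, Real.rpow_neg (hj i).le]
    have := hj i
    field_simp
  have hTe : ∀ k, T (e k) = ((k : ℝ) + 1) ^ (-β) • e k := fun k => ext_inner_basis e fun i => by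
    rw [hT, inner_smul_right, inner_basis_self]
    by_cases h : i = k
    · simp [h]
    · simp [h]
  have h := (e.hasSum_repr y).map f hf
  have e1 : f y = L μ := by
    change L (T y) = L μ
    rw [hTy]
  rw [e1] at h
  convert h using 2 with i
  simp only [Function.comp_apply, e.repr_apply_apply, hy]
  rw [f.map_smul, smul_eq_mul]
  change _ = _ * L (T (e i))
  rw [hTe, hL.map_smul _ _ (hV _ (memSobolev_basis e β i)), Real.rpow_neg (hj i).le]
  have := hj i
  field_simp

/-- The positive square root of a diagonal operator is diagonal. -/
theorem sqrt_apply_eigenvector [CompleteSpace E] {Λ R : E →L[ℝ] E} (hR : R.IsPositive)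
    (hRR : R ∘L R = Λ) {x : E} {l : ℝ} (hl : 0 < l) (hx : Λ x = l • x) : R x = √l • x := by
  -- `R v = - √l • v`, so that `v = 0` by positivity of `R`
  set v := R x - √l • x with hv
  have h1 : R v + √l • v = 0 := by
    rw [hv, map_sub, map_smul]
    have : R (R x) = l • x := by rw [← hx, ← hRR]; rfl
    rw [this, smul_sub, smul_smul, Real.mul_self_sqrt hl.le]
    abel
  have h2 := hR.re_inner_nonneg_right v
  have h3 : inner ℝ v (R v) + √l * ‖v‖ ^ 2 = 0 := by
    have := congrArg (inner ℝ v) h1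
    rwa [inner_add_right, inner_smul_right, inner_zero_right, real_inner_self_eq_norm_sq] at this
  simp only [RCLike.re_to_real] at h2
  have h4 : 0 < √l := Real.sqrt_pos.2 hl
  have h5 : ‖v‖ ^ 2 = 0 := by nlinarith [sq_nonneg ‖v‖]
  exact sub_eq_zero.1 (norm_eq_zero.1 (pow_eq_zero_iff (two_ne_zero)|>.1 h5))

end Coordinates

/-! ### The standard normal distribution function -/

/-- The standard normal distribution function. -/
noncomputable def normalCDF (x : ℝ) : ℝ := (gaussianReal 0 1).real (Set.Iic x)

theorem normalCDF_sub {a b : ℝ} (h : a ≤ b) :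
    normalCDF b - normalCDF a = (gaussianReal 0 1).real (Set.Icc a b) := by
  have : NullSingletonClass (gaussianReal 0 1) := nullSingletonClass_gaussianReal one_ne_zero
  have h1 : (gaussianReal 0 1).real (Set.Icc a b) = (gaussianReal 0 1).real (Set.Ioc a b) :=
    (measureReal_congr Ioc_ae_eq_Icc).symm
  have h2 : Set.Iic b = Set.Iic a ∪ Set.Ioc a b := (Set.Iic_union_Ioc_eq_Iic h).symm
  rw [h1, normalCDF, normalCDF, h2, measureReal_union (Set.Iic_disjoint_Ioc le_rfl)
    measurableSet_Ioc]
  ring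

theorem normalCDF_sub_eq_integral {a b : ℝ} (h : a ≤ b) :
    normalCDF b - normalCDF a = ∫ x in Set.Icc a b, gaussianPDFReal 0 1 x := by
  rw [normalCDF_sub h, measureReal_def, gaussianReal_apply_eq_integral _ one_ne_zero,
    ENNReal.toReal_ofReal]
  exact integral_nonneg fun x => gaussianPDFReal_nonneg _ _ _

theorem normalCDF_strictMono : StrictMono normalCDF := by
  intro a b hab
  have h := normalCDF_sub_eq_integral hab.le
  have hpos : 0 < ∫ x in Set.Icc a b, gaussianPDFReal 0 1 x := by
    rw [setIntegral_pos_iff_support_of_nonneg_ae]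
    · have : Function.support (gaussianPDFReal 0 1) = Set.univ := by
        ext x; simpa using (gaussianPDFReal_pos 0 1 x one_ne_zero).ne'
      rw [this, Set.univ_inter]
      simpa using hab
    · exact Eventually.of_forall fun x => gaussianPDFReal_nonneg _ _ _
    · exact (integrable_gaussianPDFReal 0 1).integrableOn
  linarith

theorem continuous_normalCDF : Continuous normalCDF := by
  have hle : ∀ x, gaussianPDFReal 0 1 x ≤ 1 := by
    intro x
    rw [gaussianPDFReal]
    have h1 : (√(2 * Real.pi * (1 : NNReal)))⁻¹ ≤ 1 := by
      refine inv_le_one_of_one_le₀ ?_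
      rw [Real.one_le_sqrt]
      have := Real.two_le_pi
      simp only [NNReal.coe_one, mul_one]
      linarith
    have h2 : Real.exp (-(x - 0) ^ 2 / (2 * (1 : NNReal))) ≤ 1 := by
      rw [Real.exp_le_one_iff, neg_div]
      exact neg_nonpos.2 (by positivity)
    exact mul_le_one₀ h1 (Real.exp_pos _).le h2
  have hlip : ∀ a b, a ≤ b → normalCDF b - normalCDF a ≤ b - a := by
    intro a b hab
    rw [normalCDF_sub_eq_integral hab]
    calc ∫ x in Set.Icc a b, gaussianPDFReal 0 1 x ≤ ∫ x in Set.Icc a b, (1 : ℝ) :=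
          integral_mono (integrable_gaussianPDFReal 0 1).integrableOn (integrable_const _) hle
      _ = b - a := by simp [hab]
  have : LipschitzWith 1 normalCDF := LipschitzWith.of_le_add fun x y => by
    rw [Real.dist_eq]
    rcases le_total y x with h | h
    · have := hlip y x h
      have := le_abs_self (x - y)
      linarith
    · have := normalCDF_strictMono.monotone h
      have := abs_nonneg (x - y)
      linarith
  exact this.continuous

theorem normalCDF_neg (x : ℝ) : normalCDF (-x) = 1 - normalCDF x := by
  have : NullSingletonClass (gaussianReal 0 1) := nullSingletonClass_gaussianReal one_ne_zero
  have h1 : (gaussianReal 0 1).map (fun x => -x) = gaussianReal 0 1 := by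
    rw [gaussianReal_map_neg, neg_zero]
  have h2 : normalCDF (-x) = (gaussianReal 0 1).real (Set.Ici x) := by
    rw [normalCDF]
    conv_lhs => rw [← h1]
    rw [map_measureReal_apply measurable_neg measurableSet_Iic]
    congr 1
    ext y
    simp
  have h3 : (gaussianReal 0 1).real (Set.Ici x) = (gaussianReal 0 1).real (Set.Iic x)ᶜ := by
    rw [Set.compl_Iic]; exact (measureReal_congr Ioi_ae_eq_Ici).symm
  rw [h2, h3, probReal_compl_eq_one_sub measurableSet_Iic, normalCDF]

theorem normalCDF_eq_cdf : normalCDF = cdf (gaussianReal 0 1) :=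
  funext fun x => (cdf_eq_real _ x).symm

theorem tendsto_normalCDF_atBot : Tendsto normalCDF atBot (𝓝 0) := by
  rw [normalCDF_eq_cdf]; exact tendsto_cdf_atBot _

theorem normalCDF_lt_one (x : ℝ) : normalCDF x < 1 :=
  (normalCDF_strictMono (lt_add_one x)).trans_le measureReal_le_one

theorem normalCDF_pos (x : ℝ) : 0 < normalCDF x :=
  measureReal_nonneg.trans_lt (normalCDF_strictMono (sub_one_lt x))

/-- The set that defines the quantile is a half line, as the distribution function is continuous and
strictly increasing. -/
theorem normalQuantile_spec {a : ℝ} (h0 : 0 < a) (h1 : a < 1) :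
    normalCDF (normalQuantile a) = a := by
  have hlow : ∃ x, normalCDF x ≤ a :=
    ((tendsto_normalCDF_atBot.eventually (gt_mem_nhds h0)).exists).imp fun _ h => h.le
  have hup : ∃ x, a ≤ normalCDF x := by
    have : Tendsto normalCDF atTop (𝓝 1) := by
      rw [normalCDF_eq_cdf]; exact tendsto_cdf_atTop _
    exact ((this.eventually (lt_mem_nhds h1)).exists).imp fun _ h => h.le
  obtain ⟨x, hx⟩ := mem_range_of_exists_le_of_exists_ge continuous_normalCDF hlow hup
  have : {y : ℝ | a ≤ cdf (gaussianReal 0 1) y} = Set.Ici x := by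
    ext y
    rw [← normalCDF_eq_cdf]
    simp only [Set.mem_ofPred_eq, Set.mem_Ici]
    rw [← hx, normalCDF_strictMono.le_iff_le]
  rw [normalQuantile, this, csInf_Ici, hx]

theorem normalQuantile_neg {γ : ℝ} (h0 : 0 < γ) (h1 : γ < 1) : normalQuantile (γ / 2) < 0 := by
  rw [← normalCDF_strictMono.lt_iff_lt, normalQuantile_spec (by linarith) (by linarith)]
  have := normalCDF_neg 0
  rw [neg_zero] at this
  linarith

/-- The coverage of an interval, when its half width is `v` times, and the bias is `u` times,
the standard deviation of its centre. -/
noncomputable def shiftedCoverage (u v : ℝ) : ℝ := normalCDF (v - u) - normalCDF (-v - u)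

theorem shiftedCoverage_quantile {γ : ℝ} (h0 : 0 < γ) (h1 : γ < 1) :
    shiftedCoverage 0 (-normalQuantile (γ / 2)) = 1 - γ := by
  rw [shiftedCoverage, sub_zero, sub_zero, neg_neg, normalCDF_neg,
    normalQuantile_spec (by linarith) (by linarith)]
  ring

/-- If the half width exceeds the normal quantile by a factor `r > 1`, then a sufficiently small
bias does not destroy the excess coverage. -/
theorem exists_shiftedCoverage_mem {γ : ℝ} (h0 : 0 < γ) (h1 : γ < 1) {r V : ℝ} (hr : 1 < r) :
    ∃ δ a b : ℝ, 0 < δ ∧ 1 - γ < a ∧ b < 1 ∧ ∀ u v, |u| ≤ δ → r * -normalQuantile (γ / 2) ≤ v →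
      v ≤ V → a ≤ shiftedCoverage u v ∧ shiftedCoverage u v ≤ b := by
  set z := -normalQuantile (γ / 2) with hz
  have hz0 : 0 < z := by have := normalQuantile_neg h0 h1; linarith
  have hrz : 0 < (r - 1) * z := mul_pos (by linarith) hz0
  refine ⟨(r - 1) * z / 2, shiftedCoverage 0 (z + (r - 1) * z / 2),
    normalCDF (V + (r - 1) * z / 2), by positivity, ?_, normalCDF_lt_one _, ?_⟩
  · rw [← shiftedCoverage_quantile h0 h1, ← hz]
    simp only [shiftedCoverage, sub_zero]
    have a1 := normalCDF_strictMono (show z < z + (r - 1) * z / 2 by linarith)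
    have a2 := normalCDF_strictMono (show -(z + (r - 1) * z / 2) < -z by linarith)
    linarith
  · intro u v hu hv hV
    obtain ⟨u1, u2⟩ := abs_le.1 hu
    simp only [shiftedCoverage, sub_zero]
    have a1 := normalCDF_strictMono.monotone (show z + (r - 1) * z / 2 ≤ v - u by linarith)
    have a2 := normalCDF_strictMono.monotone (show -v - u ≤ -(z + (r - 1) * z / 2) by linarith)
    have a3 := normalCDF_strictMono.monotone (show v - u ≤ V + (r - 1) * z / 2 by linarith)
    have a4 := normalCDF_pos (-v - u)
    constructor <;> linarith

/-- The coverage is bounded away from zero, if bias divided by standard deviation is bounded. -/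
theorem exists_le_shiftedCoverage {z : ℝ} (hz : 0 < z) (U : ℝ) :
    ∃ a : ℝ, 0 < a ∧ ∀ u v, |u| ≤ U → z ≤ v → a ≤ shiftedCoverage u v := by
  rcases lt_or_ge U 0 with hU | hU
  · exact ⟨1, one_pos, fun u v hu => absurd ((abs_nonneg u).trans hu) (not_le.2 hU)⟩
  have hc : Continuous fun u => shiftedCoverage u z := by
    unfold shiftedCoverage
    have := continuous_normalCDF
    fun_prop
  obtain ⟨u₀, -, hu₀⟩ := (isCompact_Icc (a := -U) (b := U)).exists_isMinOn
    ⟨0, by constructor <;> linarith⟩ hc.continuousOn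
  refine ⟨shiftedCoverage u₀ z, sub_pos.2 (normalCDF_strictMono (by linarith)),
    fun u v hu hv => ?_⟩
  refine (hu₀ (abs_le.1 hu)).trans ?_
  simp only [shiftedCoverage]
  have a1 := normalCDF_strictMono.monotone (show z - u ≤ v - u by linarith)
  have a2 := normalCDF_strictMono.monotone (show -v - u ≤ -z - u by linarith)
  linarith

theorem shiftedCoverage_le {u v V W : ℝ} (hv : v ≤ V) (hu : W ≤ |u|) :
    shiftedCoverage u v ≤ normalCDF (V - W) := by
  rw [shiftedCoverage]
  rcases le_abs.1 hu with h | h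
  · have a1 := normalCDF_strictMono.monotone (show v - u ≤ V - W by linarith)
    have a4 := normalCDF_pos (-v - u)
    linarith
  · have a1 := normalCDF_strictMono.monotone (show -(V - W) ≤ -v - u by linarith)
    rw [normalCDF_neg] at a1
    have a4 := normalCDF_lt_one (v - u)
    linarith

/-! ### The coverage in spectral coordinates -/

theorem IsIsoGaussian.map_div_norm {F Ω : Type*} [NormedAddCommGroup F] [InnerProductSpace ℝ F]
    [MeasurableSpace Ω] {P : Measure Ω} {Z : F → Ω → ℝ} (hZ : IsIsoGaussian Z P)
    {h : F} (hh : h ≠ 0) : P.map (fun ω => Z h ω / ‖h‖) = gaussianReal 0 1 := by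
  have hm := hZ.gaussian.aemeasurable h
  have h1 := (hZ.gaussian.hasGaussianLaw_eval h).map_eq_gaussianReal
  have hv : Var[Z h; P] = ‖h‖ ^ 2 := by
    rw [← covariance_self hm, hZ.cov, real_inner_self_eq_norm_sq]
  rw [hZ.mean, hv] at h1
  have h2 : P.map (fun ω => Z h ω / ‖h‖) = (P.map (Z h)).map (fun x => x / ‖h‖) :=
    (AEMeasurable.map_map_of_aemeasurable (g := fun x => x / ‖h‖)
      (measurable_id.div_const _).aemeasurable hm).symm
  rw [h2, h1, gaussianReal_map_div_const, zero_div]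
  congr 1
  have : ‖h‖ ≠ 0 := norm_ne_zero_iff.2 hh
  ext
  simp [Real.coe_toNNReal _ (sq_nonneg ‖h‖), this]

section Spectral

variable {E F Ω : Type*}
  [NormedAddCommGroup E] [InnerProductSpace ℝ E] [CompleteSpace E]
  [NormedAddCommGroup F] [InnerProductSpace ℝ F] [CompleteSpace F]
  [MeasurableSpace Ω]

/-- Standardization by `t`, the standard deviation of the posterior mean of `L μ`. -/
theorem coverage_eq_shiftedCoverage {P : Measure Ω} {Z : F → Ω → ℝ} (hZ : IsIsoGaussian Z P)
    (e : HilbertBasis ℕ ℝ E) (K : E →L[ℝ] F) (Λ R : E →L[ℝ] E) (L : E → ℝ) {γ : ℝ}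
    (h0 : 0 < γ) (h1 : γ < 1) {n : ℕ} (hn : 0 < n) (τ : ℝ) (μ : E) {t : ℝ} (ht : 0 < t)
    (htn : t ^ 2 = ‖LAvec e K (τ • R) L n‖ ^ 2 / n) :
    coverage P Z e K Λ R L γ n τ μ
      = shiftedCoverage ((inner ℝ (K μ) (LAvec e K (τ • R) L n) - L μ) / t)
        (-normalQuantile (γ / 2) * (postSd e K (τ ^ 2 • Λ) (τ • R) L n / t)) := by
  set h := LAvec e K (τ • R) L n with hh
  set s := postSd e K (τ ^ 2 • Λ) (τ • R) L n with hs
  set z := normalQuantile (γ / 2) with hz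
  have hz0 : z < 0 := normalQuantile_neg h0 h1
  have hs0 : 0 ≤ s := Real.sqrt_nonneg _
  have hn' : (0 : ℝ) < n := by exact_mod_cast hn
  have hsn : 0 < √(n : ℝ) := Real.sqrt_pos.2 hn'
  have hteq : t = ‖h‖ / √(n : ℝ) := by
    refine (pow_left_inj₀ ht.le (by positivity) two_ne_zero).1 ?_
    rw [htn, div_pow, Real.sq_sqrt hn'.le]
  have hnorm : 0 < ‖h‖ := by
    rcases (norm_nonneg h).eq_or_lt with h2 | h2
    · rw [← h2, zero_div] at hteq; exact absurd hteq ht.ne'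
    · exact h2
  have hhne : h ≠ 0 := norm_pos_iff.1 hnorm
  set b := inner ℝ (K μ) h - L μ with hb
  have hset : {ω | obs Z K n μ h ω + z * s ≤ L μ ∧ L μ ≤ obs Z K n μ h ω - z * s}
      = (fun ω => Z h ω / ‖h‖) ⁻¹' Set.Icc (-(-z * (s / t)) - b / t) (-z * (s / t) - b / t) := by
    ext ω
    have hZt : (√(n : ℝ))⁻¹ * Z h ω = t * (Z h ω / ‖h‖) := by
      rw [hteq]; field_simp
    simp only [Set.mem_ofPred_eq, Set.mem_preimage, Set.mem_Icc, obs, hZt]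
    set y := Z h ω / ‖h‖
    have e1 : -(-z * (s / t)) - b / t = (z * s - b) / t := by ring
    have e2 : -z * (s / t) - b / t = (-(z * s) - b) / t := by ring
    rw [e1, e2, div_le_iff₀ ht, le_div_iff₀ ht, hb]
    constructor
    · rintro ⟨a1, a2⟩; constructor <;> linarith
    · rintro ⟨a1, a2⟩; constructor <;> linarith
  have hm : AEMeasurable (fun ω => Z h ω / ‖h‖) P := (hZ.gaussian.aemeasurable h).div_const _
  have hv : 0 ≤ -z * (s / t) := mul_nonneg (by linarith) (by positivity)
  rw [coverage, ← hh, ← hs, ← hz, hset, shiftedCoverage, normalCDF_sub (by linarith),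
    ← hZ.map_div_norm hhne, measureReal_def, measureReal_def,
    Measure.map_apply_of_aemeasurable hm measurableSet_Icc]

/-- The mean and variance of the posterior mean, and the posterior variance, in the coordinates of
a basis that diagonalizes both `KᵀK` and `R`. -/
theorem posterior_spectral (e : HilbertBasis ℕ ℝ E) (K : E →L[ℝ] F) {R : E →L[ℝ] E} {L : E → ℝ}
    {κ r : ℕ → ℝ} (hK : ∀ i, K.adjoint (K (e i)) = κ i ^ 2 • e i) (hR : IsSelfAdjoint R)
    (hRe : ∀ i, R (e i) = r i • e i) {n : ℕ} (hn : 0 < n)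
    (hw : Summable fun i => L (R (e i)) ^ 2) :
    (∀ μ, HasSum (fun i => κ i ^ 2 * r i * L (R (e i)) / ((n : ℝ)⁻¹ + r i ^ 2 * κ i ^ 2)
        * inner ℝ (e i) μ) (inner ℝ (K μ) (LAvec e K R L n))) ∧
    HasSum (fun i => κ i ^ 2 * r i ^ 2 * L (R (e i)) ^ 2
        / ((n : ℝ)⁻¹ + r i ^ 2 * κ i ^ 2) ^ 2) (‖LAvec e K R L n‖ ^ 2) ∧
    HasSum (fun i => L (R (e i)) ^ 2 * (n : ℝ)⁻¹ / ((n : ℝ)⁻¹ + r i ^ 2 * κ i ^ 2))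
      (‖functionalVec e L R‖ ^ 2 - inner ℝ (LAvec e K R L n)
        (((n : ℝ)⁻¹ • ContinuousLinearMap.id ℝ F + K ∘L (R ∘L R) ∘L K.adjoint)
          (LAvec e K R L n))) := by
  have hn' : (0 : ℝ) < (n : ℝ)⁻¹ := by positivity
  have hd : ∀ i, 0 < (n : ℝ)⁻¹ + r i ^ 2 * κ i ^ 2 := fun i => by positivity
  have hRadj : ContinuousLinearMap.adjoint R = R := hR.adjoint_eq
  have hRs : ∀ x y, inner ℝ (R x) y = inner ℝ x (R y) := fun x y => by
    rw [← ContinuousLinearMap.adjoint_inner_right, hRadj]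
  have hRin : ∀ x i, inner ℝ (e i) (R x) = r i * inner ℝ (e i) x := fun x i => by
    rw [← hRs, hRe, inner_smul_left]; simp
  have hKin : ∀ x i, inner ℝ (e i) (K.adjoint (K x)) = κ i ^ 2 * inner ℝ (e i) x := fun x i => by
    rw [ContinuousLinearMap.adjoint_inner_right, ← ContinuousLinearMap.adjoint_inner_left, hK,
      inner_smul_left]
    simp
  set w := functionalVec e L R with hwdef
  have hwc : ∀ i, inner ℝ (e i) w = L (R (e i)) := inner_tsum_smul_basis e hw
  set T : E →L[ℝ] E := (n : ℝ)⁻¹ • ContinuousLinearMap.id ℝ E + R ∘L K.adjoint ∘L K ∘L R with hT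
  have hTapp : ∀ x, T x = (n : ℝ)⁻¹ • x + R (K.adjoint (K (R x))) := fun x => rfl
  have hTsa : IsSelfAdjoint T := by
    rw [ContinuousLinearMap.isSelfAdjoint_iff_isSymmetric]
    intro x y
    change inner ℝ (T x) y = inner ℝ x (T y)
    rw [hTapp, hTapp, inner_add_left, inner_add_right, inner_smul_left, inner_smul_right, hRs,
      ContinuousLinearMap.adjoint_inner_left, ← hRs, ContinuousLinearMap.adjoint_inner_right]
    simp
  have hTe : ∀ i, T (e i) = ((n : ℝ)⁻¹ + r i ^ 2 * κ i ^ 2) • e i := fun i => by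
    rw [hTapp, hRe, map_smul, map_smul, hK, map_smul, map_smul, hRe, smul_smul, smul_smul,
      ← add_smul]
    congr 1; ring
  -- `T` is bounded below by `n⁻¹`, so that `Ring.inverse` is a true inverse
  have hTu : IsUnit T := by
    refine ContinuousLinearMap.isUnit_of_forall_le_norm_inner_map T (c := ⟨(n : ℝ)⁻¹, hn'.le⟩)
      hn' fun x => ?_
    have e1 : inner ℝ (T x) x = (n : ℝ)⁻¹ * ‖x‖ ^ 2 + ‖K (R x)‖ ^ 2 := by
      rw [hTapp, inner_add_left, inner_smul_left, hRs, ContinuousLinearMap.adjoint_inner_left,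
        real_inner_self_eq_norm_sq, real_inner_self_eq_norm_sq]
      simp
    rw [e1, Real.norm_of_nonneg (by positivity)]
    change ‖x‖ ^ 2 * (n : ℝ)⁻¹ ≤ _
    nlinarith [sq_nonneg ‖K (R x)‖]
  set u := Ring.inverse T w with hu
  have hTinv : T u = w := by
    have := Ring.mul_inverse_cancel T hTu
    exact congrArg (fun A : E →L[ℝ] E => A w) this
  have huc : ∀ i, inner ℝ (e i) u = L (R (e i)) / ((n : ℝ)⁻¹ + r i ^ 2 * κ i ^ 2) := fun i => by
    rw [eq_div_iff (hd i).ne', ← hwc, ← hTinv]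
    have : inner ℝ (e i) (T u) = inner ℝ (T (e i)) u := by
      rw [← ContinuousLinearMap.adjoint_inner_left, hTsa.adjoint_eq]
    rw [this, hTe, inner_smul_left]
    simp [mul_comm]
  set v := R u with hv
  have hvc : ∀ i, inner ℝ (e i) v
      = r i * L (R (e i)) / ((n : ℝ)⁻¹ + r i ^ 2 * κ i ^ 2) := fun i => by
    rw [hv, hRin, huc, mul_div_assoc]
  have hLA : LAvec e K R L n = K v := by
    have hinvadj : ContinuousLinearMap.adjoint (Ring.inverse T) = Ring.inverse T := by
      have := Ring.inverse_star T
      rw [hTsa.star_eq] at this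
      exact this.symm
    rw [LAvec, regOp, ← hT, ContinuousLinearMap.adjoint_comp, ContinuousLinearMap.adjoint_comp,
      hinvadj, hRadj, ContinuousLinearMap.adjoint_adjoint]
    rfl
  set g := K.adjoint (K v) with hg
  have hgc : ∀ i, inner ℝ (e i) g
      = κ i ^ 2 * (r i * L (R (e i)) / ((n : ℝ)⁻¹ + r i ^ 2 * κ i ^ 2)) := fun i => by
    rw [hg, hKin, hvc]
  have hnorm : HasSum (fun i => κ i ^ 2 * r i ^ 2 * L (R (e i)) ^ 2
        / ((n : ℝ)⁻¹ + r i ^ 2 * κ i ^ 2) ^ 2) (‖LAvec e K R L n‖ ^ 2) := by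
    have h := hasSum_inner_basis e v g
    have e1 : inner ℝ v g = ‖LAvec e K R L n‖ ^ 2 := by
      rw [hg, ContinuousLinearMap.adjoint_inner_right, real_inner_self_eq_norm_sq, hLA]
    rw [e1] at h
    convert h using 2 with i
    rw [hvc, hgc]
    have := (hd i).ne'
    field_simp
  refine ⟨fun μ => ?_, hnorm, ?_⟩
  · have h := hasSum_inner_basis e μ g
    have e1 : inner ℝ μ g = inner ℝ (K μ) (LAvec e K R L n) := by
      rw [hg, ContinuousLinearMap.adjoint_inner_right, hLA]
    rw [e1] at h
    convert h using 2 with i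
    rw [hgc]
    ring
  · have hRg : ∀ i, inner ℝ (e i) (R g) = r i * (κ i ^ 2 * (r i * L (R (e i))
        / ((n : ℝ)⁻¹ + r i ^ 2 * κ i ^ 2))) := fun i => by
      rw [hRin, hgc]
    have h1 : inner ℝ (LAvec e K R L n)
        (((n : ℝ)⁻¹ • ContinuousLinearMap.id ℝ F + K ∘L (R ∘L R) ∘L K.adjoint)
          (LAvec e K R L n)) = (n : ℝ)⁻¹ * ‖LAvec e K R L n‖ ^ 2 + ‖R g‖ ^ 2 := by
      have h2 : ((n : ℝ)⁻¹ • ContinuousLinearMap.id ℝ F + K ∘L (R ∘L R) ∘L K.adjoint)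
          (LAvec e K R L n)
            = (n : ℝ)⁻¹ • LAvec e K R L n + K (R (R (K.adjoint (LAvec e K R L n)))) := rfl
      rw [h2, inner_add_right, inner_smul_right, real_inner_self_eq_norm_sq,
        ← ContinuousLinearMap.adjoint_inner_left, hLA, ← hg, ← hRs, real_inner_self_eq_norm_sq]
    rw [h1]
    have h3 := ((hasSum_sq_inner_basis e w).sub
      ((hnorm.mul_left (n : ℝ)⁻¹).add (hasSum_sq_inner_basis e (R g))))
    refine (congrArg (HasSum · _) (funext fun i => ?_)).mpr h3
    rw [hwc, hRg]
    have := (hd i).ne'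
    field_simp
    ring

end Spectral

/-! ### The two terms of the contraction rate -/

section Terms

variable {S : ℝ → ℝ} {α β p q : ℝ}

theorem rho_pos {n : ℕ} {τ : ℝ} (hn : 0 < n) (hτ : 0 < τ) : 0 < rho α p n τ := by
  have : (0 : ℝ) < n := by exact_mod_cast hn
  exact Real.rpow_pos_of_pos (by positivity) _

theorem rho_rpow {n : ℕ} {τ : ℝ} (hn : 0 < n) (hτ : 0 < τ) (a : ℝ) :
    rho α p n τ ^ a = ((n : ℝ) * τ ^ 2) ^ (a / (1 + 2 * α + 2 * p)) := by
  have : (0 : ℝ) < n := by exact_mod_cast hn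
  rw [rho, ← Real.rpow_mul (by positivity)]
  congr 1
  ring

theorem rho_div_rho {n : ℕ} {τ τ' : ℝ} (hn : 0 < n) (hτ : 0 < τ)
    (hτ' : 0 < τ') :
    rho α p n τ' / rho α p n τ = (τ' / τ) ^ (2 / (1 + 2 * α + 2 * p)) := by
  have hn' : (0 : ℝ) < n := by exact_mod_cast hn
  have e : (τ' / τ) ^ (2 / (1 + 2 * α + 2 * p))
      = ((τ' / τ) ^ (2 : ℝ)) ^ (1 / (1 + 2 * α + 2 * p)) := by
    rw [← Real.rpow_mul (by positivity)]; congr 1; ring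
  rw [rho, rho, ← Real.div_rpow (by positivity) (by positivity), e]
  congr 1
  rw [Real.rpow_ofNat, div_pow]
  field_simp

theorem tendsto_rho (hD : 0 < 1 + 2 * α + 2 * p) {τ : ℕ → ℝ} (hτ : IsScaling τ) :
    Tendsto (fun n => rho α p n (τ n)) atTop atTop :=
  (tendsto_rpow_atTop (by positivity)).comp hτ.2

theorem biasTerm_eq (hD : 0 < 1 + 2 * α + 2 * p) {n : ℕ} {τ : ℝ} (hn : 0 < n) (hτ : 0 < τ) :
    biasTerm S α β p q n τ = rho α p n τ ^ (-min (q + β) (1 + 2 * α + 2 * p))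
      * |biasShape S (q + β) (1 + 2 * α + 2 * p) (rho α p n τ)| := by
  have h1 : min ((β + q) / (1 + 2 * α + 2 * p)) 1
      = min (q + β) (1 + 2 * α + 2 * p) / (1 + 2 * α + 2 * p) := by
    rw [add_comm β q, ← min_div_div_right hD.le, div_self hD.ne']
  rw [biasTerm, rho_rpow hn hτ, h1, neg_div]
  congr 1
  rw [biasFactorSq, biasShape, add_comm β q]
  split_ifs
  · rw [Real.sqrt_sq_eq_abs]
  · rw [abs_of_nonneg (Real.sqrt_nonneg _), cumulSq]
    congr 1
    rw [Finset.range_eq_Ico]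
    have := Finset.sum_Ico_add' (fun i : ℕ => S (i : ℝ) ^ 2 / (i : ℝ)) 0 ⌊rho α p n τ⌋₊ 1
    push_cast at this
    rw [this]
    rfl
  · simp

theorem spreadTerm_eq (hD : 0 < 1 + 2 * α + 2 * p) (hqp : q < p) {n : ℕ} {τ : ℝ} (hn : 0 < n)
    (hτ : 0 < τ) :
    spreadTerm S α p q n τ
      = τ * (rho α p n τ ^ (-(q + α + 1 / 2)) * |S (rho α p n τ)|) := by
  have h1 : min ((1 / 2 + α + q) / (1 + 2 * α + 2 * p)) (1 / 2)
      = (q + α + 1 / 2) / (1 + 2 * α + 2 * p) := by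
    rw [min_eq_left]
    · congr 1; ring
    · rw [div_le_iff₀ hD]; linarith
  rw [spreadTerm, h1, rho_rpow hn hτ, spreadFactorSq, if_pos hqp, Real.sqrt_sq_eq_abs, neg_div]
  ring

theorem exists_terms_pos (hS : PotterBounded S) (h0 : ∀ i : ℕ, 0 ≤ S (i + 1))
    (hD : 0 < 1 + 2 * α + 2 * p) (hqp : q < p) :
    ∃ t₀, 1 ≤ t₀ ∧ ∀ (n : ℕ) (τ : ℝ), 0 < n → 0 < τ → t₀ ≤ rho α p n τ →
      0 < biasTerm S α β p q n τ ∧ 0 < spreadTerm S α p q n τ := by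
  obtain ⟨t₁, ht₁, h₁⟩ := hS.eventually_pos
  obtain ⟨t₂, ht₂, h₂⟩ := (hS.biasShape h0 (q + β) (1 + 2 * α + 2 * p)).eventually_pos
  refine ⟨max t₁ t₂, ht₁.trans (le_max_left _ _), fun n τ hn hτ hρ => ?_⟩
  have hρ0 := rho_pos (α := α) (p := p) hn hτ
  have a := h₁ _ ((le_max_left _ _).trans hρ)
  have b := h₂ _ ((le_max_right _ _).trans hρ)
  rw [biasTerm_eq hD hn hτ, spreadTerm_eq hD hqp hn hτ]
  constructor
  · exact mul_pos (Real.rpow_pos_of_pos hρ0 _) (abs_pos.2 b.ne')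
  · exact mul_pos hτ (mul_pos (Real.rpow_pos_of_pos hρ0 _) (abs_pos.2 a.ne'))

/-- The quotient of the terms is `√n / H ρ`, where `H` varies regularly with the positive index
`min (q + β) D + p - q`. -/
theorem exists_biasTerm_mul_eq (hS : PotterBounded S) (h0 : ∀ i : ℕ, 0 ≤ S (i + 1))
    (hD : 0 < 1 + 2 * α + 2 * p) (hqp : q < p) :
    ∃ t₀, 1 ≤ t₀ ∧ ∀ (n : ℕ) (τ : ℝ), 0 < n → 0 < τ → t₀ ≤ rho α p n τ →
      biasTerm S α β p q n τ * (rho α p n τ ^ (min (q + β) (1 + 2 * α + 2 * p) + p - q)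
        * (S (rho α p n τ) / biasShape S (q + β) (1 + 2 * α + 2 * p) (rho α p n τ)))
        = √(n : ℝ) * spreadTerm S α p q n τ := by
  obtain ⟨t₁, ht₁, h₁⟩ := hS.eventually_pos
  obtain ⟨t₂, ht₂, h₂⟩ := (hS.biasShape h0 (q + β) (1 + 2 * α + 2 * p)).eventually_pos
  refine ⟨max t₁ t₂, ht₁.trans (le_max_left _ _), fun n τ hn hτ hρ => ?_⟩
  have hρ0 := rho_pos (α := α) (p := p) hn hτ
  have hn' : (0 : ℝ) < n := by exact_mod_cast hn
  have a := h₁ _ ((le_max_left _ _).trans hρ)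
  have b := h₂ _ ((le_max_right _ _).trans hρ)
  have e1 : √(n : ℝ) * τ = rho α p n τ ^ ((1 + 2 * α + 2 * p) / 2) := by
    have : (1 + 2 * α + 2 * p) / 2 / (1 + 2 * α + 2 * p) = 1 / 2 := by field_simp
    rw [rho_rpow hn hτ, this, ← Real.sqrt_eq_rpow, Real.sqrt_mul hn'.le, Real.sqrt_sq hτ.le]
  rw [biasTerm_eq hD hn hτ, spreadTerm_eq hD hqp hn hτ, ← mul_assoc (√(n : ℝ)), e1,
    abs_of_pos a, abs_of_pos b, ← mul_assoc (rho α p n τ ^ ((1 + 2 * α + 2 * p) / 2)),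
    ← Real.rpow_add hρ0]
  have e2 : rho α p n τ ^ ((1 + 2 * α + 2 * p) / 2 + -(q + α + 1 / 2))
      = rho α p n τ ^ (-min (q + β) (1 + 2 * α + 2 * p))
        * rho α p n τ ^ (min (q + β) (1 + 2 * α + 2 * p) + p - q) := by
    rw [← Real.rpow_add hρ0]; congr 1; ring
  rw [e2]
  field_simp

/-- Increasing the scaling decreases the quotient of the two terms, by at least and at most a
power of the quotient of the scalings. -/
theorem exists_terms_compare (hS : PotterBounded S) (h0 : ∀ i : ℕ, 0 ≤ S (i + 1))
    (hD : 0 < 1 + 2 * α + 2 * p) (hqp : q < p) (hqβ : 0 < q + β) :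
    ∃ a b C t₀ : ℝ, 0 < a ∧ 0 < b ∧ 0 < C ∧ 1 ≤ t₀ ∧ ∀ (n : ℕ) (τ τ' : ℝ), 0 < n → 0 < τ →
      τ ≤ τ' → t₀ ≤ rho α p n τ →
      biasTerm S α β p q n τ' * spreadTerm S α p q n τ
        ≤ C * (τ / τ') ^ a * (biasTerm S α β p q n τ * spreadTerm S α p q n τ') ∧
      biasTerm S α β p q n τ * spreadTerm S α p q n τ'
        ≤ C * (τ' / τ) ^ b * (biasTerm S α β p q n τ' * spreadTerm S α p q n τ) := by
  set D := 1 + 2 * α + 2 * p with hDdef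
  set E := min (q + β) D + p - q with hE
  have hE0 : 0 < E := by
    have : 0 < min (q + β) D := lt_min hqβ hD
    linarith
  obtain ⟨t₁, ht₁, h₁⟩ := exists_biasTerm_mul_eq (β := β) hS h0 hD hqp
  obtain ⟨t₂, ht₂, h₂⟩ := exists_terms_pos (β := β) hS h0 hD hqp
  have hU : PotterBounded fun x => S x / biasShape S (q + β) D x := hS.div (hS.biasShape h0 _ _)
  obtain ⟨C, t₃, hC, ht₃, h₃⟩ := hU (E / 2) (by positivity)
  refine ⟨E / D, 3 * E / D, C, max t₁ (max t₂ t₃), by positivity, by positivity, by positivity,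
    ht₁.trans (le_max_left _ _), fun n τ τ' hn hτ hle hρ => ?_⟩
  have hτ' : 0 < τ' := hτ.trans_le hle
  set X := rho α p n τ with hX
  set Y := rho α p n τ' with hY
  have hX0 : 0 < X := rho_pos hn hτ
  have hY0 : 0 < Y := rho_pos hn hτ'
  have hYX : Y / X = (τ' / τ) ^ (2 / D) := rho_div_rho hn hτ hτ'
  have hXY : X ≤ Y := by
    rw [← one_le_div hX0, hYX]
    exact Real.one_le_rpow ((one_le_div hτ).2 hle) (by positivity)
  have hX1 : t₁ ≤ X := (le_max_left _ _).trans hρ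
  have hX2 : t₂ ≤ X := ((le_max_left _ _).trans (le_max_right _ _)).trans hρ
  have hX3 : t₃ ≤ X := ((le_max_right _ _).trans (le_max_right _ _)).trans hρ
  have eX := h₁ n τ hn hτ hX1
  have eY := h₁ n τ' hn hτ' (hX1.trans hXY)
  obtain ⟨pX, sX⟩ := h₂ n τ hn hτ hX2
  obtain ⟨pY, sY⟩ := h₂ n τ' hn hτ' (hX2.trans hXY)
  obtain ⟨uX, c1, c2⟩ := h₃ X Y hX3 hXY
  have uY := (h₃ Y Y (hX3.trans hXY) le_rfl).1
  rw [← hX, ← hDdef, ← hE] at eX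
  rw [← hY, ← hDdef, ← hE] at eY
  set bX := biasTerm S α β p q n τ
  set bY := biasTerm S α β p q n τ'
  set tX := spreadTerm S α p q n τ
  set tY := spreadTerm S α p q n τ'
  set u : ℝ → ℝ := fun x => S x / biasShape S (q + β) D x with hu
  change 0 < u X at uX
  change 0 < u Y at uY
  change u Y ≤ C * (Y / X) ^ (E / 2) * u X at c1
  change u X ≤ C * (Y / X) ^ (E / 2) * u Y at c2
  change bX * (X ^ E * u X) = _ at eX
  change bY * (Y ^ E * u Y) = _ at eY
  -- the cross product of the two identities, in which `√n` cancels
  have hcross : (bX * tY) * (X ^ E * u X) = (bY * tX) * (Y ^ E * u Y) := by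
    have hn' : (0 : ℝ) < √(n : ℝ) := Real.sqrt_pos.2 (by exact_mod_cast hn)
    calc (bX * tY) * (X ^ E * u X) = (bX * (X ^ E * u X)) * tY := by ring
      _ = (√(n : ℝ) * tY) * tX := by rw [eX]; ring
      _ = _ := by rw [← eY]; ring
  have hr0 : 0 < Y / X := by positivity
  have hYE : Y ^ E = X ^ E * (Y / X) ^ E := by
    rw [Real.div_rpow hY0.le hX0.le]; field_simp
  rw [hYE] at hcross
  have hcross' : (bX * tY) * u X = (bY * tX) * ((Y / X) ^ E * u Y) := by
    have hXE : 0 < X ^ E := Real.rpow_pos_of_pos hX0 _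
    have : X ^ E * ((bX * tY) * u X) = X ^ E * ((bY * tX) * ((Y / X) ^ E * u Y)) := by
      linarith
    exact mul_left_cancel₀ hXE.ne' this
  have ehalf : (Y / X) ^ E = (Y / X) ^ (E / 2) * (Y / X) ^ (E / 2) := by
    rw [← Real.rpow_add hr0, add_halves]
  set g := (Y / X) ^ (E / 2) with hg
  have hg0 : 0 < g := Real.rpow_pos_of_pos hr0 _
  have eg : (τ / τ') ^ (E / D) = g⁻¹ := by
    rw [hg, hYX, ← Real.rpow_mul (by positivity), ← Real.inv_rpow (by positivity), inv_div]
    congr 1; field_simp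
  have eg3 : (τ' / τ) ^ (3 * E / D) = g ^ 3 := by
    rw [hg, hYX, ← Real.rpow_mul (by positivity), ← Real.rpow_natCast, ← Real.rpow_mul
      (by positivity)]
    congr 1; push_cast; field_simp
  rw [eg, eg3]
  rw [ehalf] at hcross'
  constructor
  · have h4 : (bY * tX) * (g * g * u Y) ≤ (bX * tY) * (C * g * u Y) := by
      rw [← hcross']; gcongr
    have h5 : (bY * tX) * g ≤ C * (bX * tY) := by
      have h6 : ((bY * tX) * g) * (g * u Y) ≤ (C * (bX * tY)) * (g * u Y) := by
        refine le_trans (le_of_eq ?_) (h4.trans (le_of_eq ?_)) <;> ring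
      exact le_of_mul_le_mul_right h6 (by positivity)
    calc bY * tX = (bY * tX) * g * g⁻¹ := by field_simp
      _ ≤ C * (bX * tY) * g⁻¹ := by gcongr
      _ = _ := by ring
  · have h4 : (bX * tY) * u X ≤ (bY * tX) * (g * g * (C * g * u X)) := by
      rw [hcross']; gcongr
    have h5 : (bX * tY) * u X ≤ (C * g ^ 3 * (bY * tX)) * u X :=
      h4.trans (le_of_eq (by ring))
    exact le_of_mul_le_mul_right h5 uX

/-- The effective dimension is at most polynomial in `n`, if the two terms are comparable. -/
theorem exists_rho_rpow_mul_le (hS : PotterBounded S) (h0 : ∀ i : ℕ, 0 ≤ S (i + 1))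
    (hD : 0 < 1 + 2 * α + 2 * p) (hqp : q < p) (hqβ : 0 < q + β) :
    ∃ a C t₀ : ℝ, 0 < a ∧ 0 < C ∧ 1 ≤ t₀ ∧ ∀ (n : ℕ) (τ : ℝ), 0 < n → 0 < τ →
      t₀ ≤ rho α p n τ →
      biasTerm S α β p q n τ * rho α p n τ ^ a ≤ C * √(n : ℝ) * spreadTerm S α p q n τ := by
  set D := 1 + 2 * α + 2 * p with hDdef
  set E := min (q + β) D + p - q with hE
  have hE0 : 0 < E := by
    have : 0 < min (q + β) D := lt_min hqβ hD
    linarith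
  obtain ⟨t₁, ht₁, h₁⟩ := exists_biasTerm_mul_eq (β := β) hS h0 hD hqp
  obtain ⟨t₂, ht₂, h₂⟩ := exists_terms_pos (β := β) hS h0 hD hqp
  have hU : PotterBounded fun x => S x / biasShape S (q + β) D x := hS.div (hS.biasShape h0 _ _)
  obtain ⟨C, t₃, hC, ht₃, h₃⟩ := hU (E / 2) (by positivity)
  have u3 := (h₃ t₃ t₃ le_rfl le_rfl).1
  refine ⟨E / 2, C / (S t₃ / biasShape S (q + β) D t₃), max t₁ (max t₂ t₃), by positivity,
    by positivity, ht₁.trans (le_max_left _ _), fun n τ hn hτ hρ => ?_⟩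
  set X := rho α p n τ with hX
  have hX0 : 0 < X := rho_pos hn hτ
  have hX1 : t₁ ≤ X := (le_max_left _ _).trans hρ
  have hX2 : t₂ ≤ X := ((le_max_left _ _).trans (le_max_right _ _)).trans hρ
  have hX3 : t₃ ≤ X := ((le_max_right _ _).trans (le_max_right _ _)).trans hρ
  have eX := h₁ n τ hn hτ hX1
  obtain ⟨pX, sX⟩ := h₂ n τ hn hτ hX2
  obtain ⟨-, -, c2⟩ := h₃ t₃ X le_rfl hX3
  have uX := (h₃ X X hX3 le_rfl).1
  rw [← hX, ← hDdef, ← hE] at eX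
  set u : ℝ → ℝ := fun x => S x / biasShape S (q + β) D x with hu
  change 0 < u X at uX
  change 0 < u t₃ at u3
  change u t₃ ≤ C * (X / t₃) ^ (E / 2) * u X at c2
  change _ * (X ^ E * u X) = _ at eX
  change _ ≤ C / u t₃ * √(n : ℝ) * _
  have h4 : (X / t₃) ^ (E / 2) ≤ X ^ (E / 2) :=
    Real.rpow_le_rpow (by positivity) (div_le_self hX0.le ht₃) (by positivity)
  have h5 : u t₃ ≤ C * X ^ (E / 2) * u X := c2.trans (by gcongr)
  have ehalf : X ^ E = X ^ (E / 2) * X ^ (E / 2) := by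
    rw [← Real.rpow_add hX0, add_halves]
  rw [mul_assoc, ← eX, ehalf, div_mul_eq_mul_div, le_div_iff₀ u3]
  calc biasTerm S α β p q n τ * X ^ (E / 2) * u t₃
      ≤ biasTerm S α β p q n τ * X ^ (E / 2) * (C * X ^ (E / 2) * u X) := by gcongr
    _ = _ := by ring

end Terms

/-! ### The diagonal model -/

section Model

variable {E F : Type*}
  [NormedAddCommGroup E] [InnerProductSpace ℝ E] [CompleteSpace E]
  [MeasurableSpace E]
  [NormedAddCommGroup F] [InnerProductSpace ℝ F] [CompleteSpace F]

/-- The assumptions on the operators `K`, `Λ`, `R = Λ^{1/2}` and the functional `L`, all of which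
are diagonal in the basis `e`. -/
structure DiagonalModel (e : HilbertBasis ℕ ℝ E) (K : E →L[ℝ] F) (Λ R : E →L[ℝ] E) (κ : ℕ → ℝ)
    (L : E → ℝ) (V : Submodule ℝ E) (S : ℝ → ℝ) (α β p q C : ℝ) : Prop where
  pos_α : 0 < α
  pos_β : 0 < β
  nonneg_p : 0 ≤ p
  one_le_C : 1 ≤ C
  apply_K : ∀ i, K.adjoint (K (e i)) = κ i ^ 2 • e i
  bounds_κ : ∀ i : ℕ, C⁻¹ * ((i : ℝ) + 1) ^ (-p) ≤ κ i ∧ κ i ≤ C * ((i : ℝ) + 1) ^ (-p)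
  apply_Λ : ∀ i : ℕ, Λ (e i) = ((i : ℝ) + 1) ^ (-1 - 2 * α) • e i
  pos_R : R.IsPositive
  comp_R : R ∘L R = Λ
  measurable_L : IsMeasurableLinear Λ L V
  mem_V : ∀ μ, MemSobolev e β μ → μ ∈ V
  slowly : SlowlyVarying S
  abs_l : ∀ i : ℕ, |L (R (e i)) / √(((i : ℝ) + 1) ^ (-1 - 2 * α))|
      = ((i : ℝ) + 1) ^ (-q - 1 / 2) * S ((i : ℝ) + 1)
  lt_p : q < p
  lt_β : -β < q
  lt_α : -(α + 1 / 2) < q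

/-- The signal-to-noise ratio `n τ² λ_i κ_i²` of the `i`-th coordinate. -/
noncomputable def signal (κ : ℕ → ℝ) (α : ℝ) (n : ℕ) (τ : ℝ) (i : ℕ) : ℝ :=
  (n : ℝ) * τ ^ 2 * (((i : ℝ) + 1) ^ (-1 - 2 * α) * κ i ^ 2)

/-- Minus the bias of the posterior mean of `L μ`, in spectral coordinates. -/
noncomputable def spectralBias (e : HilbertBasis ℕ ℝ E) (κ : ℕ → ℝ) (L : E → ℝ) (α : ℝ)
    (n : ℕ) (τ : ℝ) (μ : E) : ℝ :=
  ∑' i : ℕ, L (e i) * inner ℝ (e i) μ / (1 + signal κ α n τ i)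

namespace DiagonalModel

variable {e : HilbertBasis ℕ ℝ E} {K : E →L[ℝ] F} {Λ R : E →L[ℝ] E} {κ : ℕ → ℝ}
    {L : E → ℝ} {V : Submodule ℝ E} {S : ℝ → ℝ} {α β p q C : ℝ}

theorem D_pos (M : DiagonalModel e K Λ R κ L V S α β p q C) : 0 < 1 + 2 * α + 2 * p := by
  linarith [M.pos_α, M.nonneg_p]

theorem qβ_pos (M : DiagonalModel e K Λ R κ L V S α β p q C) : 0 < q + β := by
  linarith [M.lt_β]

theorem potter (M : DiagonalModel e K Λ R κ L V S α β p q C) : PotterBounded S :=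
  M.slowly.potterBounded

theorem S_nonneg (M : DiagonalModel e K Λ R κ L V S α β p q C) (i : ℕ) : 0 ≤ S (i + 1) := by
  have h := abs_nonneg (L (R (e i)) / √(((i : ℝ) + 1) ^ (-1 - 2 * α)))
  rw [M.abs_l] at h
  exact nonneg_of_mul_nonneg_right h (by positivity)

theorem R_apply (M : DiagonalModel e K Λ R κ L V S α β p q C) (i : ℕ) :
    R (e i) = √(((i : ℝ) + 1) ^ (-1 - 2 * α)) • e i :=
  sqrt_apply_eigenvector M.pos_R M.comp_R (by positivity) (M.apply_Λ i)

theorem L_smul (M : DiagonalModel e K Λ R κ L V S α β p q C) (a : ℝ) (i : ℕ) :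
    L (a • e i) = a * L (e i) :=
  M.measurable_L.map_smul a _ (M.mem_V _ (memSobolev_basis e β i))

theorem abs_L (M : DiagonalModel e K Λ R κ L V S α β p q C) (i : ℕ) :
    |L (e i)| = ((i : ℝ) + 1) ^ (-q - 1 / 2) * S ((i : ℝ) + 1) := by
  have hpos : 0 < √(((i : ℝ) + 1) ^ (-1 - 2 * α)) := Real.sqrt_pos.2 (by positivity)
  rw [← M.abs_l, M.R_apply, M.L_smul, mul_div_cancel_left₀ _ hpos.ne']

theorem sq_L (M : DiagonalModel e K Λ R κ L V S α β p q C) (i : ℕ) :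
    L (e i) ^ 2 = S ((i : ℝ) + 1) ^ 2 * ((i : ℝ) + 1) ^ (-1 - 2 * q) := by
  rw [← sq_abs, M.abs_L, mul_pow, mul_comm, ← Real.rpow_natCast (_ ^ (-q - 1 / 2)),
    ← Real.rpow_mul (by positivity)]
  congr 2; push_cast; ring

theorem signal_bounds (M : DiagonalModel e K Λ R κ L V S α β p q C) {n : ℕ} {τ : ℝ} (hn : 0 < n)
    (hτ : 0 < τ) (i : ℕ) :
    (C ^ 2)⁻¹ * (rho α p n τ / (i + 1)) ^ (1 + 2 * α + 2 * p) ≤ signal κ α n τ i ∧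
    signal κ α n τ i ≤ C ^ 2 * (rho α p n τ / (i + 1)) ^ (1 + 2 * α + 2 * p) := by
  have hj : (0 : ℝ) < (i : ℝ) + 1 := by positivity
  have hC : 0 < C := by linarith [M.one_le_C]
  have hn' : (0 : ℝ) < n := by exact_mod_cast hn
  have e1 : (rho α p n τ / (i + 1)) ^ (1 + 2 * α + 2 * p)
      = (n : ℝ) * τ ^ 2 * (((i : ℝ) + 1) ^ (-1 - 2 * α) * (((i : ℝ) + 1) ^ (-p)) ^ 2) := by
    rw [Real.div_rpow (rho_pos hn hτ).le hj.le, rho_rpow hn hτ, div_self M.D_pos.ne',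
      Real.rpow_one, div_eq_mul_inv, ← Real.rpow_neg hj.le, ← Real.rpow_natCast (_ ^ (-p)),
      ← Real.rpow_mul hj.le, ← Real.rpow_add hj]
    congr 2; push_cast; ring
  obtain ⟨h1, h2⟩ := M.bounds_κ i
  have h0 : 0 ≤ κ i := le_trans (by positivity) h1
  rw [e1, signal]
  constructor
  · calc (C ^ 2)⁻¹ * ((n : ℝ) * τ ^ 2 * (((i : ℝ) + 1) ^ (-1 - 2 * α)
            * (((i : ℝ) + 1) ^ (-p)) ^ 2))
        = (n : ℝ) * τ ^ 2 * (((i : ℝ) + 1) ^ (-1 - 2 * α)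
            * (C⁻¹ * ((i : ℝ) + 1) ^ (-p)) ^ 2) := by field_simp
      _ ≤ _ := by gcongr
  · calc (n : ℝ) * τ ^ 2 * (((i : ℝ) + 1) ^ (-1 - 2 * α) * κ i ^ 2)
        ≤ (n : ℝ) * τ ^ 2 * (((i : ℝ) + 1) ^ (-1 - 2 * α)
            * (C * ((i : ℝ) + 1) ^ (-p)) ^ 2) := by gcongr
      _ = _ := by ring

theorem signal_nonneg (κ : ℕ → ℝ) (α : ℝ) (n : ℕ) (τ : ℝ) (i : ℕ) : 0 ≤ signal κ α n τ i := by
  unfold signal; positivity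

/-- The bias, the variance of the posterior mean, and the posterior variance as series. -/
theorem spectral [BorelSpace E] (M : DiagonalModel e K Λ R κ L V S α β p q C) {n : ℕ} {τ : ℝ}
    (hn : 0 < n) (hτ : 0 < τ) :
    (∀ μ, MemSobolev e β μ →
      inner ℝ (K μ) (LAvec e K (τ • R) L n) - L μ = -spectralBias e κ L α n τ μ) ∧
    HasSum (fun i : ℕ => τ ^ 2 * (S (i + 1) ^ 2 * ((i : ℝ) + 1) ^ (-1 - 2 * (q + α + 1 / 2))
      * signal κ α n τ i / (1 + signal κ α n τ i) ^ 2))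
      (‖LAvec e K (τ • R) L n‖ ^ 2 / n) ∧
    HasSum (fun i : ℕ => τ ^ 2 * (S (i + 1) ^ 2 * ((i : ℝ) + 1) ^ (-1 - 2 * (q + α + 1 / 2))
      / (1 + signal κ α n τ i) ^ 1)) (postSd e K (τ ^ 2 • Λ) (τ • R) L n ^ 2) := by
  have hn' : (0 : ℝ) < n := by exact_mod_cast hn
  set r : ℕ → ℝ := fun i => τ * √(((i : ℝ) + 1) ^ (-1 - 2 * α)) with hr
  have hr2 : ∀ i, r i ^ 2 = τ ^ 2 * ((i : ℝ) + 1) ^ (-1 - 2 * α) := fun i => by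
    rw [hr]; simp only; rw [mul_pow, Real.sq_sqrt (by positivity)]
  have hRe : ∀ i, (τ • R) (e i) = r i • e i := fun i => by
    change τ • R (e i) = _
    rw [M.R_apply, smul_smul]
  have hLe : ∀ i, L ((τ • R) (e i)) = r i * L (e i) := fun i => by rw [hRe, M.L_smul]
  have hw2 : ∀ i, L ((τ • R) (e i)) ^ 2
      = τ ^ 2 * (S (i + 1) ^ 2 * ((i : ℝ) + 1) ^ (-1 - 2 * (q + α + 1 / 2))) := fun i => by
    rw [hLe, mul_pow, hr2, M.sq_L]
    have : ((i : ℝ) + 1) ^ (-1 - 2 * (q + α + 1 / 2))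
        = ((i : ℝ) + 1) ^ (-1 - 2 * α) * ((i : ℝ) + 1) ^ (-1 - 2 * q) := by
      rw [← Real.rpow_add (by positivity)]; congr 1; ring
    rw [this]; ring
  have hw : Summable fun i => L ((τ • R) (e i)) ^ 2 := by
    simp only [hw2]
    exact (M.potter.summable_sq M.S_nonneg (by linarith [M.lt_α])).mul_left _
  have hsa : IsSelfAdjoint (τ • R) := by
    have h1 := M.pos_R.isSelfAdjoint
    rw [isSelfAdjoint_iff, star_smul, h1.star_eq]
    simp
  obtain ⟨h1, h2, h3⟩ := posterior_spectral e K M.apply_K hsa hRe hn hw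
  have hx : ∀ i, (n : ℝ)⁻¹ + r i ^ 2 * κ i ^ 2 = (n : ℝ)⁻¹ * (1 + signal κ α n τ i) := fun i => by
    rw [hr2, signal]; field_simp
  have hx' : ∀ i, κ i ^ 2 * r i ^ 2 = (n : ℝ)⁻¹ * signal κ α n τ i := fun i => by
    rw [hr2, signal]; field_simp
  have hxp : ∀ i, 0 < 1 + signal κ α n τ i := fun i => by
    have := signal_nonneg κ α n τ i; linarith
  refine ⟨fun μ hμ => ?_, ?_, ?_⟩
  · have h4 := (h1 μ).sub (M.measurable_L.hasSum_inner_mul e M.pos_β M.mem_V hμ)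
    rw [← h4.tsum_eq, spectralBias, ← tsum_neg]
    refine tsum_congr fun i => ?_
    rw [hLe, hx]
    have e1 : κ i ^ 2 * r i * (r i * L (e i)) = (n : ℝ)⁻¹ * signal κ α n τ i * L (e i) := by
      rw [← hx']; ring
    rw [e1]
    have := (hxp i).ne'
    field_simp
    ring
  · have h4 := h2.div_const (n : ℝ)
    refine (congrArg (HasSum · _) (funext fun i => ?_)).mpr h4
    rw [hw2, hx, hx']
    have := (hxp i).ne'
    field_simp
  · have hcomp : (τ • R) ∘L (τ • R) = τ ^ 2 • Λ := by
      rw [← M.comp_R]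
      ext x
      simp [smul_smul, sq]
    rw [hcomp] at h3
    rw [postSd, Real.sq_sqrt (h3.nonneg fun i => by
      have := hxp i
      rw [hx]
      positivity)]
    refine (congrArg (HasSum · _) (funext fun i => ?_)).mpr h3
    rw [hw2, hx]
    have := (hxp i).ne'
    field_simp

/-- As `q < p`, the spread of the posterior mean, the posterior spread and the difference of their
squares are all of the order of the spread term: the series are dominated by the coordinates `j` of
the order `ρ`. Hence the half width of the interval exceeds the quantile times the standard
deviation of its centre by at least a factor `r > 1`. -/
theorem exists_coverage_eq [BorelSpace E] (M : DiagonalModel e K Λ R κ L V S α β p q C)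
    {Ω : Type*} [MeasurableSpace Ω] {P : Measure Ω} {Z : F → Ω → ℝ} (hZ : IsIsoGaussian Z P) {γ : ℝ}
    (h0 : 0 < γ) (h1 : γ < 1) :
    ∃ r W c c' t₀ : ℝ, 1 < r ∧ 0 < c ∧ 0 < c' ∧ 1 ≤ t₀ ∧ ∀ (n : ℕ) (τ : ℝ), 0 < n → 0 < τ →
      t₀ ≤ rho α p n τ → ∃ t v : ℝ, 0 < t ∧ c * spreadTerm S α p q n τ ≤ t ∧
        t ≤ c' * spreadTerm S α p q n τ ∧ r * -normalQuantile (γ / 2) ≤ v ∧ v ≤ W ∧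
        ∀ μ, MemSobolev e β μ → coverage P Z e K Λ R L γ n τ μ
          = shiftedCoverage (-(spectralBias e κ L α n τ μ / t)) v := by
  have hC : 0 < C := by linarith [M.one_le_C]
  have hθ : 0 < q + α + 1 / 2 := by linarith [M.lt_α]
  have hD := M.D_pos
  set D := 1 + 2 * α + 2 * p with hDdef
  obtain ⟨C₁, t₁, hC₁, ht₁, u₁⟩ := M.potter.exists_tsum_le M.S_nonneg (k := 1) (D := D)
    (c := (C ^ 2)⁻¹) hθ (by push_cast; linarith [M.lt_p]) (by positivity)
  obtain ⟨c₂, t₂, hc₂, ht₂, u₂⟩ := M.potter.exists_le_tsum 2 (s := 2 * (q + α + 1 / 2))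
    (by linarith)
  obtain ⟨t₃, ht₃, u₃⟩ := M.potter.eventually_pos
  set A := (C ^ 2)⁻¹ * (1 / 3) ^ D / (1 + C ^ 2) ^ 2 with hA
  set B := 1 / (1 + C ^ 2) ^ 2 with hB
  have hA0 : 0 < A := by positivity
  have hB0 : 0 < B := by positivity
  set z := -normalQuantile (γ / 2) with hz
  have hz0 : 0 < z := by have := normalQuantile_neg h0 h1; linarith
  refine ⟨√(1 + c₂ * B / C₁), z * √(C₁ / (c₂ * A)), √(c₂ * A), √C₁, max t₁ (max t₂ t₃), ?_,
    by positivity, by positivity, ht₁.trans (le_max_left _ _), fun n τ hn hτ hρ => ?_⟩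
  · rw [Real.lt_sqrt (by norm_num)]
    have : 0 < c₂ * B / C₁ := by positivity
    linarith
  have hρ1 : t₁ ≤ rho α p n τ := (le_max_left _ _).trans hρ
  have hρ2 : t₂ ≤ rho α p n τ := ((le_max_left _ _).trans (le_max_right _ _)).trans hρ
  have hρ3 : t₃ ≤ rho α p n τ := ((le_max_right _ _).trans (le_max_right _ _)).trans hρ
  have hn' : (0 : ℝ) < n := by exact_mod_cast hn
  have hb := M.signal_bounds hn hτ
  rw [← hDdef] at hb
  have hρ0 : 0 < rho α p n τ := rho_pos hn hτ
  have hst := spreadTerm_eq (S := S) hD M.lt_p hn hτ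
  have hSρ := u₃ _ hρ3
  rw [abs_of_pos hSρ] at hst
  set ρ := rho α p n τ with hρdef
  set x := signal κ α n τ with hx
  have hx0 : ∀ i, 0 ≤ x i := signal_nonneg κ α n τ
  have hxp : ∀ i, 0 < 1 + x i := fun i => by linarith [hx0 i]
  obtain ⟨s1, s2, s3⟩ := M.spectral hn hτ
  set s := postSd e K (τ ^ 2 • Λ) (τ • R) L n with hs
  set Q := spreadTerm S α p q n τ with hQ
  have hQ0 : 0 < Q := by
    rw [hst]; exact mul_pos hτ (mul_pos (Real.rpow_pos_of_pos hρ0 _) hSρ)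
  have hQ2 : τ ^ 2 * (ρ ^ (-(2 * (q + α + 1 / 2))) * S ρ ^ 2) = Q ^ 2 := by
    rw [hst, mul_pow, mul_pow, ← Real.rpow_natCast (ρ ^ _), ← Real.rpow_mul hρ0.le]
    congr 3; push_cast; ring
  set T := ‖LAvec e K (τ • R) L n‖ ^ 2 / n with hT
  have hs0 : 0 ≤ s := Real.sqrt_nonneg _
  -- coordinates with `ρ ≤ j ≤ 3 ρ` have signal bounded above and below
  have hblock : ∀ i : ℕ, ρ ≤ (i : ℝ) + 1 → (i : ℝ) + 1 ≤ 3 * ρ →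
      (C ^ 2)⁻¹ * (1 / 3) ^ D ≤ x i ∧ x i ≤ C ^ 2 := by
    intro i hi1 hi2
    have hj : (0 : ℝ) < (i : ℝ) + 1 := by positivity
    constructor
    · refine le_trans ?_ (hb i).1
      have : 1 / 3 ≤ ρ / ((i : ℝ) + 1) := by rw [le_div_iff₀ hj]; linarith
      gcongr
    · refine (hb i).2.trans (mul_le_of_le_one_right (by positivity) ?_)
      exact Real.rpow_le_one (by positivity) ((div_le_one hj).2 hi1) hD.le
  have hsU : s ^ 2 ≤ C₁ * Q ^ 2 := by
    rw [← s3.tsum_eq, tsum_mul_left]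
    have := (u₁ ρ hρ1 x fun i => (hb i).1).2
    calc _ ≤ τ ^ 2 * (C₁ * (ρ ^ (-(q + α + 1 / 2)) * S ρ) ^ 2) := by gcongr
      _ = _ := by rw [hst]; ring
  have hTL : c₂ * A * Q ^ 2 ≤ T := by
    have h5 := u₂ ρ hρ2 _ (τ ^ 2 * A) s2.summable (fun i => by
      have := hx0 i
      positivity) (by positivity) (fun i hi1 hi2 => by
      obtain ⟨b1, b2⟩ := hblock i hi1 hi2
      have := hx0 i
      calc τ ^ 2 * A * (S ((i : ℝ) + 1) ^ 2 * ((i : ℝ) + 1) ^ (-1 - 2 * (q + α + 1 / 2)))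
          = τ ^ 2 * (S ((i : ℝ) + 1) ^ 2 * ((i : ℝ) + 1) ^ (-1 - 2 * (q + α + 1 / 2))
            * ((C ^ 2)⁻¹ * (1 / 3) ^ D) / (1 + C ^ 2) ^ 2) := by rw [hA]; ring
        _ ≤ _ := by gcongr)
    rw [s2.tsum_eq] at h5
    refine le_trans (le_of_eq ?_) h5
    rw [← hQ2]; ring
  -- the terms of the difference are those of `s ^ 2`, with the square of `1 + x i`
  have hdiff : c₂ * B * Q ^ 2 ≤ s ^ 2 - T := by
    have h5 := u₂ ρ hρ2 _ (τ ^ 2 * B) (s3.sub s2).summable (fun i => ?_) (by positivity)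
      (fun i hi1 hi2 => ?_)
    · rw [(s3.sub s2).tsum_eq] at h5
      refine le_trans (le_of_eq ?_) h5
      rw [← hQ2]; ring
    all_goals
      have hp := hxp i
      have e1 : τ ^ 2 * (S ((i : ℝ) + 1) ^ 2 * ((i : ℝ) + 1) ^ (-1 - 2 * (q + α + 1 / 2))
            / (1 + x i) ^ 1)
          - τ ^ 2 * (S ((i : ℝ) + 1) ^ 2 * ((i : ℝ) + 1) ^ (-1 - 2 * (q + α + 1 / 2))
            * x i / (1 + x i) ^ 2)
          = τ ^ 2 * (S ((i : ℝ) + 1) ^ 2 * ((i : ℝ) + 1) ^ (-1 - 2 * (q + α + 1 / 2))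
            / (1 + x i) ^ 2) := by field_simp; ring
      rw [e1]
    · positivity
    · obtain ⟨b1, b2⟩ := hblock i hi1 hi2
      calc τ ^ 2 * B * (S ((i : ℝ) + 1) ^ 2 * ((i : ℝ) + 1) ^ (-1 - 2 * (q + α + 1 / 2)))
          = τ ^ 2 * (S ((i : ℝ) + 1) ^ 2 * ((i : ℝ) + 1) ^ (-1 - 2 * (q + α + 1 / 2))
            / (1 + C ^ 2) ^ 2) := by rw [hB]; ring
        _ ≤ _ := by gcongr
  have hT0 : 0 < T := lt_of_lt_of_le (by positivity) hTL
  have hTs : T ≤ s ^ 2 := by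
    have : 0 < c₂ * B * Q ^ 2 := by positivity
    linarith
  have ht : 0 < √T := Real.sqrt_pos.2 hT0
  have hrs : √(1 + c₂ * B / C₁) ≤ s / √T := by
    rw [le_div_iff₀ ht, ← Real.sqrt_mul (by positivity)]
    refine Real.sqrt_le_iff.2 ⟨hs0, ?_⟩
    have h5 : c₂ * B / C₁ * T ≤ c₂ * B * Q ^ 2 := by
      rw [div_mul_eq_mul_div, div_le_iff₀ hC₁]
      calc c₂ * B * T ≤ c₂ * B * (C₁ * Q ^ 2) := by
            gcongr
            exact hTs.trans hsU
        _ = _ := by ring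
    linarith
  have hsV : s / √T ≤ √(C₁ / (c₂ * A)) := by
    rw [div_le_iff₀ ht, ← Real.sqrt_mul (by positivity)]
    refine Real.le_sqrt_of_sq_le ?_
    calc s ^ 2 ≤ C₁ * Q ^ 2 := hsU
      _ = C₁ / (c₂ * A) * (c₂ * A * Q ^ 2) := by field_simp
      _ ≤ _ := by gcongr
  refine ⟨√T, z * (s / √T), ht, ?_, ?_, ?_, ?_, fun μ hμ => ?_⟩
  · refine Real.le_sqrt_of_sq_le ?_
    rw [mul_pow, Real.sq_sqrt (by positivity)]
    exact hTL
  · refine Real.sqrt_le_iff.2 ⟨by positivity, ?_⟩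
    rw [mul_pow, Real.sq_sqrt hC₁.le]
    exact hTs.trans hsU
  · rw [mul_comm]; gcongr
  · gcongr
  · rw [coverage_eq_shiftedCoverage hZ e K Λ R L h0 h1 hn τ μ ht (Real.sq_sqrt hT0.le), s1 μ hμ,
      neg_div]

end DiagonalModel

end Model

/-! ### The bias over Sobolev balls and at fixed parameters -/

section Sobolev

variable {E : Type*} [NormedAddCommGroup E] [InnerProductSpace ℝ E]
  (e : HilbertBasis ℕ ℝ E)

/-- The Sobolev space is isometric to `E`, by multiplication of the coordinates by `j ^ β`. -/
theorem MemSobolev.exists_lift {β : ℝ} {μ : E} (hμ : MemSobolev e β μ) :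
    ∃ y : E, ‖y‖ = sobolevNorm e β μ ∧
      ∀ i : ℕ, inner ℝ (e i) y = inner ℝ (e i) μ * ((i : ℝ) + 1) ^ β := by
  have hpow : ∀ i : ℕ, (((i : ℝ) + 1) ^ β) ^ 2 = ((i : ℝ) + 1) ^ (2 * β) := fun i => by
    rw [← Real.rpow_natCast, ← Real.rpow_mul (by positivity)]; congr 1; push_cast; ring
  obtain ⟨y, hy⟩ := exists_inner_basis_eq e (c := fun i => inner ℝ (e i) μ * ((i : ℝ) + 1) ^ β)
    (by simpa only [mul_pow, hpow, MemSobolev] using hμ)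
  refine ⟨y, ?_, hy⟩
  have h := hasSum_sq_inner_basis e y
  simp only [hy, mul_pow, hpow] at h
  rw [sobolevNorm, h.tsum_eq, Real.sqrt_sq (norm_nonneg _)]

/-- The inverse of the isometry of `MemSobolev.exists_lift`. As `0 ≤ β`, it maps all of `E` into
`E`. -/
theorem exists_memSobolev_inner_eq {β : ℝ} (hβ : 0 ≤ β) (y : E) :
    ∃ μ : E, MemSobolev e β μ ∧ sobolevNorm e β μ = ‖y‖ ∧
      ∀ i : ℕ, inner ℝ (e i) μ = inner ℝ (e i) y * ((i : ℝ) + 1) ^ (-β) := by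
  obtain ⟨T, hT⟩ := exists_diagonal e (d := fun i => ((i : ℝ) + 1) ^ (-β)) (B := 1) fun i => by
    rw [abs_of_nonneg (by positivity)]
    exact Real.rpow_le_one_of_one_le_of_nonpos (by linarith [(i.cast_nonneg : (0 : ℝ) ≤ i)])
      (by linarith)
  have hsq : ∀ i : ℕ, (inner ℝ (e i) (T y)) ^ 2 * ((i : ℝ) + 1) ^ (2 * β)
      = (inner ℝ (e i) y) ^ 2 := fun i => by
    have hj : (0 : ℝ) < (i : ℝ) + 1 := by positivity
    rw [hT, Real.rpow_neg hj.le, two_mul, Real.rpow_add hj]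
    field_simp
  have h := hasSum_sq_inner_basis e y
  refine ⟨T y, ?_, ?_, fun i => by rw [hT, mul_comm]⟩
  · simpa only [MemSobolev, hsq] using h.summable
  · simp only [sobolevNorm, hsq]
    rw [h.tsum_eq, Real.sqrt_sq (norm_nonneg _)]

end Sobolev

namespace DiagonalModel

variable {E F : Type*}
  [NormedAddCommGroup E] [InnerProductSpace ℝ E] [CompleteSpace E]
  [MeasurableSpace E]
  [NormedAddCommGroup F] [InnerProductSpace ℝ F] [CompleteSpace F]
  {e : HilbertBasis ℕ ℝ E} {K : E →L[ℝ] F} {Λ R : E →L[ℝ] E} {κ : ℕ → ℝ}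
  {L : E → ℝ} {V : Submodule ℝ E} {S : ℝ → ℝ} {α β p q C : ℝ}

/-- The bias as a continuous linear functional of the lifted parameter; the norm of the
representer is the maximal bias over the unit ball of the Sobolev space, and is of the order of the
bias term. -/
theorem exists_representer (M : DiagonalModel e K Λ R κ L V S α β p q C) :
    ∃ c c' t₀ : ℝ, 0 < c ∧ 0 < c' ∧ 1 ≤ t₀ ∧ ∀ (n : ℕ) (τ : ℝ), 0 < n → 0 < τ →
      t₀ ≤ rho α p n τ → ∃ a : E,
        (∀ i : ℕ, inner ℝ (e i) a = L (e i) * ((i : ℝ) + 1) ^ (-β) / (1 + signal κ α n τ i)) ∧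
        c * biasTerm S α β p q n τ ≤ ‖a‖ ∧ ‖a‖ ≤ c' * biasTerm S α β p q n τ ∧
        ∀ μ y : E, (∀ i : ℕ, inner ℝ (e i) y = inner ℝ (e i) μ * ((i : ℝ) + 1) ^ β) →
          spectralBias e κ L α n τ μ = inner ℝ a y := by
  have hC : 0 < C := by linarith [M.one_le_C]
  obtain ⟨c, c', t₁, hc, hc', ht₁, h₁⟩ := M.potter.exists_biasSum_bounds M.S_nonneg M.qβ_pos
    M.D_pos (c := (C ^ 2)⁻¹) (C := C ^ 2) (by positivity) (by positivity)
  refine ⟨√c, √c', t₁, by positivity, by positivity, ht₁, fun n τ hn hτ hρ => ?_⟩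
  obtain ⟨hs, hlo, hup⟩ := h₁ _ hρ (signal κ α n τ) (M.signal_bounds hn hτ)
  have hbt := biasTerm_eq (S := S) (q := q) (β := β) M.D_pos hn hτ
  have hsq : ∀ i : ℕ, (L (e i) * ((i : ℝ) + 1) ^ (-β) / (1 + signal κ α n τ i)) ^ 2
      = S (i + 1) ^ 2 * ((i : ℝ) + 1) ^ (-1 - 2 * (q + β)) / (1 + signal κ α n τ i) ^ 2 := by
    intro i
    have hj : (0 : ℝ) < (i : ℝ) + 1 := by positivity
    have e1 : ((i : ℝ) + 1) ^ (-1 - 2 * (q + β))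
        = ((i : ℝ) + 1) ^ (-1 - 2 * q) * (((i : ℝ) + 1) ^ (-β)) ^ 2 := by
      rw [← Real.rpow_natCast (_ ^ (-β)), ← Real.rpow_mul hj.le, ← Real.rpow_add hj]
      congr 1; push_cast; ring
    rw [div_pow, mul_pow, M.sq_L, e1]
    ring
  obtain ⟨a, ha⟩ := exists_inner_basis_eq e
    (c := fun i => L (e i) * ((i : ℝ) + 1) ^ (-β) / (1 + signal κ α n τ i))
    (by simpa only [hsq] using hs)
  have hnorm : ‖a‖ ^ 2 = ∑' i : ℕ, S (i + 1) ^ 2 * ((i : ℝ) + 1) ^ (-1 - 2 * (q + β))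
      / (1 + signal κ α n τ i) ^ 2 := by
    have h := hasSum_sq_inner_basis e a
    simp only [ha, hsq] at h
    exact h.tsum_eq.symm
  have hb2 : biasTerm S α β p q n τ ^ 2 = (rho α p n τ ^ (-min (q + β) (1 + 2 * α + 2 * p))
      * biasShape S (q + β) (1 + 2 * α + 2 * p) (rho α p n τ)) ^ 2 := by
    rw [hbt, mul_pow, mul_pow, sq_abs]
  have hb0 : 0 ≤ biasTerm S α β p q n τ := by
    rw [hbt]
    exact mul_nonneg (Real.rpow_nonneg (rho_pos hn hτ).le _) (abs_nonneg _)
  rw [← hnorm, ← hb2] at hlo hup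
  refine ⟨a, ha, ?_, ?_, fun μ y hy => ?_⟩
  · refine abs_le_of_sq_le_sq' ?_ (norm_nonneg _) |>.2
    rwa [mul_pow, Real.sq_sqrt hc.le]
  · refine abs_le_of_sq_le_sq' ?_ (by positivity) |>.2
    rwa [mul_pow, Real.sq_sqrt hc'.le]
  · rw [← (hasSum_inner_basis e a y).tsum_eq, spectralBias]
    refine tsum_congr fun i => ?_
    have hj : (0 : ℝ) < (i : ℝ) + 1 := by positivity
    rw [ha, hy, Real.rpow_neg hj.le]
    field_simp

theorem exists_abs_spectralBias_le (M : DiagonalModel e K Λ R κ L V S α β p q C) :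
    ∃ c t₀ : ℝ, 0 < c ∧ 1 ≤ t₀ ∧ ∀ (n : ℕ) (τ : ℝ), 0 < n → 0 < τ → t₀ ≤ rho α p n τ →
      ∀ μ, MemSobolev e β μ →
        |spectralBias e κ L α n τ μ| ≤ c * biasTerm S α β p q n τ * sobolevNorm e β μ := by
  obtain ⟨c, c', t₀, hc, hc', ht₀, h⟩ := M.exists_representer
  refine ⟨c', t₀, hc', ht₀, fun n τ hn hτ hρ μ hμ => ?_⟩
  obtain ⟨a, -, -, ha, hrep⟩ := h n τ hn hτ hρ
  obtain ⟨y, hy, hyi⟩ := hμ.exists_lift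
  rw [hrep μ y hyi, ← hy]
  exact (abs_real_inner_le_norm a y).trans (by gcongr)

theorem exists_le_abs_spectralBias (M : DiagonalModel e K Λ R κ L V S α β p q C) :
    ∃ c t₀ : ℝ, 0 < c ∧ 1 ≤ t₀ ∧ ∀ (n : ℕ) (τ : ℝ), 0 < n → 0 < τ → t₀ ≤ rho α p n τ →
      ∀ B : ℝ, 0 ≤ B → ∃ μ, MemSobolev e β μ ∧ sobolevNorm e β μ ≤ B ∧
        B * (c * biasTerm S α β p q n τ) ≤ |spectralBias e κ L α n τ μ| := by
  obtain ⟨c, c', t₀, hc, hc', ht₀, h⟩ := M.exists_representer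
  refine ⟨c, t₀, hc, ht₀, fun n τ hn hτ hρ B hB => ?_⟩
  obtain ⟨a, -, ha, -, hrep⟩ := h n τ hn hτ hρ
  -- the worst parameter is proportional to the representer of the bias
  obtain ⟨μ, hμ, hμn, hμi⟩ := exists_memSobolev_inner_eq e M.pos_β.le ((B / ‖a‖) • a)
  refine ⟨μ, hμ, ?_, ?_⟩
  · rw [hμn, norm_smul, Real.norm_of_nonneg (by positivity)]
    rcases (norm_nonneg a).eq_or_lt with h0 | h0
    · rw [← h0, mul_zero]; exact hB
    · rw [div_mul_cancel₀ _ h0.ne']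
  · rw [hrep μ ((B / ‖a‖) • a) fun i => ?_]
    · rw [inner_smul_right, real_inner_self_eq_norm_sq]
      have e1 : B / ‖a‖ * ‖a‖ ^ 2 = B * ‖a‖ := by
        rcases (norm_nonneg a).eq_or_lt with h0 | h0
        · rw [← h0]; simp
        · field_simp
      rw [e1]
      exact (by gcongr : _ ≤ B * ‖a‖).trans (le_abs_self _)
    · have hj : (0 : ℝ) < (i : ℝ) + 1 := by positivity
      rw [hμi, Real.rpow_neg hj.le]
      field_simp

/-- At a fixed parameter, the bias is of smaller order than the maximal bias, unless the latter is
saturated: the coordinates with small index contribute only `ρ ^ (-D)`, and those with large index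
have a small Sobolev norm. -/
theorem exists_abs_spectralBias_le_of_lt (M : DiagonalModel e K Λ R κ L V S α β p q C)
    (hlt : q + β < 1 + 2 * α + 2 * p) {μ : E} (hμ : MemSobolev e β μ) {η : ℝ} (hη : 0 < η) :
    ∃ t₀ : ℝ, 1 ≤ t₀ ∧ ∀ (n : ℕ) (τ : ℝ), 0 < n → 0 < τ → t₀ ≤ rho α p n τ →
        |spectralBias e κ L α n τ μ| ≤ η * biasTerm S α β p q n τ := by
  have hC : 0 < C := by linarith [M.one_le_C]
  have hD := M.D_pos
  obtain ⟨c, c', t₁, hc, hc', ht₁, h₁⟩ := M.exists_representer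
  set D := 1 + 2 * α + 2 * p with hDdef
  obtain ⟨y, -, hyi⟩ := hμ.exists_lift
  have htail := (e.hasSum_repr y).tendsto_sum_nat
  rw [Metric.tendsto_atTop] at htail
  obtain ⟨m, hm⟩ := htail (η / (2 * c')) (by positivity)
  have hm := hm m le_rfl
  set y₁ := ∑ i ∈ Finset.range m, e.repr y i • e i with hy₁
  rw [dist_eq_norm, norm_sub_rev] at hm
  set B := ∑ i ∈ Finset.range m, |e.repr y i| * (|L (e i)| * ((i : ℝ) + 1) ^ (-β)
    * (C ^ 2 * ((i : ℝ) + 1) ^ D)) with hB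
  have hB0 : 0 ≤ B := Finset.sum_nonneg fun i _ => by positivity
  obtain ⟨A, t₂, hA, ht₂, h₂⟩ := M.potter ((D - (q + β)) / 2) (by linarith)
  have hS2 := (h₂ t₂ t₂ le_rfl le_rfl).1
  have hlim : Tendsto (fun ρ : ℝ => η / 2 * (S t₂ / A) * ρ ^ ((D - (q + β)) / 2)) atTop atTop :=
    (tendsto_rpow_atTop (by linarith)).const_mul_atTop (by positivity)
  obtain ⟨t₃, ht₃⟩ := eventually_atTop.1 (hlim.eventually_ge_atTop B)
  refine ⟨max t₁ (max t₂ t₃), ht₁.trans (le_max_left _ _), fun n τ hn hτ hρ => ?_⟩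
  have hρ1 : t₁ ≤ rho α p n τ := (le_max_left _ _).trans hρ
  have hρ2 : t₂ ≤ rho α p n τ := ((le_max_left _ _).trans (le_max_right _ _)).trans hρ
  have hρ3 : t₃ ≤ rho α p n τ := ((le_max_right _ _).trans (le_max_right _ _)).trans hρ
  obtain ⟨a, ha, -, han, hrep⟩ := h₁ n τ hn hτ hρ1
  have hb := M.signal_bounds hn hτ
  have hbt := biasTerm_eq (S := S) (q := q) (β := β) M.D_pos hn hτ
  rw [← hDdef] at hb hbt
  have hρ0 : 0 < rho α p n τ := rho_pos hn hτ
  obtain ⟨-, -, hs⟩ := h₂ t₂ _ le_rfl hρ2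
  have hBle := ht₃ _ hρ3
  set ρ := rho α p n τ with hρdef
  have hSρ := (h₂ ρ ρ hρ2 le_rfl).1
  rw [min_eq_left hlt.le] at hbt
  simp only [biasShape, hlt, if_true] at hbt
  rw [abs_of_pos hSρ] at hbt
  -- small indices
  have hhead : |inner ℝ a y₁| ≤ B * ρ ^ (-D) := by
    rw [hy₁, inner_sum, hB, Finset.sum_mul]
    refine (Finset.abs_sum_le_sum_abs _ _).trans (Finset.sum_le_sum fun i _ => ?_)
    have hj : (0 : ℝ) < (i : ℝ) + 1 := by positivity
    have hx := (hb i).1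
    have hx0 := signal_nonneg κ α n τ i
    have hxl : (C ^ 2)⁻¹ * (ρ ^ D / ((i : ℝ) + 1) ^ D) ≤ 1 + signal κ α n τ i := by
      rw [← Real.div_rpow hρ0.le hj.le]; linarith
    rw [inner_smul_right, real_inner_comm, ha, abs_mul, abs_div, abs_mul,
      abs_of_nonneg (Real.rpow_nonneg hj.le (-β)),
      abs_of_pos (by linarith : 0 < 1 + signal κ α n τ i), mul_assoc |e.repr y i|]
    gcongr
    calc |L (e i)| * ((i : ℝ) + 1) ^ (-β) / (1 + signal κ α n τ i)
        ≤ |L (e i)| * ((i : ℝ) + 1) ^ (-β) / ((C ^ 2)⁻¹ * (ρ ^ D / ((i : ℝ) + 1) ^ D)) := by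
          gcongr
      _ = _ := by
          rw [Real.rpow_neg hρ0.le D]
          field_simp
  have hsmall : B * ρ ^ (-D) ≤ η / 2 * biasTerm S α β p q n τ := by
    have h5 : (ρ / t₂) ^ ((D - (q + β)) / 2) ≤ ρ ^ ((D - (q + β)) / 2) :=
      Real.rpow_le_rpow (by positivity) (div_le_self hρ0.le ht₂) (by linarith)
    have h6 : S t₂ / A ≤ ρ ^ ((D - (q + β)) / 2) * S ρ := by
      rw [div_le_iff₀ (by linarith)]
      calc S t₂ ≤ A * (ρ / t₂) ^ ((D - (q + β)) / 2) * S ρ := hs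
        _ ≤ A * ρ ^ ((D - (q + β)) / 2) * S ρ := by gcongr
        _ = _ := by ring
    rw [hbt]
    calc B * ρ ^ (-D)
        ≤ η / 2 * (S t₂ / A) * ρ ^ ((D - (q + β)) / 2) * ρ ^ (-D) := by gcongr
      _ ≤ η / 2 * (ρ ^ ((D - (q + β)) / 2) * S ρ) * ρ ^ ((D - (q + β)) / 2) * ρ ^ (-D) := by
          gcongr
      _ = η / 2 * (ρ ^ (-(q + β)) * S ρ) := by
          have : ρ ^ (-(q + β))
              = ρ ^ ((D - (q + β)) / 2) * ρ ^ ((D - (q + β)) / 2) * ρ ^ (-D) := by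
            rw [← Real.rpow_add hρ0, ← Real.rpow_add hρ0]; congr 1; ring
          rw [this]; ring
  have hbt0 : 0 ≤ biasTerm S α β p q n τ := by rw [hbt]; positivity
  -- large indices
  have htl : |inner ℝ a (y - y₁)| ≤ η / 2 * biasTerm S α β p q n τ := by
    refine (abs_real_inner_le_norm _ _).trans ?_
    calc ‖a‖ * ‖y - y₁‖ ≤ c' * biasTerm S α β p q n τ * (η / (2 * c')) := by gcongr
      _ = _ := by field_simp
  rw [hrep μ y hyi]
  have e1 : inner ℝ a y = inner ℝ a y₁ + inner ℝ a (y - y₁) := by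
    rw [← inner_add_right, add_sub_cancel]
  rw [e1]
  refine (abs_add_le _ _).trans ?_
  linarith

/-- A fixed parameter at which the bias is smaller than the maximal bias by at most a small power
of `ρ`. -/
theorem exists_fixed_spectralBias_ge (M : DiagonalModel e K Λ R κ L V S α β p q C) {ε : ℝ}
    (hε : 0 < ε) :
    ∃ μ, MemSobolev e β μ ∧ ∃ c t₀ : ℝ, 0 < c ∧ 1 ≤ t₀ ∧
      ∀ (n : ℕ) (τ : ℝ), 0 < n → 0 < τ → t₀ ≤ rho α p n τ →
        c * (rho α p n τ ^ (-ε) * biasTerm S α β p q n τ) ≤ |spectralBias e κ L α n τ μ| := by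
  have hC : 0 < C := by linarith [M.one_le_C]
  -- signs that make all terms of the bias nonnegative
  set sg : ℕ → ℝ := fun i => if L (e i) < 0 then -1 else 1 with hsg
  have hsg2 : ∀ i, sg i ^ 2 = 1 := fun i => by simp only [hsg]; split_ifs <;> norm_num
  have hsgL : ∀ i, L (e i) * sg i = |L (e i)| := fun i => by
    simp only [hsg]
    split_ifs with h
    · rw [abs_of_neg h]; ring
    · rw [abs_of_nonneg (not_lt.1 h), mul_one]
  obtain ⟨y, hy⟩ := exists_inner_basis_eq e
    (c := fun i : ℕ => sg i * ((i : ℝ) + 1) ^ (-(1 / 2) - ε)) (by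
      refine (summable_rpow_add_one (s := -1 - 2 * ε) (by linarith)).congr fun i => ?_
      rw [mul_pow, hsg2, one_mul, ← Real.rpow_natCast (_ ^ (_ : ℝ)),
        ← Real.rpow_mul (by positivity)]
      congr 1; push_cast; ring)
  obtain ⟨μ, hμ, -, hμi⟩ := exists_memSobolev_inner_eq e M.pos_β.le y
  obtain ⟨c, t₁, hc, ht₁, h₁⟩ := M.potter.exists_fixedBias_ge M.S_nonneg M.qβ_pos
    M.D_pos (C := C ^ 2) (by positivity) hε
  obtain ⟨t₂, ht₂, h₂⟩ := (M.potter.biasShape M.S_nonneg (q + β)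
    (1 + 2 * α + 2 * p)).eventually_pos
  refine ⟨μ, hμ, c, max t₁ t₂, hc, ht₁.trans (le_max_left _ _), fun n τ hn hτ hρ => ?_⟩
  have h3 := (h₁ _ ((le_max_left _ _).trans hρ) (signal κ α n τ) fun i =>
    ⟨signal_nonneg κ α n τ i, (M.signal_bounds hn hτ i).2⟩).2
  rw [biasTerm_eq M.D_pos hn hτ, abs_of_pos (h₂ _ ((le_max_right _ _).trans hρ))]
  refine h3.trans ((le_of_eq ?_).trans (le_abs_self _))
  refine tsum_congr fun i => ?_
  have hj : (0 : ℝ) < (i : ℝ) + 1 := by positivity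
  congr 1
  rw [hμi, hy]
  have e1 : L (e i) * (sg i * ((i : ℝ) + 1) ^ (-(1 / 2) - ε) * ((i : ℝ) + 1) ^ (-β))
      = (L (e i) * sg i) * (((i : ℝ) + 1) ^ (-(1 / 2) - ε) * ((i : ℝ) + 1) ^ (-β)) := by ring
  rw [e1, hsgL, M.abs_L, mul_comm (_ ^ (-q - 1 / 2)), mul_assoc, ← Real.rpow_add hj,
    ← Real.rpow_add hj]
  congr 2
  ring

end DiagonalModel

/-! ### The coverage in terms of the quotient of bias and spread -/

theorem IsScaling.eventually {τ : ℕ → ℝ} (hτ : IsScaling τ) {α p : ℝ}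
    (hD : 0 < 1 + 2 * α + 2 * p) (t₀ : ℝ) :
    ∀ᶠ n : ℕ in atTop, 0 < n ∧ 0 < τ n ∧ t₀ ≤ rho α p n (τ n) := by
  filter_upwards [eventually_gt_atTop 0, (tendsto_rho hD hτ).eventually_ge_atTop t₀] with n hn hρ
  exact ⟨hn, hτ.1 n hn, hρ⟩

theorem coverage_nonneg {E F Ω : Type*}
    [NormedAddCommGroup E] [InnerProductSpace ℝ E] [CompleteSpace E]
    [NormedAddCommGroup F] [InnerProductSpace ℝ F] [CompleteSpace F] [MeasurableSpace Ω]
    (P : Measure Ω) (Z : F → Ω → ℝ) (e : HilbertBasis ℕ ℝ E) (K : E →L[ℝ] F) (Λ R : E →L[ℝ] E)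
    (L : E → ℝ) (γ : ℝ) (n : ℕ) (τ : ℝ) (μ : E) : 0 ≤ coverage P Z e K Λ R L γ n τ μ :=
  measureReal_nonneg

theorem exists_normalCDF_sub_le (W : ℝ) {η : ℝ} (hη : 0 < η) :
    ∃ B : ℝ, 0 < B ∧ normalCDF (W - B) ≤ η := by
  have h1 : Tendsto (fun B : ℝ => W - B) atTop atBot := by
    simpa only [sub_eq_add_neg] using tendsto_atBot_add_const_left atTop W tendsto_neg_atTop_atBot
  obtain ⟨B, h2, h3⟩ := (((tendsto_normalCDF_atBot.comp h1).eventually (gt_mem_nhds hη)).and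
    (eventually_gt_atTop 0)).exists
  exact ⟨B, h3, h2.le⟩

theorem memSobolev_zero {E : Type*} [NormedAddCommGroup E] [InnerProductSpace ℝ E]
    (e : HilbertBasis ℕ ℝ E) (β : ℝ) : MemSobolev e β 0 ∧ sobolevNorm e β 0 = 0 := by
  simp [MemSobolev, sobolevNorm, summable_zero]

namespace DiagonalModel

variable {E F Ω : Type*}
  [NormedAddCommGroup E] [InnerProductSpace ℝ E] [CompleteSpace E]
  [MeasurableSpace E]
  [NormedAddCommGroup F] [InnerProductSpace ℝ F] [CompleteSpace F] [MeasurableSpace Ω]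
  {P : Measure Ω} {Z : F → Ω → ℝ}
  {e : HilbertBasis ℕ ℝ E} {K : E →L[ℝ] F} {Λ R : E →L[ℝ] E} {κ : ℕ → ℝ}
  {L : E → ℝ} {V : Submodule ℝ E} {S : ℝ → ℝ} {α β p q C γ : ℝ} {τ : ℕ → ℝ}

/-- If the bias is negligible, the interval has excess coverage. -/
theorem unifAsympIn_of_isLittleO [BorelSpace E] (M : DiagonalModel e K Λ R κ L V S α β p q C)
    (hZ : IsIsoGaussian Z P) (hγ0 : 0 < γ) (hγ1 : γ < 1) (hτ : IsScaling τ)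
    (h : (fun n => biasTerm S α β p q n (τ n)) =o[atTop] fun n => spreadTerm S α p q n (τ n)) :
    UnifAsympIn (fun n μ => coverage P Z e K Λ R L γ n (τ n) μ)
      {μ | MemSobolev e β μ ∧ sobolevNorm e β μ ≤ 1} (1 - γ) 1 := by
  obtain ⟨r, W, c, c', t₁, hr, hc, hc', ht₁, h₁⟩ := M.exists_coverage_eq hZ hγ0 hγ1
  obtain ⟨A, t₂, hA, ht₂, h₂⟩ := M.exists_abs_spectralBias_le
  obtain ⟨t₃, ht₃, h₃⟩ := exists_terms_pos (β := β) M.potter M.S_nonneg M.D_pos M.lt_p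
  obtain ⟨δ, a, b, hδ, ha, hb, hcov⟩ := exists_shiftedCoverage_mem hγ0 hγ1 (V := W) hr
  refine ⟨a, b, ha, hb, ?_⟩
  filter_upwards [hτ.eventually M.D_pos t₁, hτ.eventually M.D_pos t₂, hτ.eventually M.D_pos t₃,
    h.bound (show 0 < δ * c / A by positivity)] with n h4 h5 h6 h7 μ hμ
  obtain ⟨t, v, ht, hct, -, hv, hvW, heq⟩ := h₁ n _ h4.1 h4.2.1 h4.2.2
  obtain ⟨pb, ps⟩ := h₃ n _ h6.1 h6.2.1 h6.2.2
  rw [Real.norm_of_nonneg pb.le, Real.norm_of_nonneg ps.le] at h7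
  rw [heq μ hμ.1]
  refine hcov _ _ ?_ hv hvW
  rw [abs_neg, abs_div, abs_of_pos ht, div_le_iff₀ ht]
  calc |spectralBias e κ L α n (τ n) μ|
      ≤ A * biasTerm S α β p q n (τ n) * sobolevNorm e β μ :=
        h₂ n _ h5.1 h5.2.1 h5.2.2 μ hμ.1
    _ ≤ A * (δ * c / A * spreadTerm S α p q n (τ n)) * 1 := by
        gcongr
        · exact Real.sqrt_nonneg _
        · exact hμ.2
    _ = δ * (c * spreadTerm S α p q n (τ n)) := by field_simp
    _ ≤ δ * t := by gcongr

/-- Even if the maximal bias is of the order of the spread, the bias at a fixed parameter is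
negligible, unless the bias is saturated. -/
theorem asympIn_of_isBigO [BorelSpace E] (M : DiagonalModel e K Λ R κ L V S α β p q C)
    (hZ : IsIsoGaussian Z P) (hγ0 : 0 < γ) (hγ1 : γ < 1) (hτ : IsScaling τ)
    (h : (fun n => biasTerm S α β p q n (τ n)) =O[atTop] fun n => spreadTerm S α p q n (τ n))
    (hlt : q + β < 1 + 2 * α + 2 * p) {μ : E} (hμ : MemSobolev e β μ) :
    AsympIn (fun n => coverage P Z e K Λ R L γ n (τ n) μ) (1 - γ) 1 := by
  obtain ⟨r, W, c, c', t₁, hr, hc, hc', ht₁, h₁⟩ := M.exists_coverage_eq hZ hγ0 hγ1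
  obtain ⟨B, hB, hbig⟩ := h.exists_pos
  obtain ⟨t₃, ht₃, h₃⟩ := exists_terms_pos (β := β) M.potter M.S_nonneg M.D_pos M.lt_p
  obtain ⟨δ, a, b, hδ, ha, hb, hcov⟩ := exists_shiftedCoverage_mem hγ0 hγ1 (V := W) hr
  obtain ⟨t₂, ht₂, h₂⟩ := M.exists_abs_spectralBias_le_of_lt hlt hμ
    (show 0 < δ * c / B by positivity)
  refine ⟨a, b, ha, hb, ?_⟩
  filter_upwards [hτ.eventually M.D_pos t₁, hτ.eventually M.D_pos t₂, hτ.eventually M.D_pos t₃,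
    hbig.bound] with n h4 h5 h6 h7
  obtain ⟨t, v, ht, hct, -, hv, hvW, heq⟩ := h₁ n _ h4.1 h4.2.1 h4.2.2
  obtain ⟨pb, ps⟩ := h₃ n _ h6.1 h6.2.1 h6.2.2
  rw [Real.norm_of_nonneg pb.le, Real.norm_of_nonneg ps.le] at h7
  rw [heq μ hμ]
  refine hcov _ _ ?_ hv hvW
  rw [abs_neg, abs_div, abs_of_pos ht, div_le_iff₀ ht]
  calc |spectralBias e κ L α n (τ n) μ|
      ≤ δ * c / B * biasTerm S α β p q n (τ n) := h₂ n _ h5.1 h5.2.1 h5.2.2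
    _ ≤ δ * c / B * (B * spreadTerm S α p q n (τ n)) := by gcongr
    _ = δ * (c * spreadTerm S α p q n (τ n)) := by field_simp
    _ ≤ δ * t := by gcongr

/-- Worst parameters in a Sobolev ball of radius `B`, one for each `n`. -/
theorem exists_seq_le_abs_spectralBias (M : DiagonalModel e K Λ R κ L V S α β p q C)
    (τ : ℕ → ℝ) :
    ∃ c t₀ : ℝ, 0 < c ∧ 1 ≤ t₀ ∧ ∀ B : ℝ, 0 ≤ B → ∃ μ : ℕ → E,
      (∀ n, MemSobolev e β (μ n) ∧ sobolevNorm e β (μ n) ≤ B) ∧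
      ∀ n, 0 < n → 0 < τ n → t₀ ≤ rho α p n (τ n) →
        B * (c * biasTerm S α β p q n (τ n)) ≤ |spectralBias e κ L α n (τ n) (μ n)| := by
  obtain ⟨c, t₀, hc, ht₀, h⟩ := M.exists_le_abs_spectralBias
  refine ⟨c, t₀, hc, ht₀, fun B hB => ?_⟩
  have key : ∀ n : ℕ, ∃ μ : E, (MemSobolev e β μ ∧ sobolevNorm e β μ ≤ B) ∧
      (0 < n → 0 < τ n → t₀ ≤ rho α p n (τ n) →
        B * (c * biasTerm S α β p q n (τ n)) ≤ |spectralBias e κ L α n (τ n) μ|) := by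
    intro n
    by_cases hn : 0 < n ∧ 0 < τ n ∧ t₀ ≤ rho α p n (τ n)
    · obtain ⟨μ, h1, h2, h3⟩ := h n (τ n) hn.1 hn.2.1 hn.2.2 B hB
      exact ⟨μ, ⟨h1, h2⟩, fun _ _ _ => h3⟩
    · obtain ⟨h1, h2⟩ := memSobolev_zero e β
      exact ⟨0, ⟨h1, h2.trans_le hB⟩, fun a b c => absurd ⟨a, b, c⟩ hn⟩
  choose μ h1 h2 using key
  exact ⟨μ, h1, h2⟩

/-- If maximal bias and spread are comparable, the coverage is made arbitrarily small by the worst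
parameters in a large Sobolev ball. It stays bounded away from zero, as the quotient of bias and
spread is bounded over the ball. -/
theorem exists_asympIn_of_isTheta [BorelSpace E] (M : DiagonalModel e K Λ R κ L V S α β p q C)
    (hZ : IsIsoGaussian Z P) (hγ0 : 0 < γ) (hγ1 : γ < 1) (hτ : IsScaling τ)
    (h : (fun n => biasTerm S α β p q n (τ n)) =Θ[atTop] fun n => spreadTerm S α p q n (τ n))
    {c₀ : ℝ} (hc₀ : 0 < c₀) :
    ∃ μ : ℕ → E, BddSobolevSeq e β μ ∧
      AsympIn (fun n => coverage P Z e K Λ R L γ n (τ n) (μ n)) 0 c₀ := by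
  obtain ⟨r, W, c, c', t₁, hr, hc, hc', ht₁, h₁⟩ := M.exists_coverage_eq hZ hγ0 hγ1
  obtain ⟨A, t₂, hA, ht₂, h₂⟩ := M.exists_abs_spectralBias_le
  obtain ⟨t₃, ht₃, h₃⟩ := exists_terms_pos (β := β) M.potter M.S_nonneg M.D_pos M.lt_p
  obtain ⟨A', t₄, hA', ht₄, h₄⟩ := M.exists_seq_le_abs_spectralBias τ
  obtain ⟨B₁, hB₁, hbig₁⟩ := h.1.exists_pos
  obtain ⟨B₂, hB₂, hbig₂⟩ := h.2.exists_pos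
  obtain ⟨w, hw0, hw⟩ := exists_normalCDF_sub_le W (half_pos hc₀)
  have hz0 : 0 < -normalQuantile (γ / 2) := by have := normalQuantile_neg hγ0 hγ1; linarith
  -- the radius that makes the bias at least `w` times the standard deviation
  set B := w * c' * B₂ / A' with hB
  have hB0 : 0 < B := by positivity
  obtain ⟨μ, hμ, hμb⟩ := h₄ B hB0.le
  obtain ⟨a, ha, hcov⟩ := exists_le_shiftedCoverage hz0 (A * B₁ * B / c)
  refine ⟨μ, ⟨B, hμ⟩, a, c₀ / 2, ha, by linarith, ?_⟩
  filter_upwards [hτ.eventually M.D_pos t₁, hτ.eventually M.D_pos t₂, hτ.eventually M.D_pos t₃,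
    hτ.eventually M.D_pos t₄, hbig₁.bound, hbig₂.bound] with n h5 h6 h7 h8 h9 h10
  obtain ⟨t, v, ht, hct, hct', hv, hvW, heq⟩ := h₁ n _ h5.1 h5.2.1 h5.2.2
  obtain ⟨pb, ps⟩ := h₃ n _ h7.1 h7.2.1 h7.2.2
  rw [Real.norm_of_nonneg pb.le, Real.norm_of_nonneg ps.le] at h9 h10
  have hup := h₂ n _ h6.1 h6.2.1 h6.2.2 (μ n) (hμ n).1
  have hlo := hμb n h8.1 h8.2.1 h8.2.2
  rw [heq _ (hμ n).1]
  constructor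
  · refine hcov _ _ ?_ (le_trans (le_mul_of_one_le_left hz0.le hr.le) hv)
    rw [abs_neg, abs_div, abs_of_pos ht, div_le_iff₀ ht]
    calc |spectralBias e κ L α n (τ n) (μ n)|
        ≤ A * biasTerm S α β p q n (τ n) * sobolevNorm e β (μ n) := hup
      _ ≤ A * (B₁ * spreadTerm S α p q n (τ n)) * B := by
          gcongr
          · exact Real.sqrt_nonneg _
          · exact (hμ n).2
      _ = A * B₁ * B / c * (c * spreadTerm S α p q n (τ n)) := by field_simp
      _ ≤ A * B₁ * B / c * t := by gcongr
  · refine (shiftedCoverage_le hvW ?_).trans hw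
    rw [abs_neg, abs_div, abs_of_pos ht, le_div_iff₀ ht]
    calc w * t ≤ w * (c' * (B₂ * biasTerm S α β p q n (τ n))) := by
          gcongr
          exact hct'.trans (by gcongr)
      _ = B * (A' * biasTerm S α β p q n (τ n)) := by rw [hB]; field_simp
      _ ≤ _ := hlo

/-- If the bias dominates the spread along a sequence of parameters, then the coverage tends to
zero. -/
theorem tendsto_coverage_zero [BorelSpace E] (M : DiagonalModel e K Λ R κ L V S α β p q C)
    (hZ : IsIsoGaussian Z P) (hγ0 : 0 < γ) (hγ1 : γ < 1) (hτ : IsScaling τ) {μ : ℕ → E}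
    (hμ : ∀ n, MemSobolev e β (μ n))
    (h : (fun n => spreadTerm S α p q n (τ n)) =o[atTop]
      fun n => spectralBias e κ L α n (τ n) (μ n)) :
    Tendsto (fun n => coverage P Z e K Λ R L γ n (τ n) (μ n)) atTop (𝓝 0) := by
  obtain ⟨r, W, c, c', t₁, hr, hc, hc', ht₁, h₁⟩ := M.exists_coverage_eq hZ hγ0 hγ1
  obtain ⟨t₃, ht₃, h₃⟩ := exists_terms_pos (β := β) M.potter M.S_nonneg M.D_pos M.lt_p
  rw [Metric.tendsto_atTop']
  intro η hη
  obtain ⟨w, hw0, hw⟩ := exists_normalCDF_sub_le W (half_pos hη)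
  have hev : ∀ᶠ n in atTop, dist (coverage P Z e K Λ R L γ n (τ n) (μ n)) 0 < η := by
    filter_upwards [hτ.eventually M.D_pos t₁, hτ.eventually M.D_pos t₃,
      h.bound (show 0 < (w * c')⁻¹ by positivity)] with n h5 h7 h9
    obtain ⟨t, v, ht, hct, hct', hv, hvW, heq⟩ := h₁ n _ h5.1 h5.2.1 h5.2.2
    obtain ⟨pb, ps⟩ := h₃ n _ h7.1 h7.2.1 h7.2.2
    rw [Real.norm_of_nonneg ps.le, Real.norm_eq_abs, inv_mul_eq_div,
      le_div_iff₀ (by positivity)] at h9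
    rw [Real.dist_0_eq_abs, abs_of_nonneg (coverage_nonneg P Z e K Λ R L γ n (τ n) (μ n)),
      heq _ (hμ n)]
    refine lt_of_le_of_lt ((shiftedCoverage_le hvW ?_).trans hw) (by linarith)
    rw [abs_neg, abs_div, abs_of_pos ht, le_div_iff₀ ht]
    calc w * t ≤ w * (c' * spreadTerm S α p q n (τ n)) := by gcongr
      _ = spreadTerm S α p q n (τ n) * (w * c') := by ring
      _ ≤ _ := h9
  obtain ⟨N, hN⟩ := eventually_atTop.1 hev
  exact ⟨N, fun n hn => hN n hn.le⟩

theorem exists_tendsto_zero_of_isLittleO [BorelSpace E]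
    (M : DiagonalModel e K Λ R κ L V S α β p q C)
    (hZ : IsIsoGaussian Z P) (hγ0 : 0 < γ) (hγ1 : γ < 1) (hτ : IsScaling τ)
    (h : (fun n => spreadTerm S α p q n (τ n)) =o[atTop] fun n => biasTerm S α β p q n (τ n)) :
    ∃ μ : ℕ → E, BddSobolevSeq e β μ ∧
      Tendsto (fun n => coverage P Z e K Λ R L γ n (τ n) (μ n)) atTop (𝓝 0) := by
  obtain ⟨A', t₄, hA', ht₄, h₄⟩ := M.exists_seq_le_abs_spectralBias τ
  obtain ⟨t₃, ht₃, h₃⟩ := exists_terms_pos (β := β) M.potter M.S_nonneg M.D_pos M.lt_p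
  obtain ⟨μ, hμ, hμb⟩ := h₄ 1 zero_le_one
  refine ⟨μ, ⟨1, hμ⟩, M.tendsto_coverage_zero hZ hγ0 hγ1 hτ (fun n => (hμ n).1)
    (h.trans_isBigO (IsBigO.of_bound A'⁻¹ ?_))⟩
  filter_upwards [hτ.eventually M.D_pos t₃, hτ.eventually M.D_pos t₄] with n h7 h8
  have pb := (h₃ n _ h7.1 h7.2.1 h7.2.2).1
  have := hμb n h8.1 h8.2.1 h8.2.2
  rw [one_mul] at this
  rw [Real.norm_of_nonneg pb.le, Real.norm_eq_abs, inv_mul_eq_div, le_div_iff₀ hA']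
  linarith

theorem exists_fixed_tendsto_zero [BorelSpace E] (M : DiagonalModel e K Λ R κ L V S α β p q C)
    (hZ : IsIsoGaussian Z P) (hγ0 : 0 < γ) (hγ1 : γ < 1) (hτ : IsScaling τ) {ε : ℝ} (hε : 0 < ε)
    (h : (fun n => rho α p n (τ n) ^ ε * spreadTerm S α p q n (τ n)) =O[atTop]
      fun n => biasTerm S α β p q n (τ n)) :
    ∃ μ : E, MemSobolev e β μ ∧
      Tendsto (fun n => coverage P Z e K Λ R L γ n (τ n) μ) atTop (𝓝 0) := by
  obtain ⟨μ, hμ, c, t₄, hc, ht₄, h₄⟩ := M.exists_fixed_spectralBias_ge (half_pos hε)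
  obtain ⟨t₃, ht₃, h₃⟩ := exists_terms_pos (β := β) M.potter M.S_nonneg M.D_pos M.lt_p
  obtain ⟨B, hB, hbig⟩ := h.exists_pos
  refine ⟨μ, hμ, M.tendsto_coverage_zero hZ hγ0 hγ1 hτ (fun _ => hμ) (IsLittleO.of_bound ?_)⟩
  intro η hη
  have hlim : Tendsto (fun n => η * c * rho α p n (τ n) ^ (ε / 2)) atTop atTop :=
    ((tendsto_rpow_atTop (half_pos hε)).comp (tendsto_rho M.D_pos hτ)).const_mul_atTop
      (by positivity)
  filter_upwards [hτ.eventually M.D_pos t₃, hτ.eventually M.D_pos t₄, hbig.bound,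
    hlim.eventually_ge_atTop B] with n h7 h8 h9 h10
  obtain ⟨pb, ps⟩ := h₃ n _ h7.1 h7.2.1 h7.2.2
  have hρ0 : 0 < rho α p n (τ n) := rho_pos h7.1 h7.2.1
  have h11 := h₄ n _ h8.1 h8.2.1 h8.2.2
  rw [Real.norm_of_nonneg (by positivity), Real.norm_of_nonneg pb.le] at h9
  rw [Real.norm_of_nonneg ps.le, Real.norm_eq_abs]
  refine le_trans ?_ (mul_le_mul_of_nonneg_left h11 hη.le)
  set ρ := rho α p n (τ n)
  set b := biasTerm S α β p q n (τ n)
  set s := spreadTerm S α p q n (τ n)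
  have h12 : ρ ^ ε * s ≤ ρ ^ ε * (η * (c * (ρ ^ (-(ε / 2)) * b))) := by
    calc ρ ^ ε * s ≤ B * b := h9
      _ ≤ η * c * ρ ^ (ε / 2) * b := by gcongr
      _ = _ := by
        have : ρ ^ (ε / 2) = ρ ^ ε * ρ ^ (-(ε / 2)) := by
          rw [← Real.rpow_add hρ0]; congr 1; ring
        rw [this]; ring
  exact le_of_mul_le_mul_left h12 (by positivity)

end DiagonalModel

/-! ### Comparison with an optimal scaling -/

section Compare

variable {S : ℝ → ℝ} {α β p q : ℝ} {τ τ' : ℕ → ℝ}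

theorem IsScaling.one : IsScaling fun _ => 1 :=
  ⟨fun _ _ => one_pos, by simpa using tendsto_natCast_atTop_atTop⟩

theorem tendsto_div_rpow_of_isLittleO (h : τ =o[atTop] τ') {a : ℝ} (ha : 0 < a) :
    Tendsto (fun n => (τ n / τ' n) ^ a) atTop (𝓝 0) := by
  have := h.tendsto_div_nhds_zero.rpow_const (p := a) (Or.inr ha.le)
  rwa [Real.zero_rpow ha.ne'] at this

theorem IsScaling.eventually_le (hτ : IsScaling τ) (hτ' : IsScaling τ') (h : τ =o[atTop] τ') :
    ∀ᶠ n in atTop, τ n ≤ τ' n := by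
  filter_upwards [h.bound one_pos, eventually_ge_atTop 1] with n hn h1
  rwa [Real.norm_of_nonneg (hτ.1 n h1).le, Real.norm_of_nonneg (hτ'.1 n h1).le, one_mul] at hn

/-- Above a scaling at which the bias is at most of the order of the spread, it is negligible. -/
theorem bias_isLittleO_spread (hS : PotterBounded S) (h0 : ∀ i : ℕ, 0 ≤ S (i + 1))
    (hD : 0 < 1 + 2 * α + 2 * p) (hqp : q < p) (hqβ : 0 < q + β) (hτ : IsScaling τ)
    (hτ' : IsScaling τ') (h : τ =o[atTop] τ')
    (hb : (fun n => biasTerm S α β p q n (τ n)) =O[atTop] fun n => spreadTerm S α p q n (τ n)) :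
    (fun n => biasTerm S α β p q n (τ' n)) =o[atTop] fun n => spreadTerm S α p q n (τ' n) := by
  obtain ⟨a, b, C, t₁, ha, hb', hC, ht₁, h₁⟩ := exists_terms_compare hS h0 hD hqp hqβ
  obtain ⟨t₂, ht₂, h₂⟩ := exists_terms_pos (β := β) hS h0 hD hqp
  obtain ⟨B, hB, hbig⟩ := hb.exists_pos
  refine IsLittleO.of_bound fun η hη => ?_
  have hlim := ((tendsto_div_rpow_of_isLittleO h ha).const_mul (C * B)).eventually
    (gt_mem_nhds (show C * B * 0 < η by simpa using hη))
  filter_upwards [hτ.eventually hD t₁, hτ.eventually hD t₂, hτ'.eventually hD t₂, hlim,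
    hbig.bound, hτ.eventually_le hτ' h] with n h3 h4 h5 h6 h7 h8
  obtain ⟨pb, ps⟩ := h₂ n _ h4.1 h4.2.1 h4.2.2
  obtain ⟨pb', ps'⟩ := h₂ n _ h5.1 h5.2.1 h5.2.2
  have h9 := (h₁ n _ _ h3.1 h3.2.1 h8 h3.2.2).1
  rw [Real.norm_of_nonneg pb.le, Real.norm_of_nonneg ps.le] at h7
  rw [Real.norm_of_nonneg pb'.le, Real.norm_of_nonneg ps'.le]
  have hr : 0 ≤ (τ n / τ' n) ^ a := Real.rpow_nonneg (div_nonneg h3.2.1.le h5.2.1.le) _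
  refine le_of_mul_le_mul_right (h9.trans ?_) ps
  calc C * (τ n / τ' n) ^ a * (biasTerm S α β p q n (τ n) * spreadTerm S α p q n (τ' n))
      ≤ C * (τ n / τ' n) ^ a * (B * spreadTerm S α p q n (τ n) * spreadTerm S α p q n (τ' n)) := by
        gcongr
    _ = C * B * (τ n / τ' n) ^ a * (spreadTerm S α p q n (τ' n) * spreadTerm S α p q n (τ n)) := by
        ring
    _ ≤ η * (spreadTerm S α p q n (τ' n) * spreadTerm S α p q n (τ n)) := by gcongr
    _ = _ := by ring

/-- Below an optimal scaling, the quotient of spread and bias decreases as a power of the quotient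
of the scalings. -/
theorem exists_spread_le_rpow_mul_bias (hS : PotterBounded S) (h0 : ∀ i : ℕ, 0 ≤ S (i + 1))
    (hD : 0 < 1 + 2 * α + 2 * p) (hqp : q < p) (hqβ : 0 < q + β) (hτ : IsScaling τ)
    (hτ' : IsScaling τ') (h : ∀ᶠ n in atTop, τ n ≤ τ' n)
    (hb : (fun n => spreadTerm S α p q n (τ' n)) =O[atTop]
      fun n => biasTerm S α β p q n (τ' n)) :
    ∃ a B : ℝ, 0 < a ∧ 0 < B ∧ ∀ᶠ n in atTop,
      spreadTerm S α p q n (τ n) ≤ B * (τ n / τ' n) ^ a * biasTerm S α β p q n (τ n) := by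
  obtain ⟨a, b, C, t₁, ha, hb', hC, ht₁, h₁⟩ := exists_terms_compare hS h0 hD hqp hqβ
  obtain ⟨t₂, ht₂, h₂⟩ := exists_terms_pos (β := β) hS h0 hD hqp
  obtain ⟨B, hB, hbig⟩ := hb.exists_pos
  refine ⟨a, C * B, ha, by positivity, ?_⟩
  filter_upwards [hτ.eventually hD t₁, hτ.eventually hD t₂, hτ'.eventually hD t₂,
    hbig.bound, h] with n h3 h4 h5 h7 h8
  obtain ⟨pb, ps⟩ := h₂ n _ h4.1 h4.2.1 h4.2.2
  obtain ⟨pb', ps'⟩ := h₂ n _ h5.1 h5.2.1 h5.2.2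
  have h9 := (h₁ n _ _ h3.1 h3.2.1 h8 h3.2.2).1
  rw [Real.norm_of_nonneg pb'.le, Real.norm_of_nonneg ps'.le] at h7
  have hr : 0 ≤ (τ n / τ' n) ^ a := Real.rpow_nonneg (div_nonneg h3.2.1.le h5.2.1.le) _
  refine le_of_mul_le_mul_left (h9.trans ?_) pb'
  calc C * (τ n / τ' n) ^ a * (biasTerm S α β p q n (τ n) * spreadTerm S α p q n (τ' n))
      ≤ C * (τ n / τ' n) ^ a * (biasTerm S α β p q n (τ n)
        * (B * biasTerm S α β p q n (τ' n))) := by gcongr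
    _ = _ := by ring

/-- Below a scaling at which the spread is at most of the order of the bias, it is negligible. -/
theorem spread_isLittleO_bias (hS : PotterBounded S) (h0 : ∀ i : ℕ, 0 ≤ S (i + 1))
    (hD : 0 < 1 + 2 * α + 2 * p) (hqp : q < p) (hqβ : 0 < q + β) (hτ : IsScaling τ)
    (hτ' : IsScaling τ') (h : τ =o[atTop] τ')
    (hb : (fun n => spreadTerm S α p q n (τ' n)) =O[atTop]
      fun n => biasTerm S α β p q n (τ' n)) :
    (fun n => spreadTerm S α p q n (τ n)) =o[atTop] fun n => biasTerm S α β p q n (τ n) := by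
  obtain ⟨a, B, ha, hB, hle⟩ := exists_spread_le_rpow_mul_bias hS h0 hD hqp hqβ hτ hτ'
    (hτ.eventually_le hτ' h) hb
  obtain ⟨t₂, ht₂, h₂⟩ := exists_terms_pos (β := β) hS h0 hD hqp
  refine IsLittleO.of_bound fun η hη => ?_
  have hlim := ((tendsto_div_rpow_of_isLittleO h ha).const_mul B).eventually
    (gt_mem_nhds (show B * 0 < η by simpa using hη))
  filter_upwards [hτ.eventually hD t₂, hlim, hle] with n h4 h6 h7
  obtain ⟨pb, ps⟩ := h₂ n _ h4.1 h4.2.1 h4.2.2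
  rw [Real.norm_of_nonneg pb.le, Real.norm_of_nonneg ps.le]
  exact h7.trans (by gcongr)

theorem bias_isTheta_spread (hS : PotterBounded S) (h0 : ∀ i : ℕ, 0 ≤ S (i + 1))
    (hD : 0 < 1 + 2 * α + 2 * p) (hqp : q < p) (hqβ : 0 < q + β) (hτ : IsScaling τ)
    (hτ' : IsScaling τ') (h : τ =Θ[atTop] τ')
    (hb : (fun n => biasTerm S α β p q n (τ' n)) =Θ[atTop]
      fun n => spreadTerm S α p q n (τ' n)) :
    (fun n => biasTerm S α β p q n (τ n)) =Θ[atTop] fun n => spreadTerm S α p q n (τ n) := by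
  obtain ⟨a, b, C, t₁, ha, hb', hC, ht₁, h₁⟩ := exists_terms_compare hS h0 hD hqp hqβ
  obtain ⟨t₂, ht₂, h₂⟩ := exists_terms_pos (β := β) hS h0 hD hqp
  obtain ⟨B₁, hB₁, hbig₁⟩ := hb.1.exists_pos
  obtain ⟨B₂, hB₂, hbig₂⟩ := hb.2.exists_pos
  obtain ⟨A₁, hA₁, hle₁⟩ := h.1.exists_pos
  obtain ⟨A₂, hA₂, hle₂⟩ := h.2.exists_pos
  set A := max 1 (max A₁ A₂) with hA
  have hA1 : 1 ≤ A := le_max_left _ _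
  have hAb : 1 ≤ A ^ b := Real.one_le_rpow hA1 hb'.le
  -- the cross products of the terms at two comparable scalings are comparable
  have hcross : ∀ (n : ℕ) (σ σ' : ℝ), 0 < n → 0 < σ → 0 < σ' → t₁ ≤ rho α p n σ →
      t₁ ≤ rho α p n σ' → t₂ ≤ rho α p n σ → t₂ ≤ rho α p n σ' → σ ≤ A * σ' → σ' ≤ A * σ →
      biasTerm S α β p q n σ * spreadTerm S α p q n σ'
        ≤ C * A ^ b * (biasTerm S α β p q n σ' * spreadTerm S α p q n σ) := by
    intro n σ σ' hn hσ hσ' r1 r1' r2 r2' hl hl'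
    obtain ⟨pb, ps⟩ := h₂ n σ hn hσ r2
    obtain ⟨pb', ps'⟩ := h₂ n σ' hn hσ' r2'
    rcases le_total σ σ' with hs | hs
    · refine (h₁ n σ σ' hn hσ hs r1).2.trans ?_
      have : σ' / σ ≤ A := (div_le_iff₀ hσ).2 hl'
      gcongr
    · refine (h₁ n σ' σ hn hσ' hs r1').1.trans ?_
      have h3 : (σ' / σ) ^ a ≤ 1 := Real.rpow_le_one (by positivity) ((div_le_one hσ).2 hs) ha.le
      have h4 : (σ' / σ) ^ a ≤ A ^ b := h3.trans hAb
      gcongr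
  have hev : ∀ᶠ n in atTop, (0 < n ∧ 0 < τ n ∧ max t₁ t₂ ≤ rho α p n (τ n)) ∧
      (0 < n ∧ 0 < τ' n ∧ max t₁ t₂ ≤ rho α p n (τ' n)) ∧ τ n ≤ A * τ' n ∧ τ' n ≤ A * τ n ∧
      biasTerm S α β p q n (τ' n) ≤ B₁ * spreadTerm S α p q n (τ' n) ∧
      spreadTerm S α p q n (τ' n) ≤ B₂ * biasTerm S α β p q n (τ' n) := by
    filter_upwards [hτ.eventually hD (max t₁ t₂), hτ'.eventually hD (max t₁ t₂), hle₁.bound,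
      hle₂.bound, hbig₁.bound, hbig₂.bound] with n h3 h4 h5 h6 h7 h8
    obtain ⟨pb', ps'⟩ := h₂ n _ h4.1 h4.2.1 ((le_max_right _ _).trans h4.2.2)
    have p1 := h3.2.1
    have p2 := h4.2.1
    rw [Real.norm_of_nonneg p1.le, Real.norm_of_nonneg p2.le] at h5 h6
    rw [Real.norm_of_nonneg pb'.le, Real.norm_of_nonneg ps'.le] at h7 h8
    refine ⟨h3, h4, h5.trans ?_, h6.trans ?_, h7, h8⟩
    · have : A₁ ≤ A := (le_max_left _ _).trans (le_max_right _ _)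
      gcongr
    · have : A₂ ≤ A := (le_max_right _ _).trans (le_max_right _ _)
      gcongr
  constructor
  · refine IsBigO.of_bound (C * A ^ b * B₁) ?_
    filter_upwards [hev] with n ⟨h3, h4, h5, h6, h7, h8⟩
    have r1 := (le_max_left t₁ t₂).trans h3.2.2
    have r2 := (le_max_right t₁ t₂).trans h3.2.2
    have r1' := (le_max_left t₁ t₂).trans h4.2.2
    have r2' := (le_max_right t₁ t₂).trans h4.2.2
    obtain ⟨pb, ps⟩ := h₂ n _ h3.1 h3.2.1 r2
    obtain ⟨pb', ps'⟩ := h₂ n _ h4.1 h4.2.1 r2'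
    rw [Real.norm_of_nonneg pb.le, Real.norm_of_nonneg ps.le]
    refine le_of_mul_le_mul_right
      ((hcross n _ _ h3.1 h3.2.1 h4.2.1 r1 r1' r2 r2' h5 h6).trans ?_) ps'
    calc _ ≤ C * A ^ b * (B₁ * spreadTerm S α p q n (τ' n) * spreadTerm S α p q n (τ n)) := by
          gcongr
      _ = _ := by ring
  · refine IsBigO.of_bound (C * A ^ b * B₂) ?_
    filter_upwards [hev] with n ⟨h3, h4, h5, h6, h7, h8⟩
    have r1 := (le_max_left t₁ t₂).trans h3.2.2
    have r2 := (le_max_right t₁ t₂).trans h3.2.2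
    have r1' := (le_max_left t₁ t₂).trans h4.2.2
    have r2' := (le_max_right t₁ t₂).trans h4.2.2
    obtain ⟨pb, ps⟩ := h₂ n _ h3.1 h3.2.1 r2
    obtain ⟨pb', ps'⟩ := h₂ n _ h4.1 h4.2.1 r2'
    rw [Real.norm_of_nonneg pb.le, Real.norm_of_nonneg ps.le]
    refine le_of_mul_le_mul_left
      ((hcross n _ _ h3.1 h4.2.1 h3.2.1 r1' r1 r2' r2 h6 h5).trans ?_) pb'
    calc _ ≤ C * A ^ b * (biasTerm S α β p q n (τ n) * (B₂ * biasTerm S α β p q n (τ' n))) := by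
          gcongr
      _ = _ := by ring

/-- If the scaling is below an optimal one by a power of `n`, then the bias exceeds the spread by
a power of `ρ`. -/
theorem exists_rho_rpow_mul_spread_isBigO (hS : PotterBounded S) (h0 : ∀ i : ℕ, 0 ≤ S (i + 1))
    (hD : 0 < 1 + 2 * α + 2 * p) (hqp : q < p) (hqβ : 0 < q + β) (hτ : IsScaling τ)
    (hτ' : IsScaling τ') {δ : ℝ} (hδ : 0 < δ)
    (h : τ =O[atTop] fun n : ℕ => (n : ℝ) ^ (-δ) * τ' n)
    (hb : (fun n => spreadTerm S α p q n (τ' n)) =O[atTop]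
      fun n => biasTerm S α β p q n (τ' n)) :
    ∃ ε : ℝ, 0 < ε ∧ (fun n => rho α p n (τ n) ^ ε * spreadTerm S α p q n (τ n)) =O[atTop]
      fun n => biasTerm S α β p q n (τ n) := by
  obtain ⟨A, hA, hbig⟩ := h.exists_pos
  have hlim : Tendsto (fun n : ℕ => A * (n : ℝ) ^ (-δ)) atTop (𝓝 (A * 0)) :=
    ((tendsto_rpow_neg_atTop hδ).comp tendsto_natCast_atTop_atTop).const_mul A
  have hle : ∀ᶠ n : ℕ in atTop, 0 < n ∧ 0 < τ n ∧ 0 < τ' n ∧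
      τ n / τ' n ≤ A * (n : ℝ) ^ (-δ) ∧ τ n ≤ τ' n := by
    filter_upwards [hbig.bound, eventually_ge_atTop 1,
      hlim.eventually (gt_mem_nhds (show A * 0 < 1 by simp))] with n h1 h2 h3
    have p1 := hτ.1 n h2
    have p2 := hτ'.1 n h2
    rw [Real.norm_of_nonneg p1.le, Real.norm_of_nonneg (by positivity), ← mul_assoc] at h1
    exact ⟨h2, p1, p2, (div_le_iff₀ p2).2 h1, h1.trans (by nlinarith)⟩
  obtain ⟨a, B, ha, hB, hsp⟩ := exists_spread_le_rpow_mul_bias hS h0 hD hqp hqβ hτ hτ'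
    (hle.mono fun n h => h.2.2.2.2) hb
  obtain ⟨a', C, t₁, ha', hC, ht₁, h₁⟩ := exists_rho_rpow_mul_le (β := β) hS h0 hD hqp hqβ
  obtain ⟨t₂, ht₂, h₂⟩ := exists_terms_pos (β := β) hS h0 hD hqp
  obtain ⟨B', hB', hbig'⟩ := hb.exists_pos
  -- By comparability at `τ'`, this power of `ρ` is at most of the order `n ^ (δ * a)`, which is
  -- the factor that is gained from the distance between the scalings.
  refine ⟨a' * (2 * δ * a), by positivity,
    IsBigO.of_bound ((C * B') ^ (2 * δ * a) * (B * A ^ a)) ?_⟩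
  filter_upwards [hle, hsp, hτ'.eventually hD t₁, hτ'.eventually hD t₂, hτ.eventually hD t₂,
    hbig'.bound] with n ⟨hn, p1, p2, h3, h4⟩ h5 h6 h7 h8 h9
  obtain ⟨pb, ps⟩ := h₂ n _ h8.1 h8.2.1 h8.2.2
  obtain ⟨pb', ps'⟩ := h₂ n _ h7.1 h7.2.1 h7.2.2
  have hn' : (0 : ℝ) < n := by exact_mod_cast hn
  have hρ0 : 0 < rho α p n (τ n) := rho_pos hn p1
  have hρ0' : 0 < rho α p n (τ' n) := rho_pos hn p2
  have hρρ : rho α p n (τ n) ≤ rho α p n (τ' n) := by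
    unfold rho
    gcongr
  rw [Real.norm_of_nonneg pb'.le, Real.norm_of_nonneg ps'.le] at h9
  rw [Real.norm_of_nonneg (by positivity), Real.norm_of_nonneg pb.le]
  have h10 : rho α p n (τ' n) ^ a' ≤ C * B' * √(n : ℝ) := by
    refine le_of_mul_le_mul_left ((h₁ n _ hn p2 h6.2.2).trans ?_) pb'
    calc C * √(n : ℝ) * spreadTerm S α p q n (τ' n)
        ≤ C * √(n : ℝ) * (B' * biasTerm S α β p q n (τ' n)) := by gcongr
      _ = _ := by ring
  have h11 : rho α p n (τ n) ^ (a' * (2 * δ * a)) ≤ (C * B') ^ (2 * δ * a) * (n : ℝ) ^ (δ * a) := by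
    rw [Real.rpow_mul hρ0.le]
    calc (rho α p n (τ n) ^ a') ^ (2 * δ * a) ≤ (C * B' * √(n : ℝ)) ^ (2 * δ * a) := by
          gcongr
          exact le_trans (by gcongr) h10
      _ = _ := by
          rw [Real.mul_rpow (by positivity) (by positivity), Real.sqrt_eq_rpow,
            ← Real.rpow_mul hn'.le]
          congr 2; ring
  have h12 : (τ n / τ' n) ^ a ≤ A ^ a * (n : ℝ) ^ (-(δ * a)) := by
    calc (τ n / τ' n) ^ a ≤ (A * (n : ℝ) ^ (-δ)) ^ a := by gcongr
      _ = _ := by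
          rw [Real.mul_rpow hA.le (by positivity), ← Real.rpow_mul hn'.le]
          congr 2; ring
  calc rho α p n (τ n) ^ (a' * (2 * δ * a)) * spreadTerm S α p q n (τ n)
      ≤ ((C * B') ^ (2 * δ * a) * (n : ℝ) ^ (δ * a))
        * (B * (A ^ a * (n : ℝ) ^ (-(δ * a))) * biasTerm S α β p q n (τ n)) := by
        gcongr
        exact h5.trans (by gcongr)
    _ = (C * B') ^ (2 * δ * a) * (B * A ^ a) * biasTerm S α β p q n (τ n) := by
        rw [Real.rpow_neg hn'.le]
        field_simp

/-- For `τ = 1`, the exponents `min (q + β) D` and `q + α + 1 / 2` of the two terms decide, as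
slowly varying factors are smaller than any power. -/
theorem bias_isLittleO_spread_one (hS : PotterBounded S) (h0 : ∀ i : ℕ, 0 ≤ S (i + 1))
    (hD : 0 < 1 + 2 * α + 2 * p) (hqp : q < p) (hθ : 0 < q + α + 1 / 2) (h : α < β - 1 / 2) :
    (fun n => biasTerm S α β p q n 1) =o[atTop] fun n => spreadTerm S α p q n 1 := by
  set D := 1 + 2 * α + 2 * p with hDdef
  set E := min (q + β) D - (q + α + 1 / 2) with hE
  have hE0 : 0 < E := sub_pos.2 (lt_min (by linarith) (by rw [hDdef] at *; linarith))
  have hU : PotterBounded fun x => biasShape S (q + β) D x / S x := (hS.biasShape h0 _ _).div hS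
  obtain ⟨C, t₁, hC, ht₁, h₁⟩ := hU (E / 2) (by positivity)
  obtain ⟨t₂, ht₂, h₂⟩ := hS.eventually_pos
  have u1 := (h₁ t₁ t₁ le_rfl le_rfl).1
  set u : ℝ → ℝ := fun x => biasShape S (q + β) D x / S x with hu
  change 0 < u t₁ at u1
  refine IsLittleO.of_bound fun η hη => ?_
  have hlim : Tendsto (fun n => C * u t₁ * rho α p n 1 ^ (-(E / 2))) atTop (𝓝 (C * u t₁ * 0)) :=
    ((tendsto_rpow_neg_atTop (half_pos hE0)).comp (tendsto_rho hD IsScaling.one)).const_mul _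
  filter_upwards [IsScaling.one.eventually hD t₁, IsScaling.one.eventually hD t₂,
    hlim.eventually (gt_mem_nhds (show C * u t₁ * 0 < η by simpa using hη))] with n h3 h4 h5
  have hρ0 : 0 < rho α p n 1 := rho_pos h3.1 one_pos
  rw [biasTerm_eq hD h3.1 one_pos, spreadTerm_eq hD hqp h3.1 one_pos, ← hDdef]
  obtain ⟨h6, -, -⟩ := h₁ _ _ h3.2.2 le_rfl
  have h7 := (h₁ t₁ _ le_rfl h3.2.2).2.1
  have h8 := h₂ _ h4.2.2
  set ρ := rho α p n 1
  change 0 < u ρ at h6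
  change u ρ ≤ C * (ρ / t₁) ^ (E / 2) * u t₁ at h7
  have hsh : biasShape S (q + β) D ρ = u ρ * S ρ := by rw [hu]; field_simp
  rw [hsh, abs_of_pos (mul_pos h6 h8), abs_of_pos h8, Real.norm_of_nonneg (by positivity),
    Real.norm_of_nonneg (by positivity)]
  have h9 : (ρ / t₁) ^ (E / 2) ≤ ρ ^ (E / 2) :=
    Real.rpow_le_rpow (by positivity) (div_le_self hρ0.le ht₁) (by positivity)
  calc ρ ^ (-min (q + β) D) * (u ρ * S ρ)
      ≤ ρ ^ (-min (q + β) D) * (C * ρ ^ (E / 2) * u t₁ * S ρ) := by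
        gcongr
        exact h7.trans (by gcongr)
    _ = (C * u t₁ * ρ ^ (-(E / 2))) * (ρ ^ (-(q + α + 1 / 2)) * S ρ) := by
        have : ρ ^ (-min (q + β) D)
            = ρ ^ (-(E / 2)) * ρ ^ (-(E / 2)) * ρ ^ (-(q + α + 1 / 2)) := by
          rw [← Real.rpow_add hρ0, ← Real.rpow_add hρ0]; congr 1; rw [hE]; ring
        rw [this, Real.rpow_neg hρ0.le (E / 2)]
        field_simp
    _ ≤ η * (1 * (ρ ^ (-(q + α + 1 / 2)) * S ρ)) := by
        rw [one_mul]; gcongr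

/-- For `τ = 1` and without saturation, the slowly varying factors of the two terms are the same. -/
theorem biasTerm_one_of_lt (hlt : q + β < 1 + 2 * α + 2 * p) (hD : 0 < 1 + 2 * α + 2 * p)
    (hqp : q < p) {n : ℕ} (hn : 0 < n) :
    biasTerm S α β p q n 1
      = rho α p n 1 ^ (α + 1 / 2 - β) * spreadTerm S α p q n 1 := by
  have hρ0 : 0 < rho α p n 1 := rho_pos hn one_pos
  rw [biasTerm_eq hD hn one_pos, spreadTerm_eq hD hqp hn one_pos, min_eq_left hlt.le, biasShape,
    if_pos hlt, one_mul, ← mul_assoc, ← Real.rpow_add hρ0]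
  congr 2
  ring

end Compare

end LinearCredible

theorem theorem5p3 {E F Ω : Type*}
    [NormedAddCommGroup E] [InnerProductSpace ℝ E] [CompleteSpace E]
    [MeasurableSpace E] [BorelSpace E]
    [NormedAddCommGroup F] [InnerProductSpace ℝ F] [CompleteSpace F]
    [MeasurableSpace Ω] (P : Measure Ω) (Z : F → Ω → ℝ)
    (hZ : LinearCredible.IsIsoGaussian Z P)
    (e : HilbertBasis ℕ ℝ E) (K : E →L[ℝ] F) (Λ R : E →L[ℝ] E) (κ : ℕ → ℝ)
    (L : E → ℝ) (V : Submodule ℝ E) (S : ℝ → ℝ) (α β p q C γ : ℝ)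
    (hα : 0 < α) (hβ : 0 < β) (hp : 0 ≤ p) (hC : 1 ≤ C) (hγ0 : 0 < γ) (hγ1 : γ < 1)
    -- the operators `KᵀK` and `Λ` are diagonal in the basis `e`, and `R = Λ^{1/2}`
    (hK : ∀ i, K.adjoint (K (e i)) = κ i ^ 2 • e i)
    (hκ : ∀ i : ℕ, C⁻¹ * ((i : ℝ) + 1) ^ (-p) ≤ κ i ∧ κ i ≤ C * ((i : ℝ) + 1) ^ (-p))
    (hΛ : ∀ i : ℕ, Λ (e i) = ((i : ℝ) + 1) ^ (-1 - 2 * α) • e i)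
    (hR : R.IsPositive) (hRR : R ∘L R = Λ)
    -- the functional `L` and its representer `l i = L (Λ^{1/2} (e i)) / √(λ i)`
    (hL : LinearCredible.IsMeasurableLinear Λ L V)
    (hV : ∀ μ, LinearCredible.MemSobolev e β μ → μ ∈ V)
    (hS : LinearCredible.SlowlyVarying S)
    (hl : ∀ i : ℕ, |L (R (e i)) / √(((i : ℝ) + 1) ^ (-1 - 2 * α))|
      = ((i : ℝ) + 1) ^ (-q - 1 / 2) * S ((i : ℝ) + 1))
    (hqp : q < p) (hqβ : -β < q) (hqα : -(α + 1 / 2) < q) :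
    -- scaled priors `N(0, τ_n² Λ)`
    (∀ τ τopt : ℕ → ℝ, LinearCredible.IsScaling τ →
      LinearCredible.IsOptimalScaling S α β p q τopt →
      -- (i)
      (τopt =o[atTop] τ →
        LinearCredible.UnifAsympIn
          (fun n μ => LinearCredible.coverage P Z e K Λ R L γ n (τ n) μ)
          {μ | LinearCredible.MemSobolev e β μ ∧ LinearCredible.sobolevNorm e β μ ≤ 1}
          (1 - γ) 1) ∧
      -- (ii)
      (τ =Θ[atTop] τopt →
        (β + q < 1 + 2 * α + 2 * p → ∀ μ, LinearCredible.MemSobolev e β μ →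
          LinearCredible.AsympIn
            (fun n => LinearCredible.coverage P Z e K Λ R L γ n (τ n) μ) (1 - γ) 1) ∧
        (∀ c : ℝ, 0 < c → c < 1 → ∃ μ : ℕ → E, LinearCredible.BddSobolevSeq e β μ ∧
          LinearCredible.AsympIn
            (fun n => LinearCredible.coverage P Z e K Λ R L γ n (τ n) (μ n)) 0 c)) ∧
      -- (iii)
      (τ =o[atTop] τopt →
        ∃ μ : ℕ → E, LinearCredible.BddSobolevSeq e β μ ∧
          Tendsto (fun n => LinearCredible.coverage P Z e K Λ R L γ n (τ n) (μ n)) atTop (𝓝 0)) ∧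
      -- (iii), with a fixed truth
      ((∃ δ : ℝ, 0 < δ ∧ τ =O[atTop] fun n : ℕ => (n : ℝ) ^ (-δ) * τopt n) →
        ∃ μ : E, LinearCredible.MemSobolev e β μ ∧
          Tendsto (fun n => LinearCredible.coverage P Z e K Λ R L γ n (τ n) μ) atTop (𝓝 0))) ∧
    -- no scaling: `τ_n = 1` for every `n`
    (α < β - 1 / 2 →
      LinearCredible.UnifAsympIn
        (fun n μ => LinearCredible.coverage P Z e K Λ R L γ n 1 μ)
        {μ | LinearCredible.MemSobolev e β μ ∧ LinearCredible.sobolevNorm e β μ ≤ 1}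
        (1 - γ) 1) ∧
    (α = β - 1 / 2 →
      (∀ μ, LinearCredible.MemSobolev e β μ →
        LinearCredible.AsympIn
          (fun n => LinearCredible.coverage P Z e K Λ R L γ n 1 μ) (1 - γ) 1) ∧
      (∀ c : ℝ, 0 < c → c < 1 → ∃ μ : ℕ → E, LinearCredible.BddSobolevSeq e β μ ∧
        LinearCredible.AsympIn
          (fun n => LinearCredible.coverage P Z e K Λ R L γ n 1 (μ n)) 0 c)) ∧
    (β - 1 / 2 < α →
      ∃ μ : E, LinearCredible.MemSobolev e β μ ∧
        Tendsto (fun n => LinearCredible.coverage P Z e K Λ R L γ n 1 μ) atTop (𝓝 0)) := by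
  have M : LinearCredible.DiagonalModel e K Λ R κ L V S α β p q C :=
    ⟨hα, hβ, hp, hC, hK, hκ, hΛ, hR, hRR, hL, hV, hS, hl, hqp, hqβ, hqα⟩
  have hS' := M.potter
  have h0 := M.S_nonneg
  have hD := M.D_pos
  have hθ' := M.qβ_pos
  have hone := LinearCredible.IsScaling.one
  refine ⟨fun τ τopt hτ hopt => ⟨fun h => ?_, fun h => ⟨fun hlt μ hμ => ?_, fun c hc _ => ?_⟩,
    fun h => ?_, ?_⟩, fun h => ?_, fun h => ?_, fun h => ?_⟩
  · exact M.unifAsympIn_of_isLittleO hZ hγ0 hγ1 hτ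
      (LinearCredible.bias_isLittleO_spread hS' h0 hD hqp hθ' hopt.1 hτ h hopt.2.1)
  · exact M.asympIn_of_isBigO hZ hγ0 hγ1 hτ
      (LinearCredible.bias_isTheta_spread hS' h0 hD hqp hθ' hτ hopt.1 h hopt.2).1
      (by linarith) hμ
  · exact M.exists_asympIn_of_isTheta hZ hγ0 hγ1 hτ
      (LinearCredible.bias_isTheta_spread hS' h0 hD hqp hθ' hτ hopt.1 h hopt.2) hc
  · exact M.exists_tendsto_zero_of_isLittleO hZ hγ0 hγ1 hτ
      (LinearCredible.spread_isLittleO_bias hS' h0 hD hqp hθ' hτ hopt.1 h hopt.2.2)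
  · rintro ⟨δ, hδ, h⟩
    obtain ⟨ε, hε, hb⟩ := LinearCredible.exists_rho_rpow_mul_spread_isBigO hS' h0 hD hqp hθ' hτ
      hopt.1 hδ h hopt.2.2
    exact M.exists_fixed_tendsto_zero hZ hγ0 hγ1 hτ hε hb
  · exact M.unifAsympIn_of_isLittleO hZ hγ0 hγ1 hone
      (LinearCredible.bias_isLittleO_spread_one hS' h0 hD hqp (by linarith) h)
  · -- the exponents of the two terms agree, and so do the terms
    have heq : (fun n => LinearCredible.biasTerm S α β p q n 1) =ᶠ[atTop]
        fun n => LinearCredible.spreadTerm S α p q n 1 := by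
      filter_upwards [eventually_gt_atTop 0] with n hn
      have e1 : α + 1 / 2 - β = 0 := by linarith
      rw [LinearCredible.biasTerm_one_of_lt (by linarith) hD hqp hn, e1, Real.rpow_zero, one_mul]
    exact ⟨fun μ hμ => M.asympIn_of_isBigO hZ hγ0 hγ1 hone heq.isBigO (by linarith) hμ,
      fun c hc _ => M.exists_asympIn_of_isTheta hZ hγ0 hγ1 hone heq.isTheta hc⟩
  · refine M.exists_fixed_tendsto_zero hZ hγ0 hγ1 hone (ε := α + 1 / 2 - β) (by linarith) ?_
    refine Filter.EventuallyEq.isBigO ?_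
    filter_upwards [eventually_gt_atTop 0] with n hn
    exact (LinearCredible.biasTerm_one_of_lt (by linarith) hD hqp hn).symm
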